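/- **Setting.** Let $f:\{\pm1\}^r\to\{0,1\}$ be a predicate with Fourier coefficients $\hat f(S)=2^{-r}\sum_x f(x)\prod_{\iota\in S}x_\iota$, extended to $\mathbb R^r$ as the multilinear polynomial $\sum_S\hat f(S)\prod_{\iota\in S}x_\iota$, and assume that $f$ has no linear terms, i.e. $\|f^{=1}\|^2=0$, where $\|f^{=j}\|^2=\sum_{|S|=j}\hat f(S)^2$. Put $\xi(s)=\sum_{j=1}^r\|f^{=j}\|^2s^j$. Fix $\delta>0$, $K>0$, let $L=\lfloor 1/\delta\rfloor$, and for $\ell\ge1$ let $$\nu_\ell=\frac{\xi'(\ell\delta)-\xi'((\ell-1)\delta)}{r}.$$ Let $G=(V,E)$ be a finite $r$-uniform directed hypergraph: each $a\in E$ is an ordered list $\partial a$ of $r$ distinct vertices, and $\partial i$ is the set of hyperedges containing $i$. Assume that $G$ is $d$-index-regular (each vertex lies in exactly $d$ hyperedges, and for each $\iota\in[r]$ it is the $\iota$-th vertex of exactly $d/r$ of them) and has girth at least $2L+2$ (the length of a cycle being its number of vertices). For $b\in\partial i$ let $\mathsf D_{i;b}f$ be the partial derivative of $f$ in the coordinate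 at which $i$ occurs in $\partial b$. Let $F_{i\to a,\ell},F_{i,\ell}:\mathbb R^\ell\to[-K,K]$ ($0\le\ell<L$) be measurable functions, which may depend on $d$, on $G$, and on $i$ and $a$. Let $z_i^0\sim\mathcal N(0,\delta)$ be independent for $i\in V$, and put $z_{i\to a}^0=z_i^0$, $w_{i\to a}^0=w_i^0=0$. For $\ell=0,\dots,L-1$ and $a\in\partial i$ define $$A_{i\to a}^\ell=F_{i\to a,\ell}(u_{i\to a}^1,\dots,u_{i\to a}^\ell),\qquad A_i^\ell=F_{i,\ell}(u_i^1,\dots,u_i^\ell),$$ $$w_{i\to a}^{\ell+1}=\frac1{\sqrt{d-1}}\sum_{b\in\partial i\setminus a}\mathsf D_{i;b}f\big((z_{j\to b}^\ell)_{j\in\partial b}\big),\quad u_{i\to a}^{\ell+1}=w_{i\to a}^{\ell+1}-w_{i\to a}^\ell,\quad z_{i\to a}^{\ell+1}=z_{i\to a}^0+\sum_{s=1}^{\ell+1}A_{i\to a}^{s-1}u_{i\to a}^s,$$ $$w_i^{\ell+1}=\frac1{\sqrt d}\sum_{b\in\partial i}\mathsf D_{i;b}f\big((z_{j\to b}^\ell)_{j\in\partial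 b}\big),\qquad u_i^{\ell+1}=w_i^{\ell+1}-w_i^\ell .$$ **Theorem (state evolution).** Assume that $\mathbb E[(A_i^\ell)^2]=\mathbb E[(A_{i\to a}^\ell)^2]=\delta/\nu_{\ell+1}$ for all $0\le\ell<L$, all $i\in V$ and all $a\in\partial i$. Let $1\le\ell\le L$ and let $\psi:\mathbb R^\ell\to\mathbb R$ be pseudo-Lipschitz, i.e. for some $C>0$, $|\psi(x)-\psi(y)|\le C(1+\|x\|+\|y\|)\|x-y\|$ for all $x,y\in\mathbb R^\ell$. Then for every $i\in V$ and $a\in\partial i$, as $d\to\infty$, $$\mathbb E[\psi(u_{i\to a}^1,\dots,u_{i\to a}^\ell)]=\mathbb E[\psi(U_1,\dots,U_\ell)]+o_d(1),\qquad \mathbb E[\psi(u_i^1,\dots,u_i^\ell)]=\mathbb E[\psi(U_1,\dots,U_\ell)]+o_d(1),$$ where $U_s\sim\mathcal N(0,\nu_s)$ are independent. (All expectations exist for large $d$, and the $o_d(1)$ terms are bounded by a function of $d$ that tends to $0$ and depends only on $f,\delta,K,\ell,\psi$, not on $G$, the nonlinearities, $i$ or $a$.) -/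

import Mathlib

open MeasureTheory ProbabilityTheory

namespace CSP

/-! ### Predicates on the discrete cube and their Fourier expansion -/

/-- The Fourier coefficient `E_x [f(x) ∏_{ι ∈ S} x_ι]`, with `x` uniform in `{±1}^r`. -/
noncomputable def cubeFourierCoeff {r : ℕ} (f : (Fin r → ℤˣ) → ℝ) (S : Finset (Fin r)) : ℝ :=
  (∑ x : Fin r → ℤˣ, f x * ∏ ι ∈ S, ((x ι : ℤ) : ℝ)) / 2 ^ r

/-- The multilinear polynomial that represents `f`, as a function on `ℝ^r`. -/
noncomputable def multilinearExt {r : ℕ} (f : (Fin r → ℤˣ) → ℝ) (x : Fin r → ℝ) : ℝ :=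
  ∑ S : Finset (Fin r), cubeFourierCoeff f S * ∏ ι ∈ S, x ι

/-- The partial derivative of (the multilinear extension of) `f` in the coordinate `ι`. -/
noncomputable def partialDeriv {r : ℕ} (f : (Fin r → ℤˣ) → ℝ) (ι : Fin r) (x : Fin r → ℝ) : ℝ :=
  deriv (fun t : ℝ => multilinearExt f (Function.update x ι t)) (x ι)

/-- The Fourier weight `‖f^{=j}‖²` of `f` at degree `j`. -/
noncomputable def fourierWeight {r : ℕ} (f : (Fin r → ℤˣ) → ℝ) (j : ℕ) : ℝ :=
  ∑ S ∈ Finset.powersetCard j (Finset.univ : Finset (Fin r)), cubeFourierCoeff f S ^ 2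

/-- The polynomial `ξ(s) = ∑_{j=1}^r ‖f^{=j}‖² s^j`. -/
noncomputable def mixture {r : ℕ} (f : (Fin r → ℤˣ) → ℝ) : Polynomial ℝ :=
  ∑ j ∈ Finset.Icc 1 r, Polynomial.C (fourierWeight f j) * Polynomial.X ^ j

/-- `ν_ℓ = (ξ'(ℓδ) - ξ'((ℓ-1)δ)) / r`, for `ℓ ≥ 1`. -/
noncomputable def nu {r : ℕ} (f : (Fin r → ℤˣ) → ℝ) (δ : ℝ) (ℓ : ℕ) : ℝ :=
  ((mixture f).derivative.eval ((ℓ : ℝ) * δ)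
    - (mixture f).derivative.eval (((ℓ : ℝ) - 1) * δ)) / r

/-- `ν_ℓ` is a legitimate variance. -/
theorem nu_nonneg {r : ℕ} (f : (Fin r → ℤˣ) → ℝ) {δ : ℝ} (hδ : 0 ≤ δ) {ℓ : ℕ} (hℓ : 1 ≤ ℓ) :
    0 ≤ nu f δ ℓ := by
  have h1 : (1 : ℝ) ≤ ℓ := by exact_mod_cast hℓ
  have h0 : 0 ≤ ((ℓ : ℝ) - 1) * δ := mul_nonneg (by linarith) hδ
  have hle : ((ℓ : ℝ) - 1) * δ ≤ (ℓ : ℝ) * δ := by nlinarith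
  unfold nu mixture
  apply div_nonneg _ (Nat.cast_nonneg r)
  rw [sub_nonneg]
  simp only [Polynomial.derivative_sum, Polynomial.eval_finsetSum,
    Polynomial.derivative_C_mul_X_pow, Polynomial.eval_mul, Polynomial.eval_C,
    Polynomial.eval_pow, Polynomial.eval_X]
  refine Finset.sum_le_sum fun j _ => ?_
  have hw : 0 ≤ fourierWeight f j := Finset.sum_nonneg fun _ _ => sq_nonneg _
  gcongr

/-! ### Directed hypergraphs -/

/-- An `r`-uniform directed hypergraph with vertex set `V` and (labelled) hyperedge set `E`: the
hyperedge `e` is the ordered list `∂e = [scope e 0, …, scope e (r-1)]` of `r` distinct vertices. -/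
structure DirectedHypergraph (r : ℕ) (V E : Type) where
  scope : E → Fin r → V
  scope_injective : ∀ e, Function.Injective (scope e)

namespace DirectedHypergraph

variable {r : ℕ} {V E : Type}

/-- The set `∂i` of hyperedges that contain the vertex `i`. -/
def incident [DecidableEq V] [Fintype E] (G : DirectedHypergraph r V E) (i : V) : Finset E :=
  {e | ∃ ι, G.scope e ι = i}

/-- Every vertex lies in `d` hyperedges, and for each `ι` it is the `ι`-th vertex of exactly `d / r`
of them. -/
def IsIndexRegular [DecidableEq V] [Fintype E] (G : DirectedHypergraph r V E) (d : ℕ) : Prop :=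
  ∀ v, (G.incident v).card = d ∧
    ∀ ι : Fin r, r * (Finset.univ.filter fun e => G.scope e ι = v).card = d

/-- The factor graph: the bipartite graph that joins each hyperedge to the vertices it contains. -/
def factorGraph (G : DirectedHypergraph r V E) : SimpleGraph (V ⊕ E) :=
  SimpleGraph.fromRel fun x y =>
    match x, y with
    | Sum.inl v, Sum.inr e => ∃ ι, G.scope e ι = v
    | _, _ => False

/-- The girth is at least `g`, where the length of a cycle of the hypergraph is the number of its
vertices, that is, half the length of the corresponding cycle of the factor graph. -/
def GirthAtLeast (G : DirectedHypergraph r V E) (g : ℕ) : Prop :=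
  ((2 * g : ℕ) : ℕ∞) ≤ G.factorGraph.egirth

/-- `D_{i;b} f`: the partial derivative of `f` in the coordinate at which `i` occurs in `∂b`. For
`i ∈ ∂b` the sum has exactly one term. -/
noncomputable def partialAt [DecidableEq V] (G : DirectedHypergraph r V E)
    (f : (Fin r → ℤˣ) → ℝ) (i : V) (b : E) (x : Fin r → ℝ) : ℝ :=
  ∑ ι with G.scope b ι = i, partialDeriv f ι x

end DirectedHypergraph

/-! ### The message-passing algorithm -/

/-- The node-to-factor quantities after some iteration: the current `w_{i → a}` and `z_{i → a}`, and
the history `s ↦ u_{i → a}^s`. Only the values at pairs with `i ∈ ∂a` are meaningful. -/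
structure MsgState (V E : Type) where
  w : V → E → ℝ
  z : V → E → ℝ
  u : ℕ → V → E → ℝ

section Algorithm

variable {r : ℕ} {V E : Type} [DecidableEq V] [Fintype E] [DecidableEq E]

/-- `ℓ` iterations of the algorithm on `G`, with predicate `f`, degree `d`, nonlinearities
`F ℓ i a : ℝ^ℓ → ℝ` for the messages from `i` to `a`, and initialization `z0`. -/
noncomputable def msgState (G : DirectedHypergraph r V E) (f : (Fin r → ℤˣ) → ℝ) (d : ℕ)
    (F : (ℓ : ℕ) → V → E → (Fin ℓ → ℝ) → ℝ) (z0 : V → ℝ) : ℕ → MsgState V E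
  | 0 => { w := fun _ _ => 0, z := fun i _ => z0 i, u := fun _ _ _ => 0 }
  | ℓ + 1 =>
    let st := msgState G f d F z0 ℓ
    let w' : V → E → ℝ := fun i a =>
      1 / √((d : ℝ) - 1) *
        ∑ b ∈ G.incident i \ {a}, G.partialAt f i b (fun ι => st.z (G.scope b ι) b)
    let u' : V → E → ℝ := fun i a => w' i a - st.w i a
    { w := w'
      z := fun i a => st.z i a + F ℓ i a (fun s => st.u (s + 1) i a) * u' i a
      u := Function.update st.u (ℓ + 1) u' }

variable (G : DirectedHypergraph r V E) (f : (Fin r → ℤˣ) → ℝ) (d : ℕ)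
  (F : (ℓ : ℕ) → V → E → (Fin ℓ → ℝ) → ℝ) (FN : (ℓ : ℕ) → V → (Fin ℓ → ℝ) → ℝ)
  (z0 : V → ℝ) (ℓ : ℕ) (i : V) (a : E)

/-- `w_{i → a}^ℓ` -/
noncomputable def msgW : ℝ := (msgState G f d F z0 ℓ).w i a

/-- `z_{i → a}^ℓ` -/
noncomputable def msgZ : ℝ := (msgState G f d F z0 ℓ).z i a

/-- The node-to-factor message `u_{i → a}^ℓ`, for `ℓ ≥ 1`. -/
noncomputable def msgU : ℝ := (msgState G f d F z0 ℓ).u ℓ i a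

/-- `A_{i → a}^ℓ`, the nonlinearity evaluated at `u_{i → a}^1, …, u_{i → a}^ℓ`. -/
noncomputable def msgA : ℝ := F ℓ i a fun s => msgU G f d F z0 (s + 1) i a

/-- `w_i^ℓ` -/
noncomputable def nodeW : ℕ → V → ℝ
  | 0, _ => 0
  | ℓ + 1, i =>
    1 / √(d : ℝ) *
      ∑ b ∈ G.incident i, G.partialAt f i b (fun ι => msgZ G f d F z0 ℓ (G.scope b ι) b)

/-- The node message `u_i^ℓ = w_i^ℓ - w_i^{ℓ-1}`, for `ℓ ≥ 1`. -/
noncomputable def nodeU : ℝ := nodeW G f d F z0 ℓ i - nodeW G f d F z0 (ℓ - 1) i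

/-- `A_i^ℓ`, the node nonlinearity evaluated at `u_i^1, …, u_i^ℓ`. -/
noncomputable def nodeA : ℝ := FN ℓ i fun s => nodeU G f d F z0 (s + 1) i

/-! The defining equations of the algorithm. -/

theorem msgW_zero : msgW G f d F z0 0 i a = 0 := rfl

theorem msgZ_zero : msgZ G f d F z0 0 i a = z0 i := rfl

theorem msgW_succ : msgW G f d F z0 (ℓ + 1) i a =
    1 / √((d : ℝ) - 1) *
      ∑ b ∈ G.incident i \ {a},
        G.partialAt f i b (fun ι => msgZ G f d F z0 ℓ (G.scope b ι) b) := rfl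

theorem msgU_succ : msgU G f d F z0 (ℓ + 1) i a =
    msgW G f d F z0 (ℓ + 1) i a - msgW G f d F z0 ℓ i a := by
  simp [msgU, msgW, msgState]

theorem msgState_u {s : ℕ} (hs : s ≤ ℓ) :
    (msgState G f d F z0 ℓ).u s i a = msgU G f d F z0 s i a := by
  induction ℓ with
  | zero => obtain rfl : s = 0 := by omega
            rfl
  | succ k ih =>
    rcases Nat.lt_or_ge k s with h | h
    · obtain rfl : s = k + 1 := by omega
      rfl
    · rw [← ih h]
      simp [msgState, Function.update_of_ne (show s ≠ k + 1 by omega)]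

theorem msgZ_succ : msgZ G f d F z0 (ℓ + 1) i a =
    msgZ G f d F z0 ℓ i a + msgA G f d F z0 ℓ i a * msgU G f d F z0 (ℓ + 1) i a := by
  have h : (fun s : Fin ℓ => msgU G f d F z0 (s + 1) i a)
      = fun s : Fin ℓ => (msgState G f d F z0 ℓ).u (s + 1) i a :=
    funext fun s => (msgState_u G f d F z0 ℓ i a (by omega)).symm
  rw [msgA, h, msgU_succ]
  rfl

theorem msgZ_eq_sum : msgZ G f d F z0 ℓ i a =
    z0 i + ∑ s ∈ Finset.Icc 1 ℓ, msgA G f d F z0 (s - 1) i a * msgU G f d F z0 s i a := by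
  induction ℓ with
  | zero => simp [msgZ_zero]
  | succ k ih =>
    rw [msgZ_succ, ih, Finset.sum_Icc_succ_top (by omega), add_assoc]
    simp

end Algorithm

/-! ### The probabilistic setting -/

/-- The law of the initialization: the `z_i^0` are i.i.d. `N(0, δ)`. All quantities of the algorithm
are functions of the initialization, so this is the underlying probability space. -/
noncomputable def initLaw (V : Type) [Fintype V] (δ : ℝ) : Measure (V → ℝ) :=
  Measure.pi fun _ => gaussianReal 0 δ.toNNReal

/-- The law of `(U_1, …, U_ℓ)`, with independent `U_s ∼ N(0, ν_s)`. -/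
noncomputable def limitLaw {r : ℕ} (f : (Fin r → ℤˣ) → ℝ) (δ : ℝ) (ℓ : ℕ) :
    Measure (Fin ℓ → ℝ) :=
  Measure.pi fun s => gaussianReal 0 (nu f δ (s + 1)).toNNReal

/-- Pseudo-Lipschitz functions on `ℝ^s` with its Euclidean norm. -/
def PseudoLipschitz {s : ℕ} (ψ : EuclideanSpace ℝ (Fin s) → ℝ) : Prop :=
  ∃ C : ℝ, 0 < C ∧ ∀ x y, |ψ x - ψ y| ≤ C * (1 + ‖x‖ + ‖y‖) * ‖x - y‖

/-- Normalization of the second moments: `E[(A_i^ℓ)²] = E[(A_{i → a}^ℓ)²] = δ / ν_{ℓ+1}` for all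
`ℓ < L`, all variables `i` and all factors `a ∈ ∂i`. -/
def SecondMomentNormalized {r : ℕ} {V E : Type} [Fintype V] [DecidableEq V] [Fintype E]
    [DecidableEq E] (G : DirectedHypergraph r V E) (f : (Fin r → ℤˣ) → ℝ) (d : ℕ)
    (F : (ℓ : ℕ) → V → E → (Fin ℓ → ℝ) → ℝ) (FN : (ℓ : ℕ) → V → (Fin ℓ → ℝ) → ℝ)
    (δ : ℝ) (L : ℕ) : Prop :=
  ∀ ℓ < L, ∀ i, ∀ a ∈ G.incident i,
    ∫ z0, nodeA G f d F FN z0 ℓ i ^ 2 ∂(initLaw V δ) = δ / nu f δ (ℓ + 1) ∧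
    ∫ z0, msgA G f d F z0 ℓ i a ^ 2 ∂(initLaw V δ) = δ / nu f δ (ℓ + 1)

end CSP

/-!
The girth condition makes the messages that enter a vertex functions of the initial values in a
tree, so that messages through different hyperedges, and messages of different vertices of one
hyperedge, are independent (`disjoint_sphere_children`, `integral_prod_of_dependsOn`). The new
increment of a message at step `s` comes from the initial values at distance exactly `s` in that
tree. Because `f` has no linear terms, it is orthogonal to every random variable that does not
involve those values (`Setting.orthogonalX`, `Setting.integral_Y_mul`): the sequences of messages
are exact martingales, and increments at different steps are uncorrelated.

Fourth moments are bounded uniformly in the degree (`Setting.exists_integral_X_pow_four_le`). Second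
moments are computed by induction on the step. By orthogonality,
`E[(A u)²] = (d - 1)⁻¹ ∑ E[A² Y²]`, where the `Y` are the contributions to `u` of the hyperedges; as
these are independent, the law of large numbers replaces each `Y²` by its mean, whatever the
measurable bounded multiplier `A` is (`Setting.abs_integral_A_mul_sub_le`). The Fourier expansion of
`f` and index regularity express the average of `E[Y²]` through the second moments of the previous
messages (`Setting.incrementsConverge_of_secondMomentsConverge`); the normalization of `A` then adds
exactly `δ` to the second moment of a message at each step, up to `O(1 / √d)`
(`Setting.secondMomentsConverge`). If some `ν` vanishes, then `f` is constant and every increment is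
zero.

Each linear combination of the increments of one message is thus a normalized sum of independent
centered variables with bounded fourth moments and known variance, so its characteristic function is
close to a Gaussian one, uniformly over all instances (`Setting.norm_charFun_sumLaw_sub_le`). Lévy's
theorem, applied to a putative sequence of counterexamples, and truncation with the fourth moment
bound give the convergence for pseudo-Lipschitz test functions
(`exists_forall_abs_integral_sub_le`).
-/

/-! ### Paths below the girth -/

namespace SimpleGraph

variable {α : Type*} {G : SimpleGraph α}

/-- Two paths with the same ends whose lengths add up to less than the girth coincide: the graph
formed by their edges has too few edges to contain a cycle. -/
theorem path_unique_of_length_add_lt_egirth {u v : α} {p q : G.Walk u v} (hp : p.IsPath)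
    (hq : q.IsPath) (h : ((p.length + q.length : ℕ) : ℕ∞) < G.egirth) : p = q := by
  classical
  set H : SimpleGraph α := fromEdgeSet {e | e ∈ p.edges ∨ e ∈ q.edges} with hH
  have hle : H ≤ G := by
    intro x y hxy
    rw [hH, fromEdgeSet_adj] at hxy
    rcases hxy.1 with h' | h'
    · exact p.adj_of_mem_edges h'
    · exact q.adj_of_mem_edges h'
  have hac : H.IsAcyclic := by
    intro x c hc
    have h1 : G.egirth ≤ c.length := by
      have := egirth_le_length (hc.mapLe hle)
      simpa using this
    have h2 : c.length ≤ p.length + q.length := by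
      have hsub : c.edges.toFinset ⊆ (p.edges ++ q.edges).toFinset := by
        intro e he
        have := c.edges_subset_edgeSet (List.mem_toFinset.1 he)
        rw [hH, edgeSet_fromEdgeSet] at this
        simpa using this.1
      have := Finset.card_le_card hsub
      rw [List.toFinset_card_of_nodup hc.isTrail.edges_nodup] at this
      have h3 := this.trans (List.toFinset_card_le _)
      simpa using h3
    exact absurd (h1.trans (by exact_mod_cast h2)) (not_le.2 h)
  have hpe : ∀ e ∈ p.edges, e ∈ H.edgeSet := fun e he => by
    rw [hH, edgeSet_fromEdgeSet]
    exact ⟨Or.inl he, G.not_isDiag_of_mem_edgeSet (p.edges_subset_edgeSet he)⟩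
  have hqe : ∀ e ∈ q.edges, e ∈ H.edgeSet := fun e he => by
    rw [hH, edgeSet_fromEdgeSet]
    exact ⟨Or.inr he, G.not_isDiag_of_mem_edgeSet (q.edges_subset_edgeSet he)⟩
  have key := congrArg Subtype.val
    ((hac.subsingleton_path u v).elim ⟨p.transfer H hpe, hp.transfer hpe⟩
      ⟨q.transfer H hqe, hq.transfer hqe⟩)
  have := congrArg Walk.support key
  simp only [Walk.support_transfer] at this
  exact Walk.support_injective this

/-- Below the girth, the endpoint of an edge out of `u` that a path from `u` does not use as its
first edge is not on the path. -/
theorem notMem_support_of_length_lt_egirth {u v w : α} {p : G.Walk u v} (hp : p.IsPath)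
    (huw : G.Adj u w) (he : s(u, w) ∉ p.edges) (h : ((p.length + 1 : ℕ) : ℕ∞) < G.egirth) :
    w ∉ p.support := by
  classical
  intro hw
  have hq := hp.takeUntil hw
  have hc : (Walk.cons huw.symm (p.takeUntil w hw)).IsCycle := by
    rw [Walk.cons_isCycle_iff]
    refine ⟨hq, fun h' => he ?_⟩
    rw [Sym2.eq_swap]
    exact p.edges_takeUntil_subset_edges hw h'
  have h1 := egirth_le_length hc
  have h2 : (p.takeUntil w hw).length ≤ p.length := p.length_takeUntil_le_length hw
  rw [Walk.length_cons] at h1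
  exact absurd (h1.trans (by exact_mod_cast Nat.add_le_add_right h2 1)) (not_le.2 h)

end SimpleGraph

/-! ### Trees of messages in the hypergraph -/

namespace CSP
namespace DirectedHypergraph

variable {r : ℕ} {V E : Type} {G : DirectedHypergraph r V E} {L : ℕ}

theorem factorGraph_adj (b : E) (ι : Fin r) :
    G.factorGraph.Adj (Sum.inl (G.scope b ι)) (Sum.inr b) := by
  simp [factorGraph]

/-- The vertices at distance `k` from `i` in the tree of messages that enter the message from `i`
to `a`: those joined to `i` by a path of length `2k` of the factor graph that avoids `a`. -/
def sphere (G : DirectedHypergraph r V E) (k : ℕ) (i : V) (a : E) : Set V :=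
  {v | ∃ p : G.factorGraph.Walk (Sum.inl i) (Sum.inl v),
    p.IsPath ∧ p.length = 2 * k ∧ Sum.inr a ∉ p.support}

/-- The vertices at distance less than `s` from `i` in the tree of messages that enter the message
from `i` to `a`. -/
def ball (G : DirectedHypergraph r V E) (s : ℕ) (i : V) (a : E) : Set V :=
  {v | ∃ k < s, v ∈ G.sphere k i a}

theorem mem_sphere_zero (i : V) (a : E) : i ∈ G.sphere 0 i a :=
  ⟨SimpleGraph.Walk.nil, by simp⟩

theorem sphere_subset_ball {k s : ℕ} (h : k < s) (i : V) (a : E) :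
    G.sphere k i a ⊆ G.ball s i a := fun _ hv => ⟨k, h, hv⟩

theorem ball_mono {s t : ℕ} (h : s ≤ t) (i : V) (a : E) : G.ball s i a ⊆ G.ball t i a :=
  fun _ ⟨k, hk, hv⟩ => ⟨k, hk.trans_le h, hv⟩

/-- A path witnessing membership in a sphere of a child extends to a path from the parent. -/
theorem exists_extended_path (hG : G.GirthAtLeast (2 * L + 2)) {k : ℕ} (hk : k < L) {b : E}
    {ι κ : Fin r} (hκ : κ ≠ ι) {v : V} (hv : v ∈ G.sphere k (G.scope b κ) b) :
    ∃ q : G.factorGraph.Walk (Sum.inl (G.scope b κ)) (Sum.inl v),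
      (SimpleGraph.Walk.cons (factorGraph_adj b ι)
        (SimpleGraph.Walk.cons (factorGraph_adj b κ).symm q)).IsPath ∧ q.length = 2 * k ∧
      Sum.inr b ∉ q.support := by
  obtain ⟨q, hq, hlen, hb⟩ := hv
  refine ⟨q, ?_, hlen, hb⟩
  have hne : G.scope b ι ≠ G.scope b κ := fun h => hκ (G.scope_injective b h).symm
  have h1 : (SimpleGraph.Walk.cons (factorGraph_adj b κ).symm q).IsPath :=
    (SimpleGraph.Walk.cons_isPath_iff _ _).2 ⟨hq, hb⟩
  refine (SimpleGraph.Walk.cons_isPath_iff _ _).2 ⟨h1, ?_⟩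
  apply SimpleGraph.notMem_support_of_length_lt_egirth h1 (factorGraph_adj b ι).symm
  · rw [SimpleGraph.Walk.edges_cons, List.mem_cons, not_or]
    refine ⟨by simp [hne], fun h => hb (q.fst_mem_support_of_mem_edges h)⟩
  · refine lt_of_lt_of_le ?_ hG
    rw [SimpleGraph.Walk.length_cons, hlen]
    exact_mod_cast (by omega)

theorem sphere_child_subset (hG : G.GirthAtLeast (2 * L + 2)) {k : ℕ} (hk : k < L) {a b : E}
    (hab : b ≠ a) {ι κ ι' : Fin r} (hκ : κ ≠ ι) (ha : G.scope a ι' = G.scope b ι) :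
    G.sphere k (G.scope b κ) b ⊆ G.sphere (k + 1) (G.scope b ι) a := by
  intro v hv
  obtain ⟨q, hq, hlen, -⟩ := exists_extended_path hG hk hκ hv
  refine ⟨_, hq, by simp [hlen]; ring, ?_⟩
  apply SimpleGraph.notMem_support_of_length_lt_egirth hq (ha ▸ factorGraph_adj a ι')
  · have h2 := ((SimpleGraph.Walk.cons_isPath_iff _ _).1 hq).2
    rw [SimpleGraph.Walk.edges_cons, List.mem_cons, not_or]
    refine ⟨by simp [hab.symm], fun h => h2 (SimpleGraph.Walk.fst_mem_support_of_mem_edges _ h)⟩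
  · refine lt_of_lt_of_le ?_ hG
    simp only [SimpleGraph.Walk.length_cons, hlen]
    exact_mod_cast (by omega)

theorem disjoint_sphere (hG : G.GirthAtLeast (2 * L + 2)) {k l : ℕ} (hk : k ≤ L) (hl : l ≤ L)
    (hkl : k ≠ l) (i : V) (a : E) : Disjoint (G.sphere k i a) (G.sphere l i a) := by
  rw [Set.disjoint_left]
  rintro v ⟨p, hp, hpl, -⟩ ⟨q, hq, hql, -⟩
  have : p = q := SimpleGraph.path_unique_of_length_add_lt_egirth hp hq <| by
    refine lt_of_lt_of_le ?_ hG
    exact_mod_cast (by omega)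
  subst this
  omega

theorem disjoint_sphere_ball (hG : G.GirthAtLeast (2 * L + 2)) {s : ℕ} (hs : s ≤ L) (i : V)
    (a : E) : Disjoint (G.sphere s i a) (G.ball s i a) := by
  rw [Set.disjoint_left]
  rintro v hv ⟨k, hk, hv'⟩
  exact Set.disjoint_left.1 (disjoint_sphere hG hs (hk.le.trans hs) hk.ne' i a) hv hv'

/-- The trees hanging off different children of the same vertex are disjoint. -/
theorem disjoint_sphere_children (hG : G.GirthAtLeast (2 * L + 2)) {k l : ℕ} (hk : k < L)
    (hl : l < L) {b c : E} {ι κ ι' κ' : Fin r} (hκ : κ ≠ ι) (hκ' : κ' ≠ ι')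
    (h : G.scope b ι = G.scope c ι') (hne : b = c → κ ≠ κ') :
    Disjoint (G.sphere k (G.scope b κ) b) (G.sphere l (G.scope c κ') c) := by
  rw [Set.disjoint_left]
  intro v hv hv'
  obtain ⟨p, hp, hpl, -⟩ := exists_extended_path hG hk hκ hv
  obtain ⟨q, hq, hql, -⟩ := exists_extended_path hG hl hκ' hv'
  have key := SimpleGraph.path_unique_of_length_add_lt_egirth hp
    (q := (SimpleGraph.Walk.cons (factorGraph_adj c ι')
        (SimpleGraph.Walk.cons (factorGraph_adj c κ').symm q)).copy (congrArg Sum.inl h.symm) rfl)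
    (by simpa using hq) <| by
      refine lt_of_lt_of_le ?_ hG
      simp only [SimpleGraph.Walk.length_cons, SimpleGraph.Walk.length_copy, hpl, hql]
      exact_mod_cast (by omega)
  have hs := congrArg SimpleGraph.Walk.support key
  simp only [SimpleGraph.Walk.support_copy, SimpleGraph.Walk.support_cons] at hs
  have h1 : b = c := by simp at hs; exact hs.2.1
  have hs' : p.support = q.support := by simp at hs; exact hs.2.2
  rw [← p.cons_tail_support, ← q.cons_tail_support] at hs'
  have h2 : G.scope b κ = G.scope c κ' := by simpa using (List.cons.inj hs').1
  subst h1
  exact hne rfl (G.scope_injective b h2)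

end DirectedHypergraph

/-! ### Random variables with all moments -/

/-- A real random variable all of whose moments are finite. -/
structure HasAllMoments {Ω : Type*} [MeasurableSpace Ω] (X : Ω → ℝ) (P : Measure Ω) : Prop where
  measurable : Measurable X
  memLp : ∀ p : ENNReal, p ≠ ⊤ → MemLp X p P

namespace HasAllMoments

variable {Ω : Type*} [MeasurableSpace Ω] {P : Measure Ω} {X Y : Ω → ℝ}

theorem integrable (hX : HasAllMoments X P) : Integrable X P :=
  memLp_one_iff_integrable.1 (hX.memLp 1 (by simp))

theorem add (hX : HasAllMoments X P) (hY : HasAllMoments Y P) :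
    HasAllMoments (fun ω => X ω + Y ω) P :=
  ⟨hX.1.add hY.1, fun p hp => (hX.2 p hp).add (hY.2 p hp)⟩

theorem sub (hX : HasAllMoments X P) (hY : HasAllMoments Y P) :
    HasAllMoments (fun ω => X ω - Y ω) P :=
  ⟨hX.1.sub hY.1, fun p hp => (hX.2 p hp).sub (hY.2 p hp)⟩

theorem const_mul (hX : HasAllMoments X P) (c : ℝ) : HasAllMoments (fun ω => c * X ω) P :=
  ⟨hX.1.const_mul c, fun p hp => (hX.2 p hp).const_mul c⟩

theorem mul (hX : HasAllMoments X P) (hY : HasAllMoments Y P) :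
    HasAllMoments (fun ω => X ω * Y ω) P := by
  refine ⟨hX.1.mul hY.1, fun p hp => ?_⟩
  have h : ENNReal.HolderTriple (2 * p) (2 * p) p := ⟨by
    rw [ENNReal.mul_inv (by simp) (by simp), ← add_mul, ENNReal.inv_two_add_inv_two, one_mul]⟩
  have h2 : 2 * p ≠ ⊤ := ENNReal.mul_ne_top (by simp) hp
  exact (hY.2 _ h2).mul' (hX.2 _ h2)

variable [IsProbabilityMeasure P]

theorem of_bound (hX : Measurable X) {C : ℝ} (h : ∀ ω, |X ω| ≤ C) : HasAllMoments X P :=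
  ⟨hX, fun _ _ => MemLp.of_bound hX.aestronglyMeasurable C (Filter.Eventually.of_forall h)⟩

theorem const (c : ℝ) : HasAllMoments (fun _ : Ω => c) P :=
  of_bound measurable_const (fun _ => le_rfl)

theorem pow (hX : HasAllMoments X P) (n : ℕ) : HasAllMoments (fun ω => X ω ^ n) P := by
  induction n with
  | zero => simpa using const 1
  | succ n ih => simpa only [pow_succ] using ih.mul hX

theorem finset_sum {ι : Type*} {s : Finset ι} {X : ι → Ω → ℝ}
    (h : ∀ i ∈ s, HasAllMoments (X i) P) : HasAllMoments (fun ω => ∑ i ∈ s, X i ω) P := by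
  classical
  induction s using Finset.induction_on with
  | empty => simpa using const 0
  | insert i s hi ih =>
    simp only [Finset.sum_insert hi]
    exact (h i (Finset.mem_insert_self i s)).add
      (ih fun j hj => h j (Finset.mem_insert_of_mem hj))

theorem finset_prod {ι : Type*} {s : Finset ι} {X : ι → Ω → ℝ}
    (h : ∀ i ∈ s, HasAllMoments (X i) P) : HasAllMoments (fun ω => ∏ i ∈ s, X i ω) P := by
  classical
  induction s using Finset.induction_on with
  | empty => simpa using const 1
  | insert i s hi ih =>
    simp only [Finset.prod_insert hi]
    exact (h i (Finset.mem_insert_self i s)).mul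
      (ih fun j hj => h j (Finset.mem_insert_of_mem hj))

end HasAllMoments

/-! ### Functions of disjoint sets of independent coordinates -/

section DependsOn

theorem dependsOn_map₂ {V β γ ε : Type*} {α : V → Type*} {X : (Π v, α v) → β} {Y : (Π v, α v) → γ}
    {S : Set V} (hX : DependsOn X S) (hY : DependsOn Y S) (g : β → γ → ε) :
    DependsOn (fun ω => g (X ω) (Y ω)) S := fun x y h => by
  simp only [hX h, hY h]

theorem dependsOn_map {V β γ : Type*} {α : V → Type*} {X : (Π v, α v) → β}
    {S : Set V} (hX : DependsOn X S) (g : β → γ) :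
    DependsOn (fun ω => g (X ω)) S := fun x y h => by
  simp only [hX h]

theorem dependsOn_finset_sum {V ι β : Type*} [AddCommMonoid β] {α : V → Type*}
    {X : ι → (Π v, α v) → β} {S : Set V} {s : Finset ι} (hX : ∀ i ∈ s, DependsOn (X i) S) :
    DependsOn (fun ω => ∑ i ∈ s, X i ω) S := fun _ _ h =>
  Finset.sum_congr rfl fun i hi => hX i hi h

theorem dependsOn_finset_prod {V ι β : Type*} [CommMonoid β] {α : V → Type*}
    {X : ι → (Π v, α v) → β} {S : Set V} {s : Finset ι} (hX : ∀ i ∈ s, DependsOn (X i) S) :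
    DependsOn (fun ω => ∏ i ∈ s, X i ω) S := fun _ _ h =>
  Finset.prod_congr rfl fun i hi => hX i hi h

theorem exists_measurable_factor {V : Type*} [Fintype V] {β : Type*} [MeasurableSpace β]
    {X : (V → ℝ) → β} {S : Set V} [DecidablePred (· ∈ S)] (hX : DependsOn X S)
    (hXm : Measurable X) : ∃ g : (S.toFinset → ℝ) → β, Measurable g ∧
      X = g ∘ fun ω (i : S.toFinset) => ω i := by
  classical
  refine ⟨fun x => X fun v => if h : v ∈ S.toFinset then x ⟨v, h⟩ else 0, ?_, ?_⟩
  · refine hXm.comp (measurable_pi_lambda _ fun v => ?_)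
    by_cases h : v ∈ S.toFinset
    · simpa [h] using measurable_pi_apply (X := fun _ : S.toFinset => ℝ) ⟨v, h⟩
    · simp [h]
  · funext ω
    refine hX fun v hv => ?_
    simp [hv]

variable {V : Type*} [Fintype V] {μ : V → Measure ℝ} [∀ v, IsProbabilityMeasure (μ v)]

/-- Measurable functions of disjoint sets of independent coordinates are independent. -/
theorem indepFun_of_dependsOn {β γ : Type*} [MeasurableSpace β] [MeasurableSpace γ]
    {X : (V → ℝ) → β} {Y : (V → ℝ) → γ} {S T : Set V} (hST : Disjoint S T)
    (hX : DependsOn X S) (hY : DependsOn Y T) (hXm : Measurable X) (hYm : Measurable Y) :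
    IndepFun X Y (Measure.pi μ) := by
  classical
  have hcoord : iIndepFun (fun (i : V) (ω : V → ℝ) => ω i) (Measure.pi μ) :=
    iIndepFun_pi (X := fun _ => id) (fun _ => aemeasurable_id)
  have hind := hcoord.indepFun_finset S.toFinset T.toFinset (Set.disjoint_toFinset.2 hST)
    (fun i => measurable_pi_apply i)
  obtain ⟨g, hg, rfl⟩ := exists_measurable_factor hX hXm
  obtain ⟨g', hg', rfl⟩ := exists_measurable_factor hY hYm
  exact hind.comp hg hg'

theorem integral_mul_of_dependsOn {𝕜 : Type*} [RCLike 𝕜] {X Y : (V → ℝ) → 𝕜} {S T : Set V}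
    (hST : Disjoint S T) (hX : DependsOn X S) (hY : DependsOn Y T) (hXm : Measurable X)
    (hYm : Measurable Y) :
    ∫ ω, X ω * Y ω ∂Measure.pi μ = (∫ ω, X ω ∂Measure.pi μ) * ∫ ω, Y ω ∂Measure.pi μ :=
  (indepFun_of_dependsOn hST hX hY hXm hYm).integral_fun_mul_eq_mul_integral
    hXm.aestronglyMeasurable hYm.aestronglyMeasurable

theorem integral_prod_of_dependsOn {𝕜 ι : Type*} [RCLike 𝕜] {s : Finset ι}
    {X : ι → (V → ℝ) → 𝕜} {W : ι → Set V} (hW : (s : Set ι).PairwiseDisjoint W)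
    (hX : ∀ i ∈ s, DependsOn (X i) (W i)) (hXm : ∀ i ∈ s, Measurable (X i)) :
    ∫ ω, ∏ i ∈ s, X i ω ∂Measure.pi μ = ∏ i ∈ s, ∫ ω, X i ω ∂Measure.pi μ := by
  classical
  induction s using Finset.induction_on with
  | empty => simp
  | insert i s hi ih =>
    have hd : Disjoint (W i) (⋃ j ∈ s, W j) := by
      rw [Set.disjoint_iUnion₂_right]
      intro j hj
      exact hW (by simp) (by simp [hj]) (fun h => hi (h ▸ hj))
    simp only [Finset.prod_insert hi]
    rw [integral_mul_of_dependsOn hd (hX i (by simp))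
      (dependsOn_finset_prod fun j hj => (hX j (by simp [hj])).mono
        (Set.subset_biUnion_of_mem (u := fun j => W j) hj)) (hXm i (by simp))
      (Finset.measurable_fun_prod _ fun j hj => hXm j (by simp [hj])),
      ih (hW.subset (by simp)) (fun j hj => hX j (by simp [hj]))
        (fun j hj => hXm j (by simp [hj]))]

theorem integral_sq_sum_of_dependsOn {ι : Type*} {s : Finset ι} {X : ι → (V → ℝ) → ℝ}
    {W : ι → Set V} (hW : (s : Set ι).PairwiseDisjoint W)
    (hX : ∀ i ∈ s, DependsOn (X i) (W i)) (hXm : ∀ i ∈ s, HasAllMoments (X i) (Measure.pi μ))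
    (h0 : ∀ i ∈ s, ∫ ω, X i ω ∂Measure.pi μ = 0) :
    ∫ ω, (∑ i ∈ s, X i ω) ^ 2 ∂Measure.pi μ = ∑ i ∈ s, ∫ ω, X i ω ^ 2 ∂Measure.pi μ := by
  classical
  simp only [sq, Finset.sum_mul_sum]
  rw [integral_finsetSum _ fun i hi => integrable_finsetSum _ fun j hj =>
    ((hXm i hi).mul (hXm j hj)).integrable]
  refine Finset.sum_congr rfl fun i hi => ?_
  rw [integral_finsetSum _ fun j hj => ((hXm i hi).mul (hXm j hj)).integrable]
  refine Finset.sum_eq_single_of_mem i hi fun j hj hji => ?_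
  rw [integral_mul_of_dependsOn (hW hi hj hji.symm) (hX i hi) (hX j hj) (hXm i hi).1 (hXm j hj).1,
    h0 i hi, zero_mul]

theorem integral_sq_le_of_integral_pow_four_le {Ω : Type*} [MeasurableSpace Ω] {P : Measure Ω}
    [IsProbabilityMeasure P] {X : Ω → ℝ} (hX : HasAllMoments X P) {C : ℝ} (hC : 1 ≤ C)
    (h : ∫ ω, X ω ^ 4 ∂P ≤ C) : ∫ ω, X ω ^ 2 ∂P ≤ C := by
  have h1 : ∫ ω, X ω ^ 2 ∂P ≤ ∫ ω, (1 / 2 + 1 / 2 * X ω ^ 4) ∂P := by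
    refine integral_mono (hX.pow 2).integrable
      ((HasAllMoments.const (1 / 2)).add ((hX.pow 4).const_mul _)).integrable fun ω => ?_
    change X ω ^ 2 ≤ 1 / 2 + 1 / 2 * X ω ^ 4
    nlinarith [sq_nonneg (X ω ^ 2 - 1)]
  rw [integral_add (integrable_const _) ((hX.pow 4).const_mul _).integrable,
    integral_const_mul] at h1
  simp at h1
  linarith

/-- A fourth moment bound for sums of independent centered variables: the fourth moment is of the
order of the square of the number of summands. -/
theorem integral_pow_four_sum_le {ι : Type*} {s : Finset ι} {X : ι → (V → ℝ) → ℝ}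
    {W : ι → Set V} (hW : (s : Set ι).PairwiseDisjoint W)
    (hX : ∀ i ∈ s, DependsOn (X i) (W i)) (hXm : ∀ i ∈ s, HasAllMoments (X i) (Measure.pi μ))
    (h0 : ∀ i ∈ s, ∫ ω, X i ω ∂Measure.pi μ = 0) {C : ℝ} (hC : 1 ≤ C)
    (h4 : ∀ i ∈ s, ∫ ω, X i ω ^ 4 ∂Measure.pi μ ≤ C) :
    ∫ ω, (∑ i ∈ s, X i ω) ^ 4 ∂Measure.pi μ ≤ 3 * C ^ 2 * (s.card : ℝ) ^ 2 := by
  classical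
  induction s using Finset.induction_on with
  | empty => simp
  | insert i s hi ih =>
    have hd : Disjoint (W i) (⋃ j ∈ s, W j) := by
      rw [Set.disjoint_iUnion₂_right]
      intro j hj
      exact hW (by simp) (by simp [hj]) (fun h => hi (h ▸ hj))
    have hW' : (s : Set ι).PairwiseDisjoint W := hW.subset (by simp)
    have hX' : ∀ j ∈ s, DependsOn (X j) (W j) := fun j hj => hX j (by simp [hj])
    have hXm' : ∀ j ∈ s, HasAllMoments (X j) (Measure.pi μ) := fun j hj => hXm j (by simp [hj])
    have h0' : ∀ j ∈ s, ∫ ω, X j ω ∂Measure.pi μ = 0 := fun j hj => h0 j (by simp [hj])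
    have h4' : ∀ j ∈ s, ∫ ω, X j ω ^ 4 ∂Measure.pi μ ≤ C := fun j hj => h4 j (by simp [hj])
    specialize ih hW' hX' hXm' h0' h4'
    set S : (V → ℝ) → ℝ := fun ω => ∑ j ∈ s, X j ω with hS
    have hSm : HasAllMoments S (Measure.pi μ) := HasAllMoments.finset_sum hXm'
    have hSd : DependsOn S (⋃ j ∈ s, W j) := dependsOn_finset_sum fun j hj =>
      (hX' j hj).mono (Set.subset_biUnion_of_mem (u := fun j => W j) hj)
    have hYm := hXm i (by simp)
    have hYd := hX i (by simp)
    have hS2 : ∫ ω, S ω ^ 2 ∂Measure.pi μ ≤ C * s.card := by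
      rw [hS, integral_sq_sum_of_dependsOn hW' hX' hXm' h0', mul_comm, ← nsmul_eq_mul]
      exact Finset.sum_le_card_nsmul _ _ _ fun j hj =>
        integral_sq_le_of_integral_pow_four_le (hXm' j hj) hC (h4' j hj)
    have hY2 : ∫ ω, X i ω ^ 2 ∂Measure.pi μ ≤ C :=
      integral_sq_le_of_integral_pow_four_le hYm hC (h4 i (by simp))
    have hS0 : ∫ ω, S ω ∂Measure.pi μ = 0 := by
      rw [hS, integral_finsetSum _ fun j hj => (hXm' j hj).integrable]
      exact Finset.sum_eq_zero h0'
    have hmix : ∀ k l : ℕ, ∫ ω, X i ω ^ k * S ω ^ l ∂Measure.pi μ =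
        (∫ ω, X i ω ^ k ∂Measure.pi μ) * ∫ ω, S ω ^ l ∂Measure.pi μ := fun k l =>
      integral_mul_of_dependsOn hd (dependsOn_map hYd (· ^ k)) (dependsOn_map hSd (· ^ l))
        (hYm.pow k).1 (hSm.pow l).1
    have hexp : ∀ ω, (∑ j ∈ insert i s, X j ω) ^ 4 = X i ω ^ 4 + 4 * (X i ω ^ 3 * S ω ^ 1)
        + 6 * (X i ω ^ 2 * S ω ^ 2) + 4 * (X i ω ^ 1 * S ω ^ 3) + S ω ^ 4 := fun ω => by
      rw [Finset.sum_insert hi]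
      change (X i ω + S ω) ^ 4 = _
      ring
    simp only [hexp]
    have i1 := hYm.pow 4
    have i2 := ((hYm.pow 3).mul (hSm.pow 1)).const_mul 4
    have i3 := ((hYm.pow 2).mul (hSm.pow 2)).const_mul 6
    have i4 := ((hYm.pow 1).mul (hSm.pow 3)).const_mul 4
    have i5 := hSm.pow 4
    rw [integral_add (((i1.add i2).add i3).add i4).integrable i5.integrable,
      integral_add ((i1.add i2).add i3).integrable i4.integrable,
      integral_add (i1.add i2).integrable i3.integrable,
      integral_add i1.integrable i2.integrable,
      integral_const_mul, integral_const_mul, integral_const_mul, hmix, hmix, hmix]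
    simp only [pow_one, hS0, h0 i (by simp), mul_zero, zero_mul, add_zero]
    rw [Finset.card_insert_of_notMem hi]
    push_cast
    have hprod : (∫ ω, X i ω ^ 2 ∂Measure.pi μ) * ∫ ω, S ω ^ 2 ∂Measure.pi μ ≤ C * (C * s.card) :=
      mul_le_mul hY2 hS2 (integral_nonneg fun ω => sq_nonneg _) (by linarith)
    have h4i := h4 i (by simp)
    nlinarith

end DependsOn

/-! ### Characteristic functions of sums of independent variables -/

theorem norm_prod_sub_prod_le_sum {ι : Type*} (s : Finset ι) (a b : ι → ℂ)
    (ha : ∀ i ∈ s, ‖a i‖ ≤ 1) (hb : ∀ i ∈ s, ‖b i‖ ≤ 1) :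
    ‖∏ i ∈ s, a i - ∏ i ∈ s, b i‖ ≤ ∑ i ∈ s, ‖a i - b i‖ := by
  classical
  induction s using Finset.induction_on with
  | empty => simp
  | insert i s hi ih =>
    rw [Finset.prod_insert hi, Finset.prod_insert hi, Finset.sum_insert hi]
    have h1 : a i * ∏ j ∈ s, a j - b i * ∏ j ∈ s, b j
        = (a i - b i) * ∏ j ∈ s, a j + b i * (∏ j ∈ s, a j - ∏ j ∈ s, b j) := by ring
    rw [h1]
    refine (norm_add_le _ _).trans (add_le_add ?_ ?_)
    · rw [norm_mul]
      refine mul_le_of_le_one_right (norm_nonneg _) ?_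
      rw [norm_prod]
      exact Finset.prod_le_one (fun _ _ => norm_nonneg _) fun j hj => ha j (by simp [hj])
    · rw [norm_mul]
      refine (mul_le_of_le_one_left (norm_nonneg _) (hb i (by simp))).trans ?_
      exact ih (fun j hj => ha j (by simp [hj])) fun j hj => hb j (by simp [hj])

theorem norm_exp_mul_I_sub_taylor_le (x : ℝ) :
    ‖Complex.exp (x * Complex.I) - (1 + x * Complex.I - x ^ 2 / 2)‖ ≤ 4 * |x| ^ 3 := by
  have hn : ‖(x : ℂ) * Complex.I‖ = |x| := by simp
  rcases le_or_gt |x| 1 with h | h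
  · have := Complex.exp_bound (x := (x : ℂ) * Complex.I) (by rw [hn]; exact h) (n := 3) (by norm_num)
    rw [hn] at this
    have e : (∑ m ∈ Finset.range 3, ((x : ℂ) * Complex.I) ^ m / (m.factorial : ℂ))
        = 1 + x * Complex.I - x ^ 2 / 2 := by
      simp [Finset.sum_range_succ, mul_pow, Nat.factorial]
      ring
    rw [e] at this
    refine this.trans ?_
    have h3 : 0 ≤ |x| ^ 3 := by positivity
    norm_num [Nat.factorial]
    linarith
  · refine (norm_sub_le _ _).trans ?_
    rw [Complex.norm_exp_ofReal_mul_I]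
    have h1 : ‖(1 : ℂ) + x * Complex.I - x ^ 2 / 2‖ ≤ 1 + |x| + |x| ^ 2 / 2 := by
      refine (norm_sub_le _ _).trans (add_le_add ((norm_add_le _ _).trans ?_) ?_)
      · simp
      · simp
    have h2 : |x| ≤ |x| ^ 3 := le_self_pow₀ h.le (by norm_num)
    have h3 : |x| ^ 2 ≤ |x| ^ 3 := pow_le_pow_right₀ h.le (by norm_num)
    linarith

theorem abs_exp_neg_sub_one_add_le {v : ℝ} (hv : 0 ≤ v) : |Real.exp (-v) - (1 - v)| ≤ v ^ 2 := by
  have h1 : 1 - v ≤ Real.exp (-v) := by linarith [Real.add_one_le_exp (-v)]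
  rw [abs_of_nonneg (by linarith)]
  rcases le_or_gt v 1 with h | h
  · have := Real.abs_exp_sub_one_sub_id_le (x := -v) (by rw [abs_neg, abs_of_nonneg hv]; exact h)
    have := (abs_le.1 this).2
    nlinarith
  · have : Real.exp (-v) ≤ 1 := Real.exp_le_one_iff.2 (by linarith)
    nlinarith

/-- The characteristic function of a centered random variable compared with that of a Gaussian of
the same variance. -/
theorem norm_integral_exp_sub_exp_le {Ω : Type*} [MeasurableSpace Ω] {P : Measure Ω}
    [IsProbabilityMeasure P] {X : Ω → ℝ} (hX : HasAllMoments X P) (h0 : ∫ ω, X ω ∂P = 0)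
    {C : ℝ} (hC : 1 ≤ C) (h4 : ∫ ω, X ω ^ 4 ∂P ≤ C) {c : ℝ} (hc : |c| ≤ 1) :
    ‖∫ ω, Complex.exp ((c * X ω : ℝ) * Complex.I) ∂P
        - (Real.exp (-(c ^ 2 * ∫ ω, X ω ^ 2 ∂P) / 2) : ℝ)‖ ≤ 9 * C ^ 2 * |c| ^ 3 := by
  set v : ℝ := ∫ ω, X ω ^ 2 ∂P with hv
  have hv0 : 0 ≤ v := integral_nonneg fun _ => sq_nonneg _
  have hvC : v ≤ C := integral_sq_le_of_integral_pow_four_le hX hC h4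
  have hc3 : 0 ≤ |c| ^ 3 := by positivity
  have hexp : Integrable (fun ω => Complex.exp ((c * X ω : ℝ) * Complex.I)) P := by
    refine Integrable.mono' (integrable_const (1 : ℝ)) ?_ (Filter.Eventually.of_forall fun ω => ?_)
    · exact (Complex.measurable_exp.comp
        ((Complex.measurable_ofReal.comp (hX.1.const_mul c)).mul_const _)).aestronglyMeasurable
    · rw [Complex.norm_exp_ofReal_mul_I]
  have hpoly : Integrable (fun ω => (1 : ℂ) + (c * X ω : ℝ) * Complex.I
      - ((c * X ω : ℝ) : ℂ) ^ 2 / 2) P := by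
    refine ((integrable_const _).add ?_).sub ?_
    · exact (hX.const_mul c).integrable.ofReal.mul_const _
    · have := (((hX.const_mul c).pow 2).integrable.ofReal (𝕜 := ℂ)).div_const 2
      simpa using this
  have hpi : ∫ ω, ((1 : ℂ) + (c * X ω : ℝ) * Complex.I - ((c * X ω : ℝ) : ℂ) ^ 2 / 2) ∂P
      = ((1 - c ^ 2 * v / 2 : ℝ) : ℂ) := by
    have e : ∀ ω, (1 : ℂ) + (c * X ω : ℝ) * Complex.I - ((c * X ω : ℝ) : ℂ) ^ 2 / 2
        = ((1 - c ^ 2 * X ω ^ 2 / 2 : ℝ) : ℂ) + ((c * X ω : ℝ) : ℂ) * Complex.I := fun ω => by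
      push_cast; ring
    simp only [e]
    have j1 : HasAllMoments (fun ω => 1 - c ^ 2 * X ω ^ 2 / 2) P := by
      have := (HasAllMoments.const (P := P) 1).sub ((hX.pow 2).const_mul (c ^ 2 / 2))
      refine (congrArg (HasAllMoments · P) (funext fun ω => ?_)).mp this
      ring
    rw [integral_add j1.integrable.ofReal ((hX.const_mul c).integrable.ofReal.mul_const _),
      integral_mul_const, integral_complex_ofReal, integral_complex_ofReal, integral_const_mul, h0]
    have : ∫ ω, (1 - c ^ 2 * X ω ^ 2 / 2) ∂P = 1 - c ^ 2 * v / 2 := by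
      rw [integral_sub (integrable_const _) (by
        simpa [mul_div_assoc] using (((hX.pow 2).const_mul (c ^ 2)).integrable).div_const 2)]
      simp [integral_div, integral_const_mul, hv]
    rw [this]
    simp
  have h3 : ∫ ω, |X ω| ^ 3 ∂P ≤ 2 * C := by
    have habs : HasAllMoments (fun ω => |X ω|) P :=
      ⟨hX.1.abs, fun p hp => (hX.2 p hp).abs⟩
    calc ∫ ω, |X ω| ^ 3 ∂P ≤ ∫ ω, (1 + X ω ^ 4) ∂P := by
          refine integral_mono (habs.pow 3).integrable
            ((HasAllMoments.const 1).add (hX.pow 4)).integrable fun ω => ?_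
          change |X ω| ^ 3 ≤ 1 + X ω ^ 4
          rw [show X ω ^ 4 = |X ω| ^ 4 by rw [pow_abs, abs_of_nonneg (by positivity)]]
          nlinarith [sq_nonneg (|X ω| ^ 2 - |X ω|), sq_nonneg (|X ω| ^ 2 - 1), abs_nonneg (X ω)]
      _ ≤ 2 * C := by
          rw [integral_add (integrable_const _) (hX.pow 4).integrable]
          simp
          linarith
  have step1 : ‖∫ ω, Complex.exp ((c * X ω : ℝ) * Complex.I) ∂P - ((1 - c ^ 2 * v / 2 : ℝ) : ℂ)‖
      ≤ 8 * C * |c| ^ 3 := by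
    rw [← hpi, ← integral_sub hexp hpoly]
    have habs : HasAllMoments (fun ω => |X ω|) P :=
      ⟨hX.1.abs, fun p hp => (hX.2 p hp).abs⟩
    refine (norm_integral_le_of_norm_le (((habs.pow 3).const_mul (4 * |c| ^ 3)).integrable)
      (Filter.Eventually.of_forall fun ω => ?_)).trans ?_
    · refine (norm_exp_mul_I_sub_taylor_le (c * X ω)).trans_eq ?_
      rw [abs_mul]; ring
    · rw [integral_const_mul]
      nlinarith
  have step2 : ‖((1 - c ^ 2 * v / 2 : ℝ) : ℂ) - (Real.exp (-(c ^ 2 * v) / 2) : ℝ)‖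
      ≤ C ^ 2 * |c| ^ 3 := by
    rw [← Complex.ofReal_sub, Complex.norm_real, Real.norm_eq_abs, abs_sub_comm, neg_div]
    refine (abs_exp_neg_sub_one_add_le (by positivity)).trans ?_
    have h1 : c ^ 2 * v / 2 ≤ |c| ^ 2 * C := by
      rw [sq_abs]
      have : c ^ 2 * v ≤ c ^ 2 * C := mul_le_mul_of_nonneg_left hvC (sq_nonneg c)
      have : 0 ≤ c ^ 2 * C := by positivity
      linarith
    calc (c ^ 2 * v / 2) ^ 2 ≤ (|c| ^ 2 * C) ^ 2 := pow_le_pow_left₀ (by positivity) h1 2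
      _ = C ^ 2 * (|c| ^ 3 * |c|) := by ring
      _ ≤ C ^ 2 * (|c| ^ 3 * 1) := by gcongr
      _ = _ := by ring
  calc _ ≤ _ := norm_sub_le_norm_sub_add_norm_sub _ ((1 - c ^ 2 * v / 2 : ℝ) : ℂ) _
    _ ≤ 8 * C * |c| ^ 3 + C ^ 2 * |c| ^ 3 := add_le_add step1 step2
    _ ≤ _ := by nlinarith [mul_le_mul_of_nonneg_right (show C ≤ C ^ 2 by nlinarith) hc3]

/-- A quantitative central limit theorem for characteristic functions of sums of independent,
centered, not necessarily identically distributed variables with bounded fourth moments. -/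
theorem norm_integral_exp_sum_sub_exp_le {V : Type*} [Fintype V] {μ : V → Measure ℝ}
    [∀ v, IsProbabilityMeasure (μ v)] {ι : Type*} {s : Finset ι} {X : ι → (V → ℝ) → ℝ}
    {W : ι → Set V} (hW : (s : Set ι).PairwiseDisjoint W)
    (hX : ∀ i ∈ s, DependsOn (X i) (W i)) (hXm : ∀ i ∈ s, HasAllMoments (X i) (Measure.pi μ))
    (h0 : ∀ i ∈ s, ∫ ω, X i ω ∂Measure.pi μ = 0) {C : ℝ} (hC : 1 ≤ C)
    (h4 : ∀ i ∈ s, ∫ ω, X i ω ^ 4 ∂Measure.pi μ ≤ C) {c : ℝ} (hc : |c| ≤ 1) :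
    ‖∫ ω, Complex.exp ((c * ∑ i ∈ s, X i ω : ℝ) * Complex.I) ∂Measure.pi μ
        - (Real.exp (-(c ^ 2 * ∑ i ∈ s, ∫ ω, X i ω ^ 2 ∂Measure.pi μ) / 2) : ℝ)‖
      ≤ s.card * (9 * C ^ 2 * |c| ^ 3) := by
  have e1 : ∀ ω, Complex.exp ((c * ∑ i ∈ s, X i ω : ℝ) * Complex.I)
      = ∏ i ∈ s, Complex.exp ((c * X i ω : ℝ) * Complex.I) := fun ω => by
    rw [← Complex.exp_sum, Finset.mul_sum]
    push_cast
    rw [Finset.sum_mul]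
  have e2 : ((Real.exp (-(c ^ 2 * ∑ i ∈ s, ∫ ω, X i ω ^ 2 ∂Measure.pi μ) / 2) : ℝ) : ℂ)
      = ∏ i ∈ s, ((Real.exp (-(c ^ 2 * ∫ ω, X i ω ^ 2 ∂Measure.pi μ) / 2) : ℝ) : ℂ) := by
    rw [← Complex.ofReal_prod, ← Real.exp_sum, Finset.mul_sum, ← Finset.sum_neg_distrib,
      Finset.sum_div]
  have hmeas : ∀ i ∈ s, Measurable fun ω => Complex.exp ((c * X i ω : ℝ) * Complex.I) :=
    fun i hi => Complex.measurable_exp.comp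
      ((Complex.measurable_ofReal.comp ((hXm i hi).1.const_mul c)).mul_const _)
  simp only [e1]
  rw [e2, integral_prod_of_dependsOn hW
    (fun i hi => dependsOn_map (hX i hi) fun x => Complex.exp ((c * x : ℝ) * Complex.I)) hmeas]
  refine (norm_prod_sub_prod_le_sum s _ _ (fun i hi => ?_) fun i hi => ?_).trans ?_
  · refine (norm_integral_le_of_norm_le (integrable_const (1 : ℝ))
      (Filter.Eventually.of_forall fun ω => ?_)).trans (by simp)
    rw [Complex.norm_exp_ofReal_mul_I]
  · rw [Complex.norm_real, Real.norm_eq_abs, abs_of_pos (Real.exp_pos _), Real.exp_le_one_iff]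
    have : 0 ≤ ∫ ω, X i ω ^ 2 ∂Measure.pi μ := integral_nonneg fun _ => sq_nonneg _
    have : 0 ≤ c ^ 2 * ∫ ω, X i ω ^ 2 ∂Measure.pi μ := by positivity
    linarith
  · rw [← nsmul_eq_mul]
    exact Finset.sum_le_card_nsmul _ _ _ fun i hi =>
      norm_integral_exp_sub_exp_le (hXm i hi) (h0 i hi) hC (h4 i hi) hc


/-! ### Weak convergence and pseudo-Lipschitz test functions -/

section PseudoLipschitz

variable {s : ℕ} {ψ : EuclideanSpace ℝ (Fin s) → ℝ}

theorem PseudoLipschitz.exists_abs_le (hψ : PseudoLipschitz ψ) :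
    ∃ B : ℝ, 0 < B ∧ ∀ x, |ψ x| ≤ B * (1 + ‖x‖ ^ 2) := by
  obtain ⟨C, hC, h⟩ := hψ
  refine ⟨|ψ 0| + 2 * C, by positivity, fun x => ?_⟩
  have h1 := h x 0
  simp only [norm_zero, add_zero, sub_zero] at h1
  have h2 : |ψ x| ≤ |ψ 0| + |ψ x - ψ 0| := by
    have := abs_add_le (ψ 0) (ψ x - ψ 0)
    simpa using this
  have h3 : (1 + ‖x‖) * ‖x‖ ≤ 2 * (1 + ‖x‖ ^ 2) := by nlinarith [sq_nonneg (‖x‖ - 1)]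
  have h4 : C * (1 + ‖x‖) * ‖x‖ ≤ C * (2 * (1 + ‖x‖ ^ 2)) := by
    rw [mul_assoc]
    exact mul_le_mul_of_nonneg_left h3 hC.le
  nlinarith [mul_nonneg (abs_nonneg (ψ 0)) (sq_nonneg ‖x‖)]

theorem PseudoLipschitz.continuous (hψ : PseudoLipschitz ψ) : Continuous ψ := by
  obtain ⟨C, hC, h⟩ := hψ
  rw [continuous_iff_continuousAt]
  intro y
  rw [ContinuousAt, tendsto_iff_dist_tendsto_zero]
  have hlim : Filter.Tendsto (fun x => C * (1 + ‖x‖ + ‖y‖) * ‖x - y‖) (nhds y) (nhds 0) := by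
    have hc : Continuous fun x => C * (1 + ‖x‖ + ‖y‖) * ‖x - y‖ := by fun_prop
    simpa using hc.tendsto y
  refine squeeze_zero (fun _ => dist_nonneg) (fun x => ?_) hlim
  rw [Real.dist_eq]
  exact h x y

variable {ν : Measure (EuclideanSpace ℝ (Fin s))} [IsProbabilityMeasure ν]

theorem integrable_sq_of_abs_le (hc : Continuous ψ) {B : ℝ}
    (hB : ∀ x, |ψ x| ≤ B * (1 + ‖x‖ ^ 2)) (h4 : Integrable (fun x => ‖x‖ ^ 4) ν) :
    Integrable (fun x => ψ x ^ 2) ν ∧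
      ∫ x, ψ x ^ 2 ∂ν ≤ 2 * B ^ 2 * (1 + ∫ x, ‖x‖ ^ 4 ∂ν) := by
  have hdom : Integrable (fun x => 2 * B ^ 2 * (1 + ‖x‖ ^ 4)) ν :=
    ((integrable_const _).add h4).const_mul _
  have hle : ∀ x, ψ x ^ 2 ≤ 2 * B ^ 2 * (1 + ‖x‖ ^ 4) := fun x => by
    have h1 : ψ x ^ 2 ≤ (B * (1 + ‖x‖ ^ 2)) ^ 2 := by
      rw [← sq_abs]
      exact pow_le_pow_left₀ (abs_nonneg _) (hB x) 2
    nlinarith [mul_nonneg (sq_nonneg B) (sq_nonneg (‖x‖ ^ 2 - 1))]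
  have hi : Integrable (fun x => ψ x ^ 2) ν :=
    hdom.mono' (hc.pow 2).aestronglyMeasurable <| Filter.Eventually.of_forall fun x => by
      rw [Real.norm_eq_abs, abs_of_nonneg (sq_nonneg _)]
      exact hle x
  refine ⟨hi, (integral_mono hi hdom hle).trans_eq ?_⟩
  rw [integral_const_mul, integral_add (integrable_const _) h4]
  simp

theorem integrable_of_abs_le (hc : Continuous ψ) {B : ℝ}
    (hB : ∀ x, |ψ x| ≤ B * (1 + ‖x‖ ^ 2)) (h4 : Integrable (fun x => ‖x‖ ^ 4) ν) :
    Integrable ψ ν := by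
  refine ((integrable_const (1 : ℝ)).add (integrable_sq_of_abs_le hc hB h4).1).mono'
    hc.aestronglyMeasurable (Filter.Eventually.of_forall fun x => ?_)
  change |ψ x| ≤ 1 + ψ x ^ 2
  rw [← sq_abs]
  nlinarith [sq_nonneg (|ψ x| - 1), abs_nonneg (ψ x)]

/-- Truncation of a real number to the interval `[-R, R]`. -/
def clip (R x : ℝ) : ℝ := max (-R) (min R x)

theorem abs_clip_le {R : ℝ} (hR : 0 ≤ R) (x : ℝ) : |clip R x| ≤ R :=
  abs_le.2 ⟨le_max_left _ _, max_le (by linarith) (min_le_left _ _)⟩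

theorem abs_sub_clip_le {R : ℝ} (hR : 0 < R) (x : ℝ) : |x - clip R x| ≤ x ^ 2 / R := by
  rw [le_div_iff₀ hR]
  unfold clip
  rcases le_total x (-R) with h | h
  · rw [min_eq_right (by linarith), max_eq_left h, abs_of_nonpos (by linarith)]
    nlinarith
  · rcases le_total x R with h' | h'
    · rw [min_eq_right h', max_eq_right h]
      simpa using sq_nonneg x
    · rw [min_eq_left h', max_eq_right (by linarith), abs_of_nonneg (by linarith)]
      nlinarith

theorem abs_integral_sub_integral_clip_le (hc : Continuous ψ) {B : ℝ}
    (hB : ∀ x, |ψ x| ≤ B * (1 + ‖x‖ ^ 2)) (h4 : Integrable (fun x => ‖x‖ ^ 4) ν) {M : ℝ}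
    (hM : ∫ x, ‖x‖ ^ 4 ∂ν ≤ M) {R : ℝ} (hR : 0 < R) :
    |∫ x, ψ x ∂ν - ∫ x, clip R (ψ x) ∂ν| ≤ 2 * B ^ 2 * (1 + M) / R := by
  obtain ⟨h2, h2'⟩ := integrable_sq_of_abs_le hc hB h4
  have hclip : Integrable (fun x => clip R (ψ x)) ν := by
    refine Integrable.mono' (integrable_const R) ?_
      (Filter.Eventually.of_forall fun x => abs_clip_le hR.le _)
    exact (continuous_const.max (continuous_const.min hc)).aestronglyMeasurable
  rw [← integral_sub (integrable_of_abs_le hc hB h4) hclip]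
  refine (norm_integral_le_of_norm_le (f := fun x => ψ x - clip R (ψ x)) (h2.div_const R)
    (Filter.Eventually.of_forall fun x => abs_sub_clip_le hR (ψ x))).trans ?_
  rw [integral_div]
  gcongr
  refine h2'.trans ?_
  gcongr

end PseudoLipschitz

/-- Let `𝓕 d` be families of probability measures with uniformly bounded fourth moments whose
characteristic functions converge pointwise, uniformly over the family, to that of `γ`. Then the
integrals of a pseudo-Lipschitz function converge, uniformly over the family: otherwise some
sequence of measures from the families would contradict Lévy's theorem. -/
theorem exists_forall_abs_integral_sub_le {s : ℕ} {ψ : EuclideanSpace ℝ (Fin s) → ℝ}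
    (hψ : PseudoLipschitz ψ) {γ : Measure (EuclideanSpace ℝ (Fin s))} [IsProbabilityMeasure γ]
    (hγ : Integrable (fun x => ‖x‖ ^ 4) γ) (𝓕 : ℕ → Set (Measure (EuclideanSpace ℝ (Fin s))))
    (hprob : ∀ d, ∀ ν ∈ 𝓕 d, IsProbabilityMeasure ν) {M : ℝ}
    (h4 : ∀ d, ∀ ν ∈ 𝓕 d, Integrable (fun x => ‖x‖ ^ 4) ν ∧ ∫ x, ‖x‖ ^ 4 ∂ν ≤ M)
    (hchar : ∀ t, ∀ ε : ℝ, 0 < ε → ∃ d₀ : ℕ, ∀ d, d₀ ≤ d → ∀ ν ∈ 𝓕 d,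
      ‖charFun ν t - charFun γ t‖ ≤ ε) {ε : ℝ} (hε : 0 < ε) :
    ∃ d₀ : ℕ, ∀ d, d₀ ≤ d → ∀ ν ∈ 𝓕 d, |∫ x, ψ x ∂ν - ∫ x, ψ x ∂γ| ≤ ε := by
  by_contra! hcon
  choose d hd ν hν hlt using hcon
  have hc := hψ.continuous
  obtain ⟨B, hB0, hB⟩ := hψ.exists_abs_le
  have hp : ∀ k, IsProbabilityMeasure (ν k) := fun k => hprob _ _ (hν k)
  let νp : ℕ → ProbabilityMeasure (EuclideanSpace ℝ (Fin s)) := fun k => ⟨ν k, hp k⟩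
  let γp : ProbabilityMeasure (EuclideanSpace ℝ (Fin s)) := ⟨γ, inferInstance⟩
  have hconv : Filter.Tendsto νp Filter.atTop (nhds γp) := by
    refine ProbabilityMeasure.tendsto_of_tendsto_charFun fun t => ?_
    rw [Metric.tendsto_atTop]
    intro η hη
    obtain ⟨d₀, h⟩ := hchar t (η / 2) (by linarith)
    refine ⟨d₀, fun k hk => ?_⟩
    rw [dist_eq_norm]
    exact (h (d k) (hk.trans (hd k)) (ν k) (hν k)).trans_lt (by linarith)
  set M' : ℝ := max M (∫ x, ‖x‖ ^ 4 ∂γ) with hM'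
  have hM'0 : 0 ≤ M' := le_max_of_le_right (integral_nonneg fun _ => by positivity)
  -- the truncation level makes both truncation errors at most `ε / 4`
  set R : ℝ := 8 * B ^ 2 * (1 + M') / ε with hR
  have hR0 : 0 < R := by positivity
  have herr : 2 * B ^ 2 * (1 + M') / R = ε / 4 := by
    rw [hR]
    field_simp
    norm_num
  let g : BoundedContinuousFunction (EuclideanSpace ℝ (Fin s)) ℝ :=
    BoundedContinuousFunction.ofNormedAddCommGroup (fun x => clip R (ψ x))
      (continuous_const.max (continuous_const.min hc)) R fun x => abs_clip_le hR0.le _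
  have hg := (ProbabilityMeasure.tendsto_iff_forall_integral_tendsto.1 hconv) g
  rw [Metric.tendsto_atTop] at hg
  obtain ⟨k, hk⟩ := hg (ε / 4) (by linarith)
  have h1 : |∫ x, clip R (ψ x) ∂(ν k) - ∫ x, clip R (ψ x) ∂γ| < ε / 4 := by
    have := hk k le_rfl
    rwa [Real.dist_eq] at this
  have h2 := abs_integral_sub_integral_clip_le (ν := ν k) hc hB (h4 _ _ (hν k)).1
    ((h4 _ _ (hν k)).2.trans (le_max_left _ _ : M ≤ M')) hR0
  have h3 := abs_integral_sub_integral_clip_le (ν := γ) hc hB hγ (le_max_right _ _ : _ ≤ M') hR0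
  rw [herr] at h2 h3
  have h4 := hlt k
  rw [abs_lt] at h1
  rw [abs_le] at h2 h3
  rcases lt_abs.1 h4 with h | h <;> linarith


/-! ### The multilinear extension and its derivatives -/

section Fourier

variable {r : ℕ} {f : (Fin r → ℤˣ) → ℝ}

theorem partialDeriv_eq_sum (ι : Fin r) (x : Fin r → ℝ) :
    partialDeriv f ι x = ∑ S : Finset (Fin r) with ι ∈ S,
      cubeFourierCoeff f S * ∏ κ ∈ S.erase ι, x κ := by
  have hterm : ∀ S : Finset (Fin r), HasDerivAt
      (fun t : ℝ => cubeFourierCoeff f S * ∏ κ ∈ S, Function.update x ι t κ)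
      (if ι ∈ S then cubeFourierCoeff f S * ∏ κ ∈ S.erase ι, x κ else 0) (x ι) := by
    intro S
    by_cases h : ι ∈ S
    · have e : ∀ t : ℝ, ∏ κ ∈ S, Function.update x ι t κ = t * ∏ κ ∈ S.erase ι, x κ := fun t => by
        rw [← Finset.mul_prod_erase S _ h, Function.update_self]
        congr 1
        exact Finset.prod_congr rfl fun κ hκ =>
          Function.update_of_ne (Finset.ne_of_mem_erase hκ) _ _
      simp only [e, h, if_true]
      simpa using ((hasDerivAt_id (x ι)).mul_const (∏ κ ∈ S.erase ι, x κ)).const_mul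
        (cubeFourierCoeff f S)
    · have e : ∀ t : ℝ, ∏ κ ∈ S, Function.update x ι t κ = ∏ κ ∈ S, x κ := fun t =>
        Finset.prod_congr rfl fun κ hκ => Function.update_of_ne (ne_of_mem_of_not_mem hκ h) _ _
      simp only [e, h, if_false]
      exact hasDerivAt_const _ _
  unfold partialDeriv multilinearExt
  rw [(HasDerivAt.fun_sum fun S _ => hterm S).deriv, Finset.sum_filter]

theorem cubeFourierCoeff_singleton (hlin : fourierWeight f 1 = 0) (ι : Fin r) :
    cubeFourierCoeff f {ι} = 0 := by
  have h := (Finset.sum_eq_zero_iff_of_nonneg fun _ _ => sq_nonneg _).1 hlin {ι}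
    (by simp [Finset.mem_powersetCard])
  simpa using h

end Fourier

/-! ### The messages as random variables -/

/-- The data and the hypotheses of state evolution, apart from the nonlinearities at the nodes,
which do not enter the recursion, and the test function. -/
structure Setting {r : ℕ} (f : (Fin r → ℤˣ) → ℝ) (δ K : ℝ) (L : ℕ) where
  n : ℕ
  m : ℕ
  d : ℕ
  G : DirectedHypergraph r (Fin n) (Fin m)
  F : (k : ℕ) → Fin n → Fin m → (Fin k → ℝ) → ℝ
  two_le : 2 ≤ d
  delta_pos : 0 < δ
  no_linear : fourierWeight f 1 = 0
  regular : G.IsIndexRegular d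
  girth : G.GirthAtLeast (2 * L + 2)
  measurable_F : ∀ k < L, ∀ i a, Measurable (F k i a)
  abs_F_le : ∀ k < L, ∀ i a x, |F k i a x| ≤ K
  integral_msgA_sq : ∀ k < L, ∀ i, ∀ a ∈ G.incident i,
    ∫ z0, msgA G f d F z0 k i a ^ 2 ∂(initLaw (Fin n) δ) = δ / nu f δ (k + 1)

instance isProbabilityMeasure_initLaw (V : Type) [Fintype V] (δ : ℝ) :
    IsProbabilityMeasure (initLaw V δ) := by
  unfold initLaw
  infer_instance

namespace Setting

variable {r : ℕ} {f : (Fin r → ℤˣ) → ℝ} {δ K : ℝ} {L : ℕ} (I : Setting f δ K L)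

/-- A slot is a hyperedge together with one of its `r` positions; slots stand for the pairs `(i, a)`
with `i ∈ ∂a`. -/
abbrev Slot (I : Setting f δ K L) : Type := Fin I.m × Fin r

/-- The vertex in a slot. -/
def vert (q : I.Slot) : Fin I.n := I.G.scope q.1 q.2

/-- The slots that contain the vertex `i`. -/
def slots (i : Fin I.n) : Finset I.Slot := {p | I.vert p = i}

/-- The slots of the vertex of `q` in the other hyperedges: these contribute to the message out of
`q`. -/
def incoming (q : I.Slot) : Finset I.Slot := {p | I.vert p = I.vert q ∧ p.1 ≠ q.1}

/-- The law of the initialization. -/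
noncomputable abbrev law : Measure (Fin I.n → ℝ) := initLaw (Fin I.n) δ

/-- The message `z` in the slot `q`, with the index shifted by one so that the sequence is a
martingale started at `0`: `X 0 = 0` and `X (s + 1) = z^s`. -/
noncomputable def X : ℕ → I.Slot → (Fin I.n → ℝ) → ℝ
  | 0, _, _ => 0
  | s + 1, q, z0 => msgZ I.G f I.d I.F z0 s (I.vert q) q.1

/-- The message `u^{s+1}` in the slot `q`. -/
noncomputable def U (s : ℕ) (q : I.Slot) (z0 : Fin I.n → ℝ) : ℝ :=
  msgU I.G f I.d I.F z0 (s + 1) (I.vert q) q.1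

/-- The multiplier `A^s` in the slot `q`. -/
noncomputable def A (s : ℕ) (q : I.Slot) (z0 : Fin I.n → ℝ) : ℝ :=
  msgA I.G f I.d I.F z0 s (I.vert q) q.1

/-- The derivative of `f` in the slot `p`, at the messages `X s` of the hyperedge. -/
noncomputable def D (s : ℕ) (p : I.Slot) (z0 : Fin I.n → ℝ) : ℝ :=
  partialDeriv f p.2 fun κ => I.X s (p.1, κ) z0

/-- The increment of the derivative in the slot `p`. -/
noncomputable def Y (s : ℕ) (p : I.Slot) (z0 : Fin I.n → ℝ) : ℝ := I.D (s + 1) p z0 - I.D s p z0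

theorem D_eq_sum (s : ℕ) (p : I.Slot) (z0 : Fin I.n → ℝ) :
    I.D s p z0 = ∑ S : Finset (Fin r) with p.2 ∈ S,
      cubeFourierCoeff f S * ∏ κ ∈ S.erase p.2, I.X s (p.1, κ) z0 := partialDeriv_eq_sum _ _

theorem D_zero (p : I.Slot) (z0 : Fin I.n → ℝ) : I.D 0 p z0 = 0 := by
  rw [D_eq_sum]
  refine Finset.sum_eq_zero fun S hS => ?_
  rcases (S.erase p.2).eq_empty_or_nonempty with h | ⟨κ, hκ⟩
  · have hS' : S = {p.2} := by
      rw [← Finset.insert_erase (Finset.mem_filter.1 hS).2, h]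
      rfl
    rw [hS', cubeFourierCoeff_singleton I.no_linear, zero_mul]
  · rw [Finset.prod_eq_zero hκ rfl, mul_zero]

theorem mem_slots {i : Fin I.n} {p : I.Slot} : p ∈ I.slots i ↔ I.vert p = i := by
  simp [slots]

theorem mem_incoming {q p : I.Slot} :
    p ∈ I.incoming q ↔ I.vert p = I.vert q ∧ p.1 ≠ q.1 := by
  simp [incoming]

theorem mem_incident_iff {i : Fin I.n} {b : Fin I.m} :
    b ∈ I.G.incident i ↔ ∃ ι, I.G.scope b ι = i := by
  simp [DirectedHypergraph.incident]

theorem mem_incident (q : I.Slot) : q.1 ∈ I.G.incident (I.vert q) :=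
  I.mem_incident_iff.2 ⟨q.2, rfl⟩

theorem partialAt_eq_sum (s : ℕ) (i : Fin I.n) (b : Fin I.m) (z0 : Fin I.n → ℝ) :
    I.G.partialAt f i b (fun κ => msgZ I.G f I.d I.F z0 s (I.G.scope b κ) b)
      = ∑ ι with I.G.scope b ι = i, I.D (s + 1) (b, ι) z0 := rfl

theorem msgW_eq (s : ℕ) (q : I.Slot) (z0 : Fin I.n → ℝ) :
    msgW I.G f I.d I.F z0 s (I.vert q) q.1
      = 1 / √((I.d : ℝ) - 1) * ∑ p ∈ I.incoming q, I.D s p z0 := by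
  cases s with
  | zero => simp [msgW_zero, D_zero]
  | succ s =>
    rw [msgW_succ]
    simp only [partialAt_eq_sum]
    congr 1
    refine (Finset.sum_finset_product (I.incoming q) (I.G.incident (I.vert q) \ {q.1})
      (fun b => Finset.univ.filter fun ι => I.G.scope b ι = I.vert q) (fun p => ?_)
      (f := fun p => I.D (s + 1) p z0)).symm
    rw [mem_incoming, Finset.mem_sdiff, mem_incident_iff, Finset.mem_singleton,
      Finset.mem_filter_univ]
    exact ⟨fun h => ⟨⟨⟨_, h.1⟩, h.2⟩, h.1⟩, fun h => ⟨h.2, h.1.2⟩⟩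

theorem nodeW_eq (s : ℕ) (i : Fin I.n) (z0 : Fin I.n → ℝ) :
    nodeW I.G f I.d I.F z0 s i = 1 / √(I.d : ℝ) * ∑ p ∈ I.slots i, I.D s p z0 := by
  cases s with
  | zero => simp [nodeW, D_zero]
  | succ s =>
    rw [nodeW]
    simp only [partialAt_eq_sum]
    congr 1
    refine (Finset.sum_finset_product (I.slots i) (I.G.incident i)
      (fun b => Finset.univ.filter fun ι => I.G.scope b ι = i) (fun p => ?_)
      (f := fun p => I.D (s + 1) p z0)).symm
    rw [mem_slots, mem_incident_iff, Finset.mem_filter_univ]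
    exact ⟨fun h => ⟨⟨_, h⟩, h⟩, fun h => h.2⟩

theorem U_eq (s : ℕ) (q : I.Slot) (z0 : Fin I.n → ℝ) :
    I.U s q z0 = 1 / √((I.d : ℝ) - 1) * ∑ p ∈ I.incoming q, I.Y s p z0 := by
  rw [U, msgU_succ, msgW_eq, msgW_eq, ← mul_sub, ← Finset.sum_sub_distrib]
  rfl

theorem nodeU_eq (s : ℕ) (i : Fin I.n) (z0 : Fin I.n → ℝ) :
    nodeU I.G f I.d I.F z0 (s + 1) i = 1 / √(I.d : ℝ) * ∑ p ∈ I.slots i, I.Y s p z0 := by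
  rw [nodeU, nodeW_eq, nodeW_eq, ← mul_sub, Nat.add_sub_cancel, ← Finset.sum_sub_distrib]
  rfl

theorem X_zero (q : I.Slot) (z0 : Fin I.n → ℝ) : I.X 0 q z0 = 0 := rfl

theorem X_one (q : I.Slot) (z0 : Fin I.n → ℝ) : I.X 1 q z0 = z0 (I.vert q) := rfl

theorem X_succ (s : ℕ) (q : I.Slot) (z0 : Fin I.n → ℝ) :
    I.X (s + 2) q z0 = I.X (s + 1) q z0 + I.A s q z0 * I.U s q z0 :=
  msgZ_succ I.G f I.d I.F z0 s (I.vert q) q.1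

theorem A_eq (s : ℕ) (q : I.Slot) (z0 : Fin I.n → ℝ) :
    I.A s q z0 = I.F s (I.vert q) q.1 fun t : Fin s => I.U t q z0 := rfl

/-! ### Counting slots -/

theorem injOn_fst_slots (i : Fin I.n) : Set.InjOn Prod.fst (I.slots i : Set I.Slot) := by
  intro p hp q hq h
  rw [Finset.mem_coe, mem_slots] at hp hq
  obtain ⟨b, ι⟩ := p
  obtain ⟨c, κ⟩ := q
  obtain rfl : b = c := h
  simp only [vert] at hp hq
  rw [I.G.scope_injective b (hp.trans hq.symm)]

theorem image_fst_slots (i : Fin I.n) : (I.slots i).image Prod.fst = I.G.incident i := by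
  ext b
  simp [mem_slots, vert, DirectedHypergraph.incident]

theorem card_slots (i : Fin I.n) : (I.slots i).card = I.d := by
  rw [← (I.regular i).1, ← image_fst_slots, Finset.card_image_of_injOn (I.injOn_fst_slots i)]

theorem incoming_eq (q : I.Slot) : I.incoming q = (I.slots (I.vert q)).erase q := by
  ext p
  rw [mem_incoming, Finset.mem_erase, mem_slots]
  constructor
  · rintro ⟨h1, h2⟩
    exact ⟨fun h => h2 (h ▸ rfl), h1⟩
  · rintro ⟨h1, h2⟩
    refine ⟨h2, fun h => h1 (I.injOn_fst_slots (I.vert q) ?_ ?_ h)⟩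
    · exact Finset.mem_coe.2 (I.mem_slots.2 h2)
    · exact Finset.mem_coe.2 (I.mem_slots.2 rfl)

theorem card_incoming (q : I.Slot) : (I.incoming q).card = I.d - 1 := by
  rw [incoming_eq, Finset.card_erase_of_mem (I.mem_slots.2 rfl), card_slots]

theorem incoming_subset_slots (q : I.Slot) : I.incoming q ⊆ I.slots (I.vert q) := by
  rw [incoming_eq]
  exact Finset.erase_subset _ _

/-- Index regularity: each position occurs equally often among the slots of a vertex. -/
theorem sum_slots_snd (i : Fin I.n) (g : Fin r → ℝ) :
    r * ∑ p ∈ I.slots i, g p.2 = I.d * ∑ ι, g ι := by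
  have h1 : ∑ p ∈ I.slots i, g p.2
      = ∑ ι, ((Finset.univ.filter fun e => I.G.scope e ι = i).card : ℝ) * g ι := by
    rw [Finset.sum_finset_product_right (I.slots i) Finset.univ
      (fun ι => Finset.univ.filter fun e => I.G.scope e ι = i)
      (fun p => by simp [mem_slots, vert])]
    simp
  rw [h1, Finset.mul_sum, Finset.mul_sum]
  refine Finset.sum_congr rfl fun ι _ => ?_
  rw [← mul_assoc]
  congr 1
  exact_mod_cast (I.regular i).2 ι

/-! ### The coordinates on which the messages depend -/

/-- The coordinates at distance less than `s` in the tree below the slot `q`. -/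
def ball (s : ℕ) (q : I.Slot) : Set (Fin I.n) := I.G.ball s (I.vert q) q.1

/-- The coordinates at distance `s` in the tree below the slot `q`. -/
def sphere (s : ℕ) (q : I.Slot) : Set (Fin I.n) := I.G.sphere s (I.vert q) q.1

/-- The coordinates at distance less than `s` in the trees below the other slots of the hyperedge
of `p`. -/
def branch (s : ℕ) (p : I.Slot) : Set (Fin I.n) := {v | ∃ κ ≠ p.2, v ∈ I.ball s (p.1, κ)}

/-- The coordinates at distance `s` in the trees below the other slots of the hyperedge of `p`. -/
def leaves (s : ℕ) (p : I.Slot) : Set (Fin I.n) := {v | ∃ κ ≠ p.2, v ∈ I.sphere s (p.1, κ)}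

theorem ball_mono {s t : ℕ} (h : s ≤ t) (q : I.Slot) : I.ball s q ⊆ I.ball t q :=
  DirectedHypergraph.ball_mono h _ _

theorem branch_mono {s t : ℕ} (h : s ≤ t) (p : I.Slot) : I.branch s p ⊆ I.branch t p :=
  fun _ ⟨κ, hκ, hv⟩ => ⟨κ, hκ, I.ball_mono h _ hv⟩

theorem ball_subset_branch (s : ℕ) {p : I.Slot} {κ : Fin r} (hκ : κ ≠ p.2) :
    I.ball s (p.1, κ) ⊆ I.branch s p := fun _ hv => ⟨κ, hκ, hv⟩

theorem disjoint_sphere_ball {s : ℕ} (hs : s ≤ L) (q : I.Slot) :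
    Disjoint (I.sphere s q) (I.ball s q) :=
  DirectedHypergraph.disjoint_sphere_ball I.girth hs _ _

theorem leaves_subset_sphere {s : ℕ} (hs : s < L) {p q : I.Slot} (hp : p ∈ I.incoming q) :
    I.leaves s p ⊆ I.sphere (s + 1) q := by
  rintro v ⟨κ, hκ, hv⟩
  obtain ⟨h1, h2⟩ := I.mem_incoming.1 hp
  have := DirectedHypergraph.sphere_child_subset I.girth hs h2 (ι' := q.2) hκ h1.symm hv
  change v ∈ I.G.sphere (s + 1) (I.vert p) q.1 at this
  rwa [h1] at this

theorem branch_subset_ball {s : ℕ} (hs : s ≤ L) {p q : I.Slot} (hp : p ∈ I.incoming q) :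
    I.branch s p ⊆ I.ball (s + 1) q := by
  rintro v ⟨κ, hκ, k, hk, hv⟩
  exact ⟨k + 1, by omega, I.leaves_subset_sphere (hk.trans_le hs) hp ⟨κ, hκ, hv⟩⟩

theorem disjoint_ball_ball {s t : ℕ} (hs : s ≤ L) (ht : t ≤ L) {p p' : I.Slot}
    (hv : I.vert p = I.vert p') {κ κ' : Fin r} (hκ : κ ≠ p.2) (hκ' : κ' ≠ p'.2)
    (hne : p.1 = p'.1 → κ ≠ κ') : Disjoint (I.ball s (p.1, κ)) (I.ball t (p'.1, κ')) := by
  rw [Set.disjoint_left]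
  rintro v ⟨k, hk, hvk⟩ ⟨l, hl, hvl⟩
  exact Set.disjoint_left.1 (DirectedHypergraph.disjoint_sphere_children I.girth
    (hk.trans_le hs) (hl.trans_le ht) hκ hκ' hv hne) hvk hvl

theorem sphere_subset_ball (s : ℕ) (q : I.Slot) : I.sphere s q ⊆ I.ball (s + 1) q :=
  DirectedHypergraph.sphere_subset_ball (Nat.lt_succ_self s) _ _

theorem leaves_subset_branch (s : ℕ) (p : I.Slot) : I.leaves s p ⊆ I.branch (s + 1) p :=
  fun _ ⟨κ, hκ, hv⟩ => ⟨κ, hκ, I.sphere_subset_ball s _ hv⟩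

theorem disjoint_branch {s t : ℕ} (hs : s ≤ L) (ht : t ≤ L) {p p' : I.Slot}
    (hv : I.vert p = I.vert p') (hne : p ≠ p') : Disjoint (I.branch s p) (I.branch t p') := by
  rw [Set.disjoint_left]
  rintro v ⟨κ, hκ, h⟩ ⟨κ', hκ', h'⟩
  refine Set.disjoint_left.1 (I.disjoint_ball_ball hs ht hv hκ hκ' fun h1 => absurd ?_ hne) h h'
  exact I.injOn_fst_slots (I.vert p') (Finset.mem_coe.2 (I.mem_slots.2 hv))
    (Finset.mem_coe.2 (I.mem_slots.2 rfl)) h1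

theorem pairwiseDisjoint_branch {s : ℕ} (hs : s ≤ L) (i : Fin I.n) :
    (I.slots i : Set I.Slot).PairwiseDisjoint (I.branch s) := fun _ hp _ hp' hne =>
  I.disjoint_branch hs hs ((I.mem_slots.1 hp).trans (I.mem_slots.1 hp').symm) hne

theorem disjoint_leaves_branch {s : ℕ} (hs : s < L) (p : I.Slot) :
    Disjoint (I.leaves s p) (I.branch s p) := by
  rw [Set.disjoint_left]
  rintro v ⟨κ, hκ, h⟩ ⟨κ', hκ', h'⟩
  by_cases hne : κ = κ'
  · subst hne
    exact Set.disjoint_left.1 (I.disjoint_sphere_ball hs.le _) h h'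
  · exact Set.disjoint_left.1 (I.disjoint_ball_ball (s := s + 1) hs hs.le rfl hκ hκ' fun _ => hne)
      (I.sphere_subset_ball s _ h) h'

theorem dependsOn_D_of {s : ℕ} (h : ∀ q, DependsOn (I.X s q) (I.ball s q)) (p : I.Slot) :
    DependsOn (I.D s p) (I.branch s p) := by
  intro x y hxy
  rw [D_eq_sum, D_eq_sum]
  refine Finset.sum_congr rfl fun S _ => ?_
  congr 1
  exact Finset.prod_congr rfl fun κ hκ =>
    h _ fun v hv => hxy v (I.ball_subset_branch s (Finset.ne_of_mem_erase hκ) hv)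

theorem dependsOn_U_of {s : ℕ} (hs : s + 1 ≤ L)
    (h : ∀ t ≤ s + 1, ∀ q, DependsOn (I.X t q) (I.ball t q)) (q : I.Slot) :
    DependsOn (I.U s q) (I.ball (s + 2) q) := by
  intro x y hxy
  rw [U_eq, U_eq]
  congr 1
  refine Finset.sum_congr rfl fun p hp => ?_
  have hsub := I.branch_subset_ball hs hp
  exact congrArg₂ (· - ·)
    (I.dependsOn_D_of (h (s + 1) le_rfl) p fun v hv => hxy v (hsub hv))
    (I.dependsOn_D_of (h s (by omega)) p fun v hv =>
      hxy v (hsub (I.branch_mono (Nat.le_succ s) p hv)))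

theorem dependsOn_X {s : ℕ} (hs : s ≤ L) (q : I.Slot) : DependsOn (I.X s q) (I.ball s q) := by
  induction s using Nat.strong_induction_on generalizing q with
  | _ s ih =>
    match s, hs, ih with
    | 0, _, _ => exact fun _ _ _ => rfl
    | 1, _, _ =>
      intro x y hxy
      exact hxy _ ⟨0, by omega, DirectedHypergraph.mem_sphere_zero _ _⟩
    | s + 2, hs, ih =>
      have hU : ∀ t ≤ s, DependsOn (I.U t q) (I.ball (s + 2) q) := fun t ht =>
        (I.dependsOn_U_of (by omega) (fun t' ht' q => ih t' (by omega) (by omega) q) q).mono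
          (I.ball_mono (by omega) q)
      intro x y hxy
      rw [X_succ, X_succ, A_eq, A_eq, hU s le_rfl hxy,
        (ih (s + 1) (by omega) (by omega) q).mono (I.ball_mono (by omega) q) hxy,
        funext fun t : Fin s => hU t (by omega) hxy]

theorem dependsOn_D {s : ℕ} (hs : s ≤ L) (p : I.Slot) : DependsOn (I.D s p) (I.branch s p) :=
  I.dependsOn_D_of (fun q => I.dependsOn_X hs q) p

theorem dependsOn_Y {s : ℕ} (hs : s < L) (p : I.Slot) :
    DependsOn (I.Y s p) (I.branch (s + 1) p) :=
  dependsOn_map₂ (I.dependsOn_D hs p)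
    ((I.dependsOn_D hs.le p).mono (I.branch_mono (Nat.le_succ s) p)) (· - ·)

theorem dependsOn_A {s : ℕ} (hs : s ≤ L) (q : I.Slot) :
    DependsOn (I.A s q) (I.ball (s + 1) q) := by
  intro x y hxy
  rw [A_eq, A_eq]
  congr 1
  funext t
  exact (I.dependsOn_U_of (by omega) (fun t' _ q => I.dependsOn_X (by omega) q) q).mono
    (I.ball_mono (by omega) q) hxy

/-! ### Moments exist -/

theorem integral_comp_coordinate (v : Fin I.n) {g : ℝ → ℝ} (hg : Measurable g) :
    ∫ z0, g (z0 v) ∂I.law = ∫ x, g x ∂(gaussianReal 0 δ.toNNReal) := by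
  have h := measurePreserving_eval (fun _ : Fin I.n => gaussianReal 0 δ.toNNReal) v
  rw [← h.map_eq, integral_map h.measurable.aemeasurable hg.aestronglyMeasurable]
  rfl

theorem integral_coordinate (v : Fin I.n) : ∫ z0, z0 v ∂I.law = 0 := by
  rw [I.integral_comp_coordinate v (g := fun x => x) measurable_id, integral_id_gaussianReal]

theorem integral_coordinate_sq (v : Fin I.n) : ∫ z0, z0 v ^ 2 ∂I.law = δ := by
  rw [I.integral_comp_coordinate v (g := fun x => x ^ 2) (by fun_prop)]
  have h := variance_fun_id_gaussianReal (μ := 0) (v := δ.toNNReal)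
  rw [variance_eq_integral (by fun_prop), integral_id_gaussianReal] at h
  simpa [I.delta_pos.le] using h

theorem hasAllMoments_coordinate (v : Fin I.n) : HasAllMoments (fun z0 => z0 v) I.law :=
  ⟨measurable_pi_apply v, fun p hp =>
    (memLp_id_gaussianReal' p hp).comp_measurePreserving
      (measurePreserving_eval (fun _ : Fin I.n => gaussianReal 0 δ.toNNReal) v)⟩

theorem hasAllMoments_D_of {s : ℕ} (h : ∀ q, HasAllMoments (I.X s q) I.law) (p : I.Slot) :
    HasAllMoments (I.D s p) I.law := by
  simp only [funext (I.D_eq_sum s p)]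
  exact HasAllMoments.finset_sum fun S _ =>
    (HasAllMoments.finset_prod fun κ _ => h (p.1, κ)).const_mul _

theorem hasAllMoments_U_of {s : ℕ} (h : ∀ t ≤ s + 1, ∀ q, HasAllMoments (I.X t q) I.law)
    (q : I.Slot) : HasAllMoments (I.U s q) I.law := by
  simp only [funext (I.U_eq s q)]
  exact (HasAllMoments.finset_sum fun p _ => (I.hasAllMoments_D_of (h (s + 1) le_rfl) p).sub
    (I.hasAllMoments_D_of (h s (by omega)) p)).const_mul _

theorem hasAllMoments_A_of {s : ℕ} (hs : s < L) {q : I.Slot}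
    (h : ∀ t < s, HasAllMoments (I.U t q) I.law) : HasAllMoments (I.A s q) I.law :=
  HasAllMoments.of_bound ((I.measurable_F s hs (I.vert q) q.1).comp
    (measurable_pi_lambda _ fun t : Fin s => (h t t.2).1)) fun _ => I.abs_F_le s hs _ _ _

theorem hasAllMoments_X {s : ℕ} (hs : s ≤ L) (q : I.Slot) : HasAllMoments (I.X s q) I.law := by
  induction s using Nat.strong_induction_on generalizing q with
  | _ s ih =>
    match s, hs, ih with
    | 0, _, _ => exact HasAllMoments.const 0
    | 1, _, _ => exact I.hasAllMoments_coordinate _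
    | s + 2, hs, ih =>
      have hU : ∀ t ≤ s, HasAllMoments (I.U t q) I.law := fun t ht =>
        I.hasAllMoments_U_of (fun t' ht' q => ih t' (by omega) (by omega) q) q
      simp only [funext (I.X_succ s q)]
      exact (ih (s + 1) (by omega) (by omega) q).add
        ((I.hasAllMoments_A_of (by omega) fun t ht => hU t ht.le).mul (hU s le_rfl))

theorem hasAllMoments_D {s : ℕ} (hs : s ≤ L) (p : I.Slot) : HasAllMoments (I.D s p) I.law :=
  I.hasAllMoments_D_of (fun q => I.hasAllMoments_X hs q) p

theorem hasAllMoments_Y {s : ℕ} (hs : s < L) (p : I.Slot) : HasAllMoments (I.Y s p) I.law :=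
  (I.hasAllMoments_D hs p).sub (I.hasAllMoments_D hs.le p)

theorem hasAllMoments_U {s : ℕ} (hs : s < L) (q : I.Slot) : HasAllMoments (I.U s q) I.law :=
  I.hasAllMoments_U_of (fun _ ht q => I.hasAllMoments_X (by omega) q) q

theorem hasAllMoments_A {s : ℕ} (hs : s < L) (q : I.Slot) : HasAllMoments (I.A s q) I.law :=
  I.hasAllMoments_A_of hs fun _ ht => I.hasAllMoments_U (ht.trans hs) q

theorem abs_A_le {s : ℕ} (hs : s < L) (q : I.Slot) (z0 : Fin I.n → ℝ) : |I.A s q z0| ≤ K :=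
  I.abs_F_le s hs _ _ _

theorem integral_A_sq {s : ℕ} (hs : s < L) (q : I.Slot) :
    ∫ z0, I.A s q z0 ^ 2 ∂I.law = δ / nu f δ (s + 1) :=
  I.integral_msgA_sq s hs _ _ (I.mem_incident q)

/-! ### The martingale property -/

/-- The increment of the message in `q` at step `s` is orthogonal to every random variable that does
not involve the coordinates at distance `s` below `q`. -/
def OrthogonalX (I : Setting f δ K L) (s : ℕ) : Prop :=
  ∀ (q : I.Slot) (H : (Fin I.n → ℝ) → ℝ), HasAllMoments H I.law →
    DependsOn H (I.sphere s q)ᶜ → ∫ z0, (I.X (s + 1) q z0 - I.X s q z0) * H z0 ∂I.law = 0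

/-- A product of messages in the same hyperedge, telescoped: its increment inherits the
orthogonality of the increments of the factors. -/
theorem integral_prod_sub_prod_mul {s : ℕ} (hs : s < L) (h : I.OrthogonalX s) (p : I.Slot)
    {Q : Finset (Fin r)} (hQ : p.2 ∉ Q) {H : (Fin I.n → ℝ) → ℝ} (hH : HasAllMoments H I.law)
    (hd : ∀ κ ∈ Q, DependsOn H (I.sphere s (p.1, κ))ᶜ) :
    ∫ z0, (∏ κ ∈ Q, I.X (s + 1) (p.1, κ) z0 - ∏ κ ∈ Q, I.X s (p.1, κ) z0) * H z0 ∂I.law = 0 := by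
  induction Q using Finset.induction_on generalizing H with
  | empty => simp
  | insert κ Q hκ ih =>
    have hκp : κ ≠ p.2 := fun h' => hQ (h' ▸ Finset.mem_insert_self _ _)
    have hQp : ∀ κ' ∈ Q, κ' ≠ p.2 := fun κ' hκ' h' => hQ (h' ▸ Finset.mem_insert_of_mem hκ')
    have hX1 := fun q => I.hasAllMoments_X (s := s + 1) hs q
    have hX0 := fun q => I.hasAllMoments_X (s := s) hs.le q
    have hP1 : HasAllMoments (fun z0 => ∏ κ' ∈ Q, I.X (s + 1) (p.1, κ') z0) I.law :=
      HasAllMoments.finset_prod fun κ' _ => hX1 _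
    have hP0 : HasAllMoments (fun z0 => ∏ κ' ∈ Q, I.X s (p.1, κ') z0) I.law :=
      HasAllMoments.finset_prod fun κ' _ => hX0 _
    -- different slots of a hyperedge have disjoint trees
    have hdisj : ∀ t ≤ L, ∀ κ₁ κ₂ : Fin r, κ₁ ≠ p.2 → κ₂ ≠ p.2 → κ₁ ≠ κ₂ →
        I.ball t (p.1, κ₁) ⊆ (I.sphere s (p.1, κ₂))ᶜ := fun t ht κ₁ κ₂ h₁ h₂ hne =>
      ((I.disjoint_ball_ball ht (t := s + 1) hs rfl h₁ h₂ fun _ => hne).mono_right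
        (I.sphere_subset_ball s _)).subset_compl_right
    have e : ∀ z0, (∏ κ' ∈ insert κ Q, I.X (s + 1) (p.1, κ') z0
        - ∏ κ' ∈ insert κ Q, I.X s (p.1, κ') z0) * H z0
        = (∏ κ' ∈ Q, I.X (s + 1) (p.1, κ') z0 - ∏ κ' ∈ Q, I.X s (p.1, κ') z0)
            * (I.X (s + 1) (p.1, κ) z0 * H z0)
          + (I.X (s + 1) (p.1, κ) z0 - I.X s (p.1, κ) z0)
            * ((∏ κ' ∈ Q, I.X s (p.1, κ') z0) * H z0) := fun z0 => by
      rw [Finset.prod_insert hκ, Finset.prod_insert hκ]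
      ring
    simp only [e]
    rw [integral_add ((hP1.sub hP0).mul ((hX1 _).mul hH)).integrable
        (((hX1 _).sub (hX0 _)).mul (hP0.mul hH)).integrable,
      ih (fun h' => hQ (Finset.mem_insert_of_mem h')) ((hX1 _).mul hH) fun κ' hκ' => ?_,
      h _ _ (hP0.mul hH) ?_, add_zero]
    · refine dependsOn_map₂ (dependsOn_finset_prod fun κ' hκ' => ?_)
        (hd κ (Finset.mem_insert_self _ _)) (· * ·)
      exact (I.dependsOn_X hs.le _).mono
        (hdisj s hs.le κ' κ (hQp κ' hκ') hκp (ne_of_mem_of_not_mem hκ' hκ))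
    · exact dependsOn_map₂ ((I.dependsOn_X (s := s + 1) hs _).mono
        (hdisj (s + 1) hs κ κ' hκp (hQp κ' hκ') (ne_of_mem_of_not_mem hκ' hκ).symm))
        (hd κ' (Finset.mem_insert_of_mem hκ')) (· * ·)

theorem integral_Y_mul_of {s : ℕ} (hs : s < L) (h : I.OrthogonalX s) (p : I.Slot)
    {H : (Fin I.n → ℝ) → ℝ} (hH : HasAllMoments H I.law) (hd : DependsOn H (I.leaves s p)ᶜ) :
    ∫ z0, I.Y s p z0 * H z0 ∂I.law = 0 := by
  have e : ∀ z0, I.Y s p z0 * H z0 = ∑ S : Finset (Fin r) with p.2 ∈ S,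
      cubeFourierCoeff f S * ((∏ κ ∈ S.erase p.2, I.X (s + 1) (p.1, κ) z0
        - ∏ κ ∈ S.erase p.2, I.X s (p.1, κ) z0) * H z0) := fun z0 => by
    rw [Y, D_eq_sum, D_eq_sum, ← Finset.sum_sub_distrib, Finset.sum_mul]
    exact Finset.sum_congr rfl fun S _ => by ring
  simp only [e]
  rw [integral_finsetSum]
  · refine Finset.sum_eq_zero fun S _ => ?_
    rw [integral_const_mul, I.integral_prod_sub_prod_mul hs h p (Finset.notMem_erase _ _) hH
      fun κ hκ => hd.mono ?_, mul_zero]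
    exact Set.compl_subset_compl.2 fun v hv => ⟨κ, Finset.ne_of_mem_erase hκ, hv⟩
  · intro S _
    exact ((((HasAllMoments.finset_prod fun κ _ => I.hasAllMoments_X (s := s + 1) hs _).sub
      (HasAllMoments.finset_prod fun κ _ => I.hasAllMoments_X hs.le _)).mul hH).const_mul
        _).integrable

theorem orthogonalX {s : ℕ} (hs : s < L) : I.OrthogonalX s := by
  induction s with
  | zero =>
    intro q H hH hd
    simp only [zero_add, X_one, X_zero, sub_zero]
    have hv : I.vert q ∈ I.sphere 0 q := DirectedHypergraph.mem_sphere_zero _ _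
    have := integral_mul_of_dependsOn (μ := fun _ : Fin I.n => gaussianReal 0 δ.toNNReal)
      (X := fun z0 => z0 (I.vert q)) (Y := H) (S := {I.vert q}) (T := (I.sphere 0 q)ᶜ)
      (by simpa using hv) (fun x y h => h _ rfl) hd (measurable_pi_apply _) hH.1
    unfold law initLaw
    rw [this]
    have h0 := I.integral_coordinate (I.vert q)
    unfold law initLaw at h0
    rw [h0, zero_mul]
  | succ s ih =>
    intro q H hH hd
    have hs' : s < L := by omega
    have hA := (I.hasAllMoments_A hs' q).mul hH
    have e : ∀ z0, (I.X (s + 1 + 1) q z0 - I.X (s + 1) q z0) * H z0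
        = ∑ p ∈ I.incoming q, 1 / √((I.d : ℝ) - 1) * (I.Y s p z0 * (I.A s q z0 * H z0)) :=
      fun z0 => by
        rw [X_succ, U_eq, ← Finset.mul_sum, ← Finset.sum_mul]
        ring
    simp only [e]
    rw [integral_finsetSum _ fun p _ => (((I.hasAllMoments_Y hs' p).mul hA).const_mul _).integrable]
    refine Finset.sum_eq_zero fun p hp => ?_
    rw [integral_const_mul, I.integral_Y_mul_of hs' (ih hs') p hA, mul_zero]
    have hsub := Set.compl_subset_compl.2 (I.leaves_subset_sphere hs' hp)
    exact dependsOn_map₂ ((I.dependsOn_A hs'.le q).mono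
      ((I.disjoint_sphere_ball hs.le q).symm.subset_compl_right.trans hsub)) (hd.mono hsub) (· * ·)

/-- The increment of the derivative in the slot `p` is orthogonal to every random variable that does
not involve the leaves of the branch. -/
theorem integral_Y_mul {s : ℕ} (hs : s < L) (p : I.Slot) {H : (Fin I.n → ℝ) → ℝ}
    (hH : HasAllMoments H I.law) (hd : DependsOn H (I.leaves s p)ᶜ) :
    ∫ z0, I.Y s p z0 * H z0 ∂I.law = 0 := I.integral_Y_mul_of hs (I.orthogonalX hs) p hH hd

theorem integral_Y {s : ℕ} (hs : s < L) (p : I.Slot) : ∫ z0, I.Y s p z0 ∂I.law = 0 := by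
  have := I.integral_Y_mul hs p (HasAllMoments.const 1) (fun _ _ _ => rfl)
  simpa using this

theorem integral_X {s : ℕ} (hs : s ≤ L) (q : I.Slot) : ∫ z0, I.X s q z0 ∂I.law = 0 := by
  induction s with
  | zero => simp [X_zero]
  | succ s ih =>
    have h := I.orthogonalX (s := s) hs q _ (HasAllMoments.const 1) (fun _ _ _ => rfl)
    simp only [mul_one] at h
    rw [integral_sub (I.hasAllMoments_X hs q).integrable
      (I.hasAllMoments_X (by omega) q).integrable, ih (by omega), sub_zero] at h
    exact h

theorem integral_Y_mul_D {s t : ℕ} (hs : s < L) (hts : t ≤ s) (p : I.Slot) :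
    ∫ z0, I.Y s p z0 * I.D t p z0 ∂I.law = 0 :=
  I.integral_Y_mul hs p (I.hasAllMoments_D (by omega) p) <| (I.dependsOn_D (by omega) p).mono <|
    ((I.disjoint_leaves_branch hs p).mono_right
      (I.branch_mono hts p)).symm.subset_compl_right

theorem integral_Y_mul_Y {s t : ℕ} (hs : s < L) (hts : t < s) (p : I.Slot) :
    ∫ z0, I.Y s p z0 * I.Y t p z0 ∂I.law = 0 :=
  I.integral_Y_mul hs p (I.hasAllMoments_Y (by omega) p) <| (I.dependsOn_Y (by omega) p).mono <|
    ((I.disjoint_leaves_branch hs p).mono_right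
      (I.branch_mono hts p)).symm.subset_compl_right

end Setting

/-! ### Uniform fourth moment bounds -/

theorem pow_four_sum_le {ι : Type*} (s : Finset ι) (a : ι → ℝ) :
    (∑ i ∈ s, a i) ^ 4 ≤ (s.card : ℝ) ^ 3 * ∑ i ∈ s, a i ^ 4 := by
  have h1 := sq_sum_le_card_mul_sum_sq (s := s) (f := a)
  have h2 := sq_sum_le_card_mul_sum_sq (s := s) (f := fun i => a i ^ 2)
  have h3 : (∑ i ∈ s, a i) ^ 4 ≤ ((s.card : ℝ) * ∑ i ∈ s, a i ^ 2) ^ 2 := by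
    rw [show (∑ i ∈ s, a i) ^ 4 = ((∑ i ∈ s, a i) ^ 2) ^ 2 by ring]
    exact pow_le_pow_left₀ (sq_nonneg _) h1 2
  refine h3.trans ?_
  rw [mul_pow]
  calc (s.card : ℝ) ^ 2 * (∑ i ∈ s, a i ^ 2) ^ 2
      ≤ (s.card : ℝ) ^ 2 * (s.card * ∑ i ∈ s, (a i ^ 2) ^ 2) := by gcongr
    _ = _ := by
      simp only [← pow_mul]
      ring

theorem pow_four_add_le (a b : ℝ) : (a + b) ^ 4 ≤ 8 * (a ^ 4 + b ^ 4) := by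
  nlinarith [sq_nonneg (a ^ 2 - b ^ 2), sq_nonneg (a - b), mul_nonneg (sq_nonneg (a - b))
    (sq_nonneg (a + b)), mul_nonneg (sq_nonneg (a - b)) (sq_nonneg a),
    mul_nonneg (sq_nonneg (a - b)) (sq_nonneg b), sq_nonneg ((a - b) ^ 2)]

theorem pow_four_sub_le (a b : ℝ) : (a - b) ^ 4 ≤ 8 * (a ^ 4 + b ^ 4) := by
  have := pow_four_add_le a (-b)
  rwa [← sub_eq_add_neg, Even.neg_pow (by decide)] at this

namespace Setting

variable {r : ℕ} {f : (Fin r → ℤˣ) → ℝ} {δ K : ℝ} {L : ℕ} (I : Setting f δ K L)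

theorem pairwiseDisjoint_ball {s : ℕ} (hs : s ≤ L) (p : I.Slot) {Q : Finset (Fin r)}
    (hQ : p.2 ∉ Q) : (Q : Set (Fin r)).PairwiseDisjoint fun κ => I.ball s (p.1, κ) :=
  fun _ hκ _ hκ' hne => I.disjoint_ball_ball hs hs rfl (ne_of_mem_of_not_mem hκ hQ)
    (ne_of_mem_of_not_mem hκ' hQ) fun _ => hne

/-- The messages within a hyperedge are independent. -/
theorem integral_prod_comp_X {s : ℕ} (hs : s ≤ L) (p : I.Slot) {Q : Finset (Fin r)}
    (hQ : p.2 ∉ Q) {g : Fin r → ℝ → ℝ} (hg : ∀ κ, Measurable (g κ)) :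
    ∫ z0, ∏ κ ∈ Q, g κ (I.X s (p.1, κ) z0) ∂I.law
      = ∏ κ ∈ Q, ∫ z0, g κ (I.X s (p.1, κ) z0) ∂I.law :=
  integral_prod_of_dependsOn (μ := fun _ : Fin I.n => gaussianReal 0 δ.toNNReal)
    (X := fun κ z0 => g κ (I.X s (p.1, κ) z0)) (I.pairwiseDisjoint_ball hs p hQ)
    (fun κ _ => dependsOn_map (I.dependsOn_X hs _) (g κ))
    (fun κ _ => (hg κ).comp (I.hasAllMoments_X hs _).1)

theorem integral_D_pow_four_le {s : ℕ} (hs : s ≤ L) {C : ℝ} (hC : 1 ≤ C)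
    (h : ∀ q, ∫ z0, I.X s q z0 ^ 4 ∂I.law ≤ C) (p : I.Slot) :
    ∫ z0, I.D s p z0 ^ 4 ∂I.law ≤
      (2 ^ r) ^ 3 * ∑ S : Finset (Fin r), cubeFourierCoeff f S ^ 4 * C ^ r := by
  set T : Finset (Finset (Fin r)) := Finset.univ.filter fun S => p.2 ∈ S with hT
  have hX := fun q => I.hasAllMoments_X hs q
  have hcard : (T.card : ℝ) ≤ 2 ^ r := by
    have : T.card ≤ 2 ^ r := by
      refine (Finset.card_filter_le _ _).trans_eq ?_
      simp
    exact_mod_cast this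
  have hpt : ∀ z0, I.D s p z0 ^ 4 ≤ (2 ^ r) ^ 3 *
      ∑ S ∈ T, cubeFourierCoeff f S ^ 4 * ∏ κ ∈ S.erase p.2, I.X s (p.1, κ) z0 ^ 4 := fun z0 => by
    rw [D_eq_sum]
    refine (pow_four_sum_le _ _).trans ?_
    have e : ∑ S ∈ T, (cubeFourierCoeff f S * ∏ κ ∈ S.erase p.2, I.X s (p.1, κ) z0) ^ 4
        = ∑ S ∈ T, cubeFourierCoeff f S ^ 4 * ∏ κ ∈ S.erase p.2, I.X s (p.1, κ) z0 ^ 4 :=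
      Finset.sum_congr rfl fun S _ => by rw [mul_pow, Finset.prod_pow]
    rw [e]
    have h0 : 0 ≤ ∑ S ∈ T, cubeFourierCoeff f S ^ 4 * ∏ κ ∈ S.erase p.2, I.X s (p.1, κ) z0 ^ 4 :=
      Finset.sum_nonneg fun S _ => mul_nonneg (by positivity)
        (Finset.prod_nonneg fun κ _ => by positivity)
    gcongr
  have hm : ∀ S : Finset (Fin r), HasAllMoments (fun z0 => cubeFourierCoeff f S ^ 4 *
      ∏ κ ∈ S.erase p.2, I.X s (p.1, κ) z0 ^ 4) I.law := fun S =>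
    (HasAllMoments.finset_prod fun κ _ => (hX _).pow 4).const_mul _
  refine (integral_mono ((I.hasAllMoments_D hs p).pow 4).integrable
    ((HasAllMoments.finset_sum fun S _ => hm S).const_mul _).integrable hpt).trans ?_
  rw [integral_const_mul, integral_finsetSum _ fun S _ => (hm S).integrable]
  gcongr
  have h1 : ∀ S : Finset (Fin r), ∫ z0, cubeFourierCoeff f S ^ 4 *
      ∏ κ ∈ S.erase p.2, I.X s (p.1, κ) z0 ^ 4 ∂I.law ≤ cubeFourierCoeff f S ^ 4 * C ^ r := by
    intro S
    rw [integral_const_mul, I.integral_prod_comp_X hs p (Finset.notMem_erase _ _)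
      (g := fun _ x => x ^ 4) (fun _ => by fun_prop)]
    gcongr
    refine (Finset.prod_le_prod (fun κ _ => integral_nonneg fun _ => by positivity)
      fun κ _ => h _).trans ?_
    rw [Finset.prod_const]
    refine pow_le_pow_right₀ hC ((Finset.card_le_univ _).trans_eq ?_)
    simp
  refine (Finset.sum_le_sum fun S _ => h1 S).trans ?_
  exact Finset.sum_le_sum_of_subset_of_nonneg (Finset.subset_univ _) fun S _ _ => by positivity

theorem integral_Y_pow_four_le {s : ℕ} (hs : s < L) {C : ℝ} (hC : 1 ≤ C)
    (h : ∀ t ≤ s + 1, ∀ q, ∫ z0, I.X t q z0 ^ 4 ∂I.law ≤ C) (p : I.Slot) :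
    ∫ z0, I.Y s p z0 ^ 4 ∂I.law ≤
      16 * ((2 ^ r) ^ 3 * ∑ S : Finset (Fin r), cubeFourierCoeff f S ^ 4 * C ^ r) := by
  have h1 := I.integral_D_pow_four_le hs hC (h (s + 1) le_rfl) p
  have h0 := I.integral_D_pow_four_le hs.le hC (h s (by omega)) p
  have m1 := (I.hasAllMoments_D hs p).pow 4
  have m0 := (I.hasAllMoments_D hs.le p).pow 4
  have := integral_mono ((I.hasAllMoments_Y hs p).pow 4).integrable
    ((m1.add m0).const_mul 8).integrable fun z0 => pow_four_sub_le _ _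
  rw [integral_const_mul, integral_add m1.integrable m0.integrable] at this
  linarith

theorem one_le_d_sub_one : (1 : ℝ) ≤ (I.d : ℝ) - 1 := by
  have : (2 : ℝ) ≤ I.d := by exact_mod_cast I.two_le
  linarith

theorem cast_card_incoming (q : I.Slot) : ((I.incoming q).card : ℝ) = (I.d : ℝ) - 1 := by
  rw [card_incoming, Nat.cast_sub (by linarith [I.two_le]), Nat.cast_one]

theorem pairwiseDisjoint_branch_of_subset {s : ℕ} (hs : s ≤ L) {i : Fin I.n}
    {B : Finset I.Slot} (hB : B ⊆ I.slots i) :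
    (B : Set I.Slot).PairwiseDisjoint (I.branch s) :=
  (I.pairwiseDisjoint_branch hs i).subset (Finset.coe_subset.2 hB)

theorem integral_sum_Y_pow_four_le {s : ℕ} (hs : s < L) {C : ℝ} (hC : 1 ≤ C) {i : Fin I.n}
    {B : Finset I.Slot} (hB : B ⊆ I.slots i) (h : ∀ p, ∫ z0, I.Y s p z0 ^ 4 ∂I.law ≤ C) :
    ∫ z0, (1 / √(B.card : ℝ) * ∑ p ∈ B, I.Y s p z0) ^ 4 ∂I.law ≤ 3 * C ^ 2 := by
  have h1 := integral_pow_four_sum_le (μ := fun _ : Fin I.n => gaussianReal 0 δ.toNNReal)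
    (I.pairwiseDisjoint_branch_of_subset (s := s + 1) hs hB)
    (fun p _ => I.dependsOn_Y hs p) (fun p _ => I.hasAllMoments_Y hs p)
    (fun p _ => I.integral_Y hs p) hC (fun p _ => h p)
  simp only [mul_pow]
  rw [integral_const_mul]
  have e : (1 / √(B.card : ℝ)) ^ 4 = 1 / (B.card : ℝ) ^ 2 := by
    rw [div_pow, one_pow, show √(B.card : ℝ) ^ 4 = (√(B.card : ℝ) ^ 2) ^ 2 by ring,
      Real.sq_sqrt (Nat.cast_nonneg _)]
  rw [e]
  refine (mul_le_mul_of_nonneg_left h1 (by positivity)).trans ?_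
  rcases eq_or_ne (B.card : ℝ) 0 with h0 | h0
  · rw [h0]
    simp
    positivity
  · exact le_of_eq (by field_simp)

theorem U_eq_card (s : ℕ) (q : I.Slot) (z0 : Fin I.n → ℝ) :
    I.U s q z0 = 1 / √((I.incoming q).card : ℝ) * ∑ p ∈ I.incoming q, I.Y s p z0 := by
  rw [U_eq, cast_card_incoming]

theorem exists_integral_X_pow_four_le (f : (Fin r → ℤˣ) → ℝ) (δ K : ℝ) (L : ℕ) {s : ℕ}
    (hs : s ≤ L) : ∃ C : ℝ, 1 ≤ C ∧ ∀ I : Setting f δ K L, ∀ t ≤ s, ∀ q,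
      ∫ z0, I.X t q z0 ^ 4 ∂I.law ≤ C := by
  induction s with
  | zero =>
    refine ⟨1, le_rfl, fun I t ht q => ?_⟩
    obtain rfl : t = 0 := by omega
    simp [X_zero]
  | succ s ih =>
    obtain ⟨C, hC, h⟩ := ih (by omega)
    -- it suffices to bound the last message
    suffices hlast : ∃ C' : ℝ, ∀ I : Setting f δ K L, ∀ q,
        ∫ z0, I.X (s + 1) q z0 ^ 4 ∂I.law ≤ C' by
      obtain ⟨C', h'⟩ := hlast
      refine ⟨max C C', le_max_of_le_left hC, fun I t ht q => ?_⟩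
      rcases Nat.lt_or_ge s t with h1 | h1
      · obtain rfl : t = s + 1 := by omega
        exact (h' I q).trans (le_max_right _ _)
      · exact (h I t h1 q).trans (le_max_left _ _)
    cases s with
    | zero =>
      refine ⟨∫ x, x ^ 4 ∂(gaussianReal 0 δ.toNNReal), fun I q => ?_⟩
      simp only [zero_add, X_one]
      exact (I.integral_comp_coordinate (I.vert q) (g := fun x => x ^ 4) (by fun_prop)).le
    | succ s =>
      set CY : ℝ := max 1 (16 * ((2 ^ r) ^ 3 * ∑ S : Finset (Fin r),
        cubeFourierCoeff f S ^ 4 * C ^ r)) with hCY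
      refine ⟨8 * (C + K ^ 4 * (3 * CY ^ 2)), fun I q => ?_⟩
      have hs' : s < L := by omega
      have hY : ∀ p, ∫ z0, I.Y s p z0 ^ 4 ∂I.law ≤ CY := fun p =>
        (I.integral_Y_pow_four_le hs' hC (h I) p).trans (le_max_right _ _)
      have hU : ∫ z0, I.U s q z0 ^ 4 ∂I.law ≤ 3 * CY ^ 2 := by
        simp only [U_eq_card]
        exact I.integral_sum_Y_pow_four_le hs' (le_max_left _ _) (I.incoming_subset_slots q) hY
      have hpt : ∀ z0, I.X (s + 1 + 1) q z0 ^ 4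
          ≤ 8 * (I.X (s + 1) q z0 ^ 4 + K ^ 4 * I.U s q z0 ^ 4) := fun z0 => by
        rw [X_succ]
        refine (pow_four_add_le _ _).trans ?_
        have hA : I.A s q z0 ^ 4 ≤ K ^ 4 := by
          rw [← Even.pow_abs (by decide) (I.A s q z0)]
          exact pow_le_pow_left₀ (abs_nonneg _) (I.abs_A_le hs' q z0) 4
        rw [mul_pow]
        have : 0 ≤ I.U s q z0 ^ 4 := by positivity
        gcongr
      have m1 := (I.hasAllMoments_X (s := s + 1) (by omega) q).pow 4
      have m2 := ((I.hasAllMoments_U hs' q).pow 4).const_mul (K ^ 4)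
      refine (integral_mono ((I.hasAllMoments_X hs q).pow 4).integrable
        ((m1.add m2).const_mul 8).integrable hpt).trans ?_
      rw [integral_const_mul, integral_add m1.integrable m2.integrable, integral_const_mul]
      gcongr
      exact h I (s + 1) le_rfl q

theorem exists_integral_Y_pow_four_le (f : (Fin r → ℤˣ) → ℝ) (δ K : ℝ) (L : ℕ) :
    ∃ C : ℝ, 1 ≤ C ∧ ∀ I : Setting f δ K L, ∀ s < L, ∀ p,
      ∫ z0, I.Y s p z0 ^ 4 ∂I.law ≤ C := by
  obtain ⟨C, hC, h⟩ := exists_integral_X_pow_four_le f δ K L le_rfl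
  exact ⟨max 1 _, le_max_left _ _, fun I s hs p =>
    (I.integral_Y_pow_four_le hs hC (fun t ht => h I t (by omega)) p).trans (le_max_right _ _)⟩

/-! ### Second moments -/

/-- The second moments of the derivative are given by its Fourier expansion. -/
theorem integral_D_sq {s : ℕ} (hs : s ≤ L) (p : I.Slot) :
    ∫ z0, I.D s p z0 ^ 2 ∂I.law = ∑ S : Finset (Fin r) with p.2 ∈ S,
      cubeFourierCoeff f S ^ 2 * ∏ κ ∈ S.erase p.2, ∫ z0, I.X s (p.1, κ) z0 ^ 2 ∂I.law := by
  have hX := fun q => I.hasAllMoments_X hs q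
  have hm : ∀ S : Finset (Fin r), HasAllMoments (fun z0 => cubeFourierCoeff f S *
      ∏ κ ∈ S.erase p.2, I.X s (p.1, κ) z0) I.law := fun S =>
    (HasAllMoments.finset_prod fun κ _ => hX _).const_mul _
  -- distinct monomials are orthogonal
  have horth : ∀ S T : Finset (Fin r), p.2 ∈ S → p.2 ∈ T → S ≠ T →
      ∫ z0, (∏ κ ∈ S.erase p.2, I.X s (p.1, κ) z0) * ∏ κ ∈ T.erase p.2, I.X s (p.1, κ) z0 ∂I.law
        = 0 := by
    intro S T hS hT hne
    have e : ∀ (R : Finset (Fin r)) z0, ∏ κ ∈ R.erase p.2, I.X s (p.1, κ) z0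
        = ∏ κ ∈ Finset.univ.erase p.2, if κ ∈ R then I.X s (p.1, κ) z0 else 1 := fun R z0 => by
      rw [← Finset.prod_filter]
      congr 1
      ext κ
      simp
    simp only [e, ← Finset.prod_mul_distrib]
    have := I.integral_prod_comp_X hs p (Finset.notMem_erase p.2 Finset.univ)
      (g := fun κ x => (if κ ∈ S then x else 1) * if κ ∈ T then x else 1) (fun κ => by
        split_ifs <;> fun_prop)
    rw [this]
    obtain ⟨κ, hκ⟩ : ∃ κ, ¬ (κ ∈ S ↔ κ ∈ T) := by
      by_contra! h
      exact hne (Finset.ext h)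
    have hκp : κ ≠ p.2 := by
      rintro rfl
      exact hκ (by simp [hS, hT])
    refine Finset.prod_eq_zero (Finset.mem_erase.2 ⟨hκp, Finset.mem_univ κ⟩) ?_
    by_cases hκS : κ ∈ S
    · have hκT : κ ∉ T := fun h => hκ (by simp [hκS, h])
      simpa [hκS, hκT] using I.integral_X hs _
    · have hκT : κ ∈ T := by
        by_contra h
        exact hκ (by simp [hκS, h])
      simpa [hκS, hκT] using I.integral_X hs _
  simp only [D_eq_sum, sq, Finset.sum_mul_sum]
  rw [integral_finsetSum _ fun S _ => integrable_finsetSum _ fun T _ =>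
    ((hm S).mul (hm T)).integrable]
  refine Finset.sum_congr rfl fun S hS => ?_
  rw [integral_finsetSum _ fun T _ => ((hm S).mul (hm T)).integrable]
  have e : ∀ (T : Finset (Fin r)) z0, (cubeFourierCoeff f S * ∏ κ ∈ S.erase p.2, I.X s (p.1, κ) z0)
      * (cubeFourierCoeff f T * ∏ κ ∈ T.erase p.2, I.X s (p.1, κ) z0)
      = cubeFourierCoeff f S * cubeFourierCoeff f T * ((∏ κ ∈ S.erase p.2, I.X s (p.1, κ) z0)
        * ∏ κ ∈ T.erase p.2, I.X s (p.1, κ) z0) := fun T z0 => by ring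
  simp only [e, integral_const_mul]
  rw [Finset.sum_eq_single_of_mem S hS fun T hT hne => by
    rw [horth S T (Finset.mem_filter.1 hS).2 (Finset.mem_filter.1 hT).2 hne.symm, mul_zero]]
  congr 1
  simp only [← Finset.prod_mul_distrib]
  exact I.integral_prod_comp_X hs p (Finset.notMem_erase _ _) (g := fun _ x => x * x)
    (fun _ => by fun_prop)

theorem integral_Y_sq {s : ℕ} (hs : s < L) (p : I.Slot) :
    ∫ z0, I.Y s p z0 ^ 2 ∂I.law
      = ∫ z0, I.D (s + 1) p z0 ^ 2 ∂I.law - ∫ z0, I.D s p z0 ^ 2 ∂I.law := by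
  have hY := I.hasAllMoments_Y hs p
  have hD := I.hasAllMoments_D hs.le p
  have e : ∀ z0, I.D (s + 1) p z0 ^ 2
      = I.Y s p z0 ^ 2 + I.D s p z0 ^ 2 + 2 * (I.Y s p z0 * I.D s p z0) := fun z0 => by
    unfold Y
    ring
  simp only [e]
  rw [integral_add ((hY.pow 2).add (hD.pow 2)).integrable ((hY.mul hD).const_mul 2).integrable,
    integral_add (hY.pow 2).integrable (hD.pow 2).integrable, integral_const_mul,
    I.integral_Y_mul_D hs le_rfl p]
  ring

/-- In the second moment of `A U`, the cross terms vanish because the multiplier does not involve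
the leaves. -/
theorem integral_A_mul_U_sq {s : ℕ} (hs : s < L) (q : I.Slot) :
    ∫ z0, (I.A s q z0 * I.U s q z0) ^ 2 ∂I.law
      = 1 / ((I.d : ℝ) - 1) * ∑ p ∈ I.incoming q, ∫ z0, I.A s q z0 ^ 2 * I.Y s p z0 ^ 2 ∂I.law := by
  have hA := (I.hasAllMoments_A hs q).pow 2
  have hY := fun p => I.hasAllMoments_Y hs p
  have e : ∀ z0, (I.A s q z0 * I.U s q z0) ^ 2 = 1 / ((I.d : ℝ) - 1) *
      ∑ p ∈ I.incoming q, ∑ p' ∈ I.incoming q, I.Y s p z0 * (I.A s q z0 ^ 2 * I.Y s p' z0) :=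
    fun z0 => by
      have h1 : (1 / √((I.d : ℝ) - 1)) ^ 2 = 1 / ((I.d : ℝ) - 1) := by
        rw [div_pow, one_pow, Real.sq_sqrt (by linarith [I.one_le_d_sub_one])]
      have h2 : ∑ p ∈ I.incoming q, ∑ p' ∈ I.incoming q, I.Y s p z0 * (I.A s q z0 ^ 2 * I.Y s p' z0)
          = I.A s q z0 ^ 2 * (∑ p ∈ I.incoming q, I.Y s p z0) ^ 2 := by
        rw [sq (∑ p ∈ I.incoming q, I.Y s p z0), Finset.sum_mul_sum, Finset.mul_sum]
        refine Finset.sum_congr rfl fun p _ => ?_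
        rw [Finset.mul_sum]
        exact Finset.sum_congr rfl fun p' _ => by ring
      rw [U_eq, h2, mul_pow, mul_pow, h1]
      ring
  simp only [e, integral_const_mul]
  congr 1
  rw [integral_finsetSum _ fun p _ => integrable_finsetSum _ fun p' _ =>
    ((hY p).mul (hA.mul (hY p'))).integrable]
  refine Finset.sum_congr rfl fun p hp => ?_
  rw [integral_finsetSum _ fun p' _ => ((hY p).mul (hA.mul (hY p'))).integrable,
    Finset.sum_eq_single_of_mem p hp fun p' hp' hne => ?_]
  · exact integral_congr_ae (Filter.Eventually.of_forall fun z0 => by ring)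
  · refine I.integral_Y_mul hs p (hA.mul (hY p')) (dependsOn_map₂
      ((dependsOn_map (I.dependsOn_A hs.le q) (· ^ 2)).mono ?_)
      ((I.dependsOn_Y hs p').mono ?_) (· * ·))
    · exact ((I.disjoint_sphere_ball hs q).mono_left
        (I.leaves_subset_sphere hs hp)).symm.subset_compl_right
    · refine ((I.disjoint_branch (s := s + 1) (t := s + 1) hs hs ?_ hne.symm).mono_left
        (I.leaves_subset_branch s p)).symm.subset_compl_right
      exact (I.mem_incoming.1 hp).1.trans (I.mem_incoming.1 hp').1.symm

theorem integral_X_sq_succ {s : ℕ} (hs : s + 1 < L) (q : I.Slot) :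
    ∫ z0, I.X (s + 2) q z0 ^ 2 ∂I.law = ∫ z0, I.X (s + 1) q z0 ^ 2 ∂I.law
      + ∫ z0, (I.A s q z0 * I.U s q z0) ^ 2 ∂I.law := by
  have hX1 := I.hasAllMoments_X (s := s + 1) hs.le q
  have hAU := (I.hasAllMoments_A (s := s) (by omega) q).mul
    (I.hasAllMoments_U (s := s) (by omega) q)
  have horth := I.orthogonalX hs q (I.X (s + 1) q) hX1 <| (I.dependsOn_X hs.le q).mono
    (I.disjoint_sphere_ball hs.le q).symm.subset_compl_right
  have e1 : ∀ z0, (I.X (s + 1 + 1) q z0 - I.X (s + 1) q z0) * I.X (s + 1) q z0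
      = (I.A s q z0 * I.U s q z0) * I.X (s + 1) q z0 := fun z0 => by rw [X_succ]; ring
  simp only [e1] at horth
  have e : ∀ z0, I.X (s + 2) q z0 ^ 2 = I.X (s + 1) q z0 ^ 2 + (I.A s q z0 * I.U s q z0) ^ 2
      + 2 * ((I.A s q z0 * I.U s q z0) * I.X (s + 1) q z0) := fun z0 => by rw [X_succ]; ring
  simp only [e]
  rw [integral_add ((hX1.pow 2).add (hAU.pow 2)).integrable ((hAU.mul hX1).const_mul 2).integrable,
    integral_add (hX1.pow 2).integrable (hAU.pow 2).integrable, integral_const_mul, horth]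
  ring

/-- Law of large numbers: the multiplier and the squared increments decouple. -/
theorem abs_integral_A_mul_sub_le {s : ℕ} (hs : s < L) {C : ℝ} (hC : 1 ≤ C)
    (h : ∀ p, ∫ z0, I.Y s p z0 ^ 4 ∂I.law ≤ C) (q : I.Slot) :
    |∫ z0, (I.A s q z0 * I.U s q z0) ^ 2 ∂I.law - (∫ z0, I.A s q z0 ^ 2 ∂I.law) *
        (1 / ((I.d : ℝ) - 1) * ∑ p ∈ I.incoming q, ∫ z0, I.Y s p z0 ^ 2 ∂I.law)|
      ≤ K ^ 2 * (C / √((I.d : ℝ) - 1)) := by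
  set k : ℝ := (I.d : ℝ) - 1 with hk
  have hk1 : 1 ≤ k := I.one_le_d_sub_one
  have hA := (I.hasAllMoments_A hs q).pow 2
  have hY := fun p => (I.hasAllMoments_Y hs p).pow 2
  set Z : I.Slot → (Fin I.n → ℝ) → ℝ := fun p z0 => I.Y s p z0 ^ 2 - ∫ z, I.Y s p z ^ 2 ∂I.law
    with hZ
  have hZm : ∀ p, HasAllMoments (Z p) I.law := fun p => (hY p).sub (HasAllMoments.const _)
  have hZ0 : ∀ p, ∫ z0, Z p z0 ∂I.law = 0 := fun p => by
    simp only [hZ]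
    rw [integral_sub (hY p).integrable (integrable_const _)]
    simp
  have hZ2 : ∀ p, ∫ z0, Z p z0 ^ 2 ∂I.law ≤ C := fun p => by
    set v := ∫ z, I.Y s p z ^ 2 ∂I.law with hv
    have e : ∀ z0, Z p z0 ^ 2 = I.Y s p z0 ^ 4 - 2 * v * I.Y s p z0 ^ 2 + v ^ 2 := fun z0 => by
      simp only [hZ]
      ring
    simp only [e]
    have m4 := (I.hasAllMoments_Y hs p).pow 4
    rw [integral_add (m4.sub ((hY p).const_mul _)).integrable (integrable_const _),
      integral_sub m4.integrable ((hY p).const_mul _).integrable, integral_const_mul, ← hv]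
    simp
    nlinarith [h p, sq_nonneg v]
  set S : (Fin I.n → ℝ) → ℝ := fun z0 => ∑ p ∈ I.incoming q, Z p z0 with hS
  have hSm : HasAllMoments S I.law := HasAllMoments.finset_sum fun p _ => hZm p
  have hS2 : ∫ z0, S z0 ^ 2 ∂I.law ≤ C * k := by
    have h1 := integral_sq_sum_of_dependsOn (μ := fun _ : Fin I.n => gaussianReal 0 δ.toNNReal)
      (I.pairwiseDisjoint_branch_of_subset (s := s + 1) hs (I.incoming_subset_slots q))
      (fun p _ => dependsOn_map (I.dependsOn_Y hs p) (fun y => y ^ 2 - ∫ z, I.Y s p z ^ 2 ∂I.law))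
      (fun p _ => hZm p) (fun p _ => hZ0 p)
    refine h1.trans_le ?_
    rw [hk, ← I.cast_card_incoming q, mul_comm, ← nsmul_eq_mul]
    exact Finset.sum_le_card_nsmul _ _ _ fun p _ => hZ2 p
  -- the weight `√k` balances the two terms of the arithmetic-geometric mean inequality
  have hSabs : ∫ z0, |S z0| ∂I.law ≤ C * √k := by
    have hsk : 0 < √k := Real.sqrt_pos.2 (by linarith)
    have hpt : ∀ z0, |S z0| ≤ 1 / 2 * √k + 1 / (2 * √k) * S z0 ^ 2 := fun z0 => by
      have e : 1 / 2 * √k + 1 / (2 * √k) * S z0 ^ 2 - |S z0| = (√k - |S z0|) ^ 2 / (2 * √k) := by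
        rw [← sq_abs (S z0)]
        field_simp
        ring
      have : 0 ≤ (√k - |S z0|) ^ 2 / (2 * √k) := by positivity
      linarith
    have hi := integral_mono (μ := I.law) hSm.integrable.abs
      ((HasAllMoments.const (1 / 2 * √k)).add ((hSm.pow 2).const_mul _)).integrable hpt
    rw [integral_add (integrable_const _) ((hSm.pow 2).const_mul _).integrable] at hi
    simp only [integral_const_mul, integral_const, probReal_univ, one_smul] at hi
    have h2 : 1 / (2 * √k) * ∫ z0, S z0 ^ 2 ∂I.law ≤ 1 / (2 * √k) * (C * k) := by gcongr
    have h3 : 1 / (2 * √k) * (C * k) = C / 2 * √k := by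
      have : k = √k * √k := (Real.mul_self_sqrt (by linarith)).symm
      field_simp
      rw [Real.sq_sqrt (by linarith)]
    nlinarith
  have hdiff : ∫ z0, (I.A s q z0 * I.U s q z0) ^ 2 ∂I.law - (∫ z0, I.A s q z0 ^ 2 ∂I.law) *
      (1 / k * ∑ p ∈ I.incoming q, ∫ z0, I.Y s p z0 ^ 2 ∂I.law)
      = 1 / k * ∫ z0, I.A s q z0 ^ 2 * S z0 ∂I.law := by
    have e : ∀ z0, I.A s q z0 ^ 2 * S z0 = ∑ p ∈ I.incoming q, (I.A s q z0 ^ 2 * I.Y s p z0 ^ 2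
        - I.A s q z0 ^ 2 * ∫ z, I.Y s p z ^ 2 ∂I.law) := fun z0 => by
      simp only [hS, hZ, Finset.mul_sum, mul_sub]
    simp only [e]
    have e2 : ∀ p, ∫ z0, (I.A s q z0 ^ 2 * I.Y s p z0 ^ 2
        - I.A s q z0 ^ 2 * ∫ z, I.Y s p z ^ 2 ∂I.law) ∂I.law
        = ∫ z0, I.A s q z0 ^ 2 * I.Y s p z0 ^ 2 ∂I.law
          - (∫ z0, I.A s q z0 ^ 2 ∂I.law) * ∫ z0, I.Y s p z0 ^ 2 ∂I.law := fun p => by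
      rw [integral_sub (hA.mul (hY p)).integrable (hA.mul (HasAllMoments.const _)).integrable,
        integral_mul_const]
    rw [I.integral_A_mul_U_sq hs q, integral_finsetSum _ fun p _ =>
      ((hA.mul (hY p)).sub (hA.mul (HasAllMoments.const _))).integrable]
    simp only [e2]
    rw [Finset.sum_sub_distrib, ← Finset.mul_sum]
    ring
  rw [hdiff, abs_mul, abs_of_nonneg (by positivity : 0 ≤ 1 / k)]
  have hb : |∫ z0, I.A s q z0 ^ 2 * S z0 ∂I.law| ≤ K ^ 2 * (C * √k) := by
    refine (norm_integral_le_of_norm_le (f := fun z0 => I.A s q z0 ^ 2 * S z0)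
      (hSm.integrable.abs.const_mul (K ^ 2))
      (Filter.Eventually.of_forall fun z0 => ?_)).trans ?_
    · rw [Real.norm_eq_abs, abs_mul, abs_of_nonneg (sq_nonneg _)]
      refine mul_le_mul_of_nonneg_right ?_ (abs_nonneg _)
      rw [← sq_abs]
      exact pow_le_pow_left₀ (abs_nonneg _) (I.abs_A_le hs q z0) 2
    · rw [integral_const_mul]
      gcongr
  calc 1 / k * |∫ z0, I.A s q z0 ^ 2 * S z0 ∂I.law| ≤ 1 / k * (K ^ 2 * (C * √k)) := by gcongr
    _ = K ^ 2 * (C / √k) := by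
      have : √k ≠ 0 := (Real.sqrt_pos.2 (by linarith)).ne'
      field_simp
      rw [Real.sq_sqrt (by linarith), mul_comm]

end Setting

/-! ### The limiting variances -/

section Variances

variable {r : ℕ} {f : (Fin r → ℤˣ) → ℝ} {δ : ℝ}

/-- The second moment of the partial derivative of `f` in the coordinate `ι` at independent centered
arguments of variance `x`. -/
noncomputable def derivVariance (f : (Fin r → ℤˣ) → ℝ) (ι : Fin r) (x : ℝ) : ℝ :=
  ∑ S : Finset (Fin r) with ι ∈ S, cubeFourierCoeff f S ^ 2 * x ^ (S.erase ι).card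

theorem derivative_mixture_eval (f : (Fin r → ℤˣ) → ℝ) (x : ℝ) :
    (mixture f).derivative.eval x = ∑ ι, derivVariance f ι x := by
  -- both sides are `∑ S, |S| * \hat f(S)² * x ^ (|S| - 1)`
  have h1 : ∑ ι, derivVariance f ι x
      = ∑ S : Finset (Fin r), cubeFourierCoeff f S ^ 2 * (S.card * x ^ (S.card - 1)) := by
    unfold derivVariance
    simp only [Finset.sum_filter]
    rw [Finset.sum_comm]
    refine Finset.sum_congr rfl fun S _ => ?_
    rw [← Finset.sum_filter]
    have : ∀ ι ∈ Finset.univ.filter (fun ι => ι ∈ S), cubeFourierCoeff f S ^ 2 *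
        x ^ (S.erase ι).card = cubeFourierCoeff f S ^ 2 * x ^ (S.card - 1) := fun ι hι => by
      rw [Finset.card_erase_of_mem (Finset.mem_filter.1 hι).2]
    rw [Finset.sum_congr rfl this, Finset.sum_const, Finset.filter_univ_mem, nsmul_eq_mul]
    ring
  have h2 : (mixture f).derivative.eval x = ∑ j ∈ Finset.Icc 1 r,
      ∑ S ∈ Finset.powersetCard j (Finset.univ : Finset (Fin r)),
        cubeFourierCoeff f S ^ 2 * (S.card * x ^ (S.card - 1)) := by
    unfold mixture
    simp only [Polynomial.derivative_sum, Polynomial.eval_finsetSum,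
      Polynomial.derivative_C_mul_X_pow, Polynomial.eval_mul, Polynomial.eval_C,
      Polynomial.eval_pow, Polynomial.eval_X]
    refine Finset.sum_congr rfl fun j _ => ?_
    unfold fourierWeight
    rw [Finset.sum_mul, Finset.sum_mul]
    refine Finset.sum_congr rfl fun S hS => ?_
    rw [(Finset.mem_powersetCard.1 hS).2]
    ring
  rw [h1, h2, ← Finset.powerset_univ, Finset.sum_powerset]
  refine Finset.sum_subset (fun j hj => ?_) fun j hj hj' => ?_
  · rw [Finset.mem_Icc] at hj
    simp
    omega
  · obtain rfl : j = 0 := by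
      simp at hj hj'
      omega
    simp

theorem nu_succ_eq (f : (Fin r → ℤˣ) → ℝ) (δ : ℝ) (s : ℕ) : nu f δ (s + 1)
    = (∑ ι, (derivVariance f ι ((s + 1 : ℕ) * δ) - derivVariance f ι (s * δ))) / r := by
  rw [nu, derivative_mixture_eval, derivative_mixture_eval, Finset.sum_sub_distrib]
  push_cast
  rw [add_sub_cancel_right]

/-- A limiting variance can vanish only if `f` is constant. -/
theorem cubeFourierCoeff_eq_zero_of_nu_eq_zero (hδ : 0 < δ) (hlin : fourierWeight f 1 = 0) {s : ℕ}
    (h : nu f δ (s + 1) = 0) {S : Finset (Fin r)} {ι : Fin r} (hι : ι ∈ S) :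
    cubeFourierCoeff f S = 0 := by
  have hr : (r : ℝ) ≠ 0 := by
    have := ι.pos
    exact_mod_cast this.ne'
  have hlt : (s : ℝ) * δ < (s + 1 : ℕ) * δ := by
    push_cast
    nlinarith
  have hs0 : 0 ≤ (s : ℝ) * δ := by positivity
  rw [nu_succ_eq, div_eq_zero_iff, or_iff_left hr] at h
  have e : ∀ κ, derivVariance f κ ((s + 1 : ℕ) * δ) - derivVariance f κ (s * δ)
      = ∑ T : Finset (Fin r) with κ ∈ T, cubeFourierCoeff f T ^ 2 *
        (((s + 1 : ℕ) * δ) ^ (T.erase κ).card - (s * δ) ^ (T.erase κ).card) := fun κ => by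
    unfold derivVariance
    rw [← Finset.sum_sub_distrib]
    exact Finset.sum_congr rfl fun T _ => by ring
  have hnn : ∀ (κ : Fin r) (T : Finset (Fin r)), 0 ≤ cubeFourierCoeff f T ^ 2 *
      (((s + 1 : ℕ) * δ) ^ (T.erase κ).card - (s * δ) ^ (T.erase κ).card) := fun κ T =>
    mul_nonneg (sq_nonneg _) (sub_nonneg.2 (pow_le_pow_left₀ hs0 hlt.le _))
  simp only [e] at h
  have h1 := (Finset.sum_eq_zero_iff_of_nonneg fun κ _ => Finset.sum_nonneg fun T _ =>
    hnn κ T).1 h ι (Finset.mem_univ _)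
  have h2 := (Finset.sum_eq_zero_iff_of_nonneg fun T _ => hnn ι T).1 h1 S (by simp [hι])
  rcases eq_or_ne (S.erase ι).card 0 with h0 | h0
  · rw [Finset.card_eq_zero] at h0
    have hS : S = {ι} := by
      rw [← Finset.insert_erase hι, h0]
      rfl
    rw [hS, cubeFourierCoeff_singleton hlin]
  · rcases mul_eq_zero.1 h2 with h3 | h3
    · simpa using h3
    · exact absurd h3 (sub_pos.2 (pow_lt_pow_left₀ hlt hs0 h0)).ne'

end Variances

/-! ### State evolution for the second moments -/

theorem abs_prod_sub_pow_le {ι : Type*} (Q : Finset ι) {x : ι → ℝ} {b B η : ℝ} (hB : 1 ≤ B)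
    (hb : |b| ≤ B) (hx : ∀ i ∈ Q, |x i| ≤ B) (h : ∀ i ∈ Q, |x i - b| ≤ η) :
    |∏ i ∈ Q, x i - b ^ Q.card| ≤ Q.card * B ^ Q.card * η := by
  classical
  induction Q using Finset.induction_on with
  | empty => simp
  | insert i Q hi ih =>
    have ih' := ih (fun j hj => hx j (by simp [hj])) fun j hj => h j (by simp [hj])
    have hη : 0 ≤ η := (abs_nonneg _).trans (h i (by simp))
    rw [Finset.prod_insert hi, Finset.card_insert_of_notMem hi]
    have e : x i * ∏ j ∈ Q, x j - b ^ (Q.card + 1)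
        = x i * (∏ j ∈ Q, x j - b ^ Q.card) + (x i - b) * b ^ Q.card := by ring
    rw [e]
    refine (abs_add_le _ _).trans ?_
    rw [abs_mul, abs_mul, abs_pow]
    have h1 : |x i| * |∏ j ∈ Q, x j - b ^ Q.card| ≤ B * (Q.card * B ^ Q.card * η) :=
      mul_le_mul (hx i (by simp)) ih' (abs_nonneg _) (by linarith)
    have h2 : |x i - b| * |b| ^ Q.card ≤ η * B ^ (Q.card + 1) := by
      refine mul_le_mul (h i (by simp)) ?_ (by positivity) hη
      exact (pow_le_pow_left₀ (abs_nonneg _) hb _).trans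
        (pow_le_pow_right₀ hB (Nat.le_succ _))
    push_cast
    rw [pow_succ] at h2 ⊢
    nlinarith

namespace Setting

variable {r : ℕ} {f : (Fin r → ℤˣ) → ℝ} {δ K : ℝ} {L : ℕ} (I : Setting f δ K L)

theorem abs_integral_D_sq_sub_le {s : ℕ} (hs : s ≤ L) {B η : ℝ} (hB : 1 ≤ B) (hη : 0 ≤ η)
    (hsB : s * δ ≤ B) (hXB : ∀ q, ∫ z0, I.X s q z0 ^ 2 ∂I.law ≤ B)
    (hX : ∀ q, |∫ z0, I.X s q z0 ^ 2 ∂I.law - s * δ| ≤ η) (p : I.Slot) :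
    |∫ z0, I.D s p z0 ^ 2 ∂I.law - derivVariance f p.2 (s * δ)|
      ≤ (∑ S : Finset (Fin r), cubeFourierCoeff f S ^ 2 * (r * B ^ r)) * η := by
  have hδ := I.delta_pos.le
  rw [I.integral_D_sq hs, derivVariance, ← Finset.sum_sub_distrib]
  refine (Finset.abs_sum_le_sum_abs _ _).trans ?_
  rw [Finset.sum_mul]
  refine (Finset.sum_le_sum fun S _ => ?_).trans
    (Finset.sum_le_sum_of_subset_of_nonneg (Finset.filter_subset _ _) fun S _ _ => by positivity)
  rw [← mul_sub, abs_mul, abs_of_nonneg (sq_nonneg _), mul_assoc]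
  gcongr
  have hcard : (S.erase p.2).card ≤ r := (Finset.card_le_univ _).trans_eq (by simp)
  refine (abs_prod_sub_pow_le (S.erase p.2) hB ?_ (fun κ _ => ?_) fun κ _ => hX _).trans ?_
  · rwa [abs_of_nonneg (by positivity)]
  · rw [abs_of_nonneg (integral_nonneg fun _ => sq_nonneg _)]
    exact hXB _
  · gcongr

theorem sqrt_d_pos : 0 < √(I.d : ℝ) :=
  Real.sqrt_pos.2 (by exact_mod_cast (lt_of_lt_of_le two_pos I.two_le))

theorem one_div_d_sub_one_le : 1 / ((I.d : ℝ) - 1) ≤ 2 / √(I.d : ℝ) := by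
  have h1 := I.one_le_d_sub_one
  have h2 := I.sqrt_d_pos
  have h3 : √(I.d : ℝ) * √(I.d : ℝ) = I.d := Real.mul_self_sqrt (Nat.cast_nonneg _)
  have h4 : 1 ≤ √(I.d : ℝ) := Real.one_le_sqrt.2 (by linarith)
  rw [div_le_div_iff₀ (by linarith) h2]
  nlinarith

theorem one_div_sqrt_d_sub_one_le : 1 / √((I.d : ℝ) - 1) ≤ 2 / √(I.d : ℝ) := by
  have h1 := I.one_le_d_sub_one
  have h2 := I.sqrt_d_pos
  rw [div_le_div_iff₀ (Real.sqrt_pos.2 (by linarith)) h2, one_mul,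
    Real.sqrt_le_left (by positivity), mul_pow, Real.sq_sqrt (by linarith)]
  linarith

theorem average_slots {i : Fin I.n} (hi : (I.slots i).Nonempty) (s : ℕ) :
    1 / (I.d : ℝ) * ∑ p ∈ I.slots i,
      (derivVariance f p.2 ((s + 1 : ℕ) * δ) - derivVariance f p.2 (s * δ)) = nu f δ (s + 1) := by
  obtain ⟨p, -⟩ := hi
  have hr : (r : ℝ) ≠ 0 := by
    have := p.2.pos
    exact_mod_cast this.ne'
  have hd : (I.d : ℝ) ≠ 0 := by
    have := I.one_le_d_sub_one
    linarith
  have h := I.sum_slots_snd i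
    (fun ι => derivVariance f ι ((s + 1 : ℕ) * δ) - derivVariance f ι (s * δ))
  rw [nu_succ_eq, div_mul_eq_mul_div, one_mul, div_eq_div_iff hd hr, mul_comm, h, mul_comm]

/-- If the second moments of the messages are close to their limits, then the second moments of the
increments, averaged over the slots of a vertex, are close to `ν`. The message out of a slot misses
one of the `d` terms, which is negligible. -/
theorem abs_average_sub_nu_le {s : ℕ} {ε : ℝ} (h : ∀ p, |∫ z0, I.Y s p z0 ^ 2 ∂I.law -
      (derivVariance f p.2 ((s + 1 : ℕ) * δ) - derivVariance f p.2 (s * δ))| ≤ ε) (q : I.Slot) :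
    |1 / (I.d : ℝ) * ∑ p ∈ I.slots (I.vert q), ∫ z0, I.Y s p z0 ^ 2 ∂I.law - nu f δ (s + 1)| ≤ ε ∧
    |1 / ((I.d : ℝ) - 1) * ∑ p ∈ I.incoming q, ∫ z0, I.Y s p z0 ^ 2 ∂I.law - nu f δ (s + 1)|
      ≤ ε + (|nu f δ (s + 1)| + ∑ ι, |derivVariance f ι ((s + 1 : ℕ) * δ)
        - derivVariance f ι (s * δ)|) * (2 / √(I.d : ℝ)) := by
  set τ : Fin r → ℝ := fun ι => derivVariance f ι ((s + 1 : ℕ) * δ) - derivVariance f ι (s * δ)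
    with hτ
  set v : I.Slot → ℝ := fun p => ∫ z0, I.Y s p z0 ^ 2 ∂I.law with hv
  have hk := I.one_le_d_sub_one
  have hd : (I.d : ℝ) ≠ 0 := by linarith
  have hq : q ∈ I.slots (I.vert q) := I.mem_slots.2 rfl
  have hν : 1 / (I.d : ℝ) * ∑ p ∈ I.slots (I.vert q), τ p.2 = nu f δ (s + 1) :=
    I.average_slots ⟨q, hq⟩ s
  have havg : ∀ B : Finset I.Slot, |∑ p ∈ B, v p - ∑ p ∈ B, τ p.2| ≤ B.card * ε := fun B => by
    rw [← Finset.sum_sub_distrib, ← nsmul_eq_mul]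
    exact (Finset.abs_sum_le_sum_abs _ _).trans (Finset.sum_le_card_nsmul _ _ _ fun p _ => h p)
  constructor
  · rw [← hν, ← mul_sub, abs_mul, abs_of_nonneg (by positivity)]
    have h1 := havg (I.slots (I.vert q))
    rw [card_slots] at h1
    calc _ ≤ 1 / (I.d : ℝ) * (I.d * ε) := by gcongr
      _ = ε := by field_simp
  · have h1 := havg (I.incoming q)
    rw [cast_card_incoming] at h1
    have h2 : ∑ p ∈ I.incoming q, τ p.2 = I.d * nu f δ (s + 1) - τ q.2 := by
      rw [← hν, incoming_eq, ← Finset.add_sum_erase _ _ hq]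
      field_simp
      ring
    have e : 1 / ((I.d : ℝ) - 1) * ∑ p ∈ I.incoming q, v p - nu f δ (s + 1)
        = 1 / ((I.d : ℝ) - 1) * (∑ p ∈ I.incoming q, v p - ∑ p ∈ I.incoming q, τ p.2)
          + (nu f δ (s + 1) - τ q.2) * (1 / ((I.d : ℝ) - 1)) := by
      rw [h2]
      have : (I.d : ℝ) - 1 ≠ 0 := by linarith
      field_simp
      ring
    rw [e]
    refine (abs_add_le _ _).trans (add_le_add ?_ ?_)
    · rw [abs_mul, abs_of_nonneg (by positivity)]
      calc _ ≤ 1 / ((I.d : ℝ) - 1) * (((I.d : ℝ) - 1) * ε) := by gcongr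
        _ = ε := by
          have : (I.d : ℝ) - 1 ≠ 0 := by linarith
          field_simp
    · have hp : 0 ≤ 1 / ((I.d : ℝ) - 1) := by positivity
      rw [abs_mul, abs_of_nonneg hp]
      refine mul_le_mul ?_ I.one_div_d_sub_one_le hp (by positivity)
      refine (abs_sub _ _).trans (add_le_add le_rfl ?_)
      exact Finset.single_le_sum (f := fun ι => |τ ι|) (fun _ _ => abs_nonneg _)
        (Finset.mem_univ q.2)

/-- The statement that the second moments of the messages up to step `s` follow state evolution, with
errors of order `1 / √d`. -/
def SecondMomentsConverge (f : (Fin r → ℤˣ) → ℝ) (δ K : ℝ) (L s : ℕ) : Prop :=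
  ∃ C : ℝ, 0 ≤ C ∧ ∀ I : Setting f δ K L, ∀ t ≤ s, ∀ q,
    |∫ z0, I.X t q z0 ^ 2 ∂I.law - t * δ| ≤ C / √(I.d : ℝ)

/-- The statement that the averaged second moments of the increments at step `s` converge to `ν`,
with errors of order `1 / √d`. -/
def IncrementsConverge (f : (Fin r → ℤˣ) → ℝ) (δ K : ℝ) (L s : ℕ) : Prop :=
  ∃ C : ℝ, 0 ≤ C ∧ ∀ I : Setting f δ K L, ∀ q,
    |1 / (I.d : ℝ) * ∑ p ∈ I.slots (I.vert q), ∫ z0, I.Y s p z0 ^ 2 ∂I.law - nu f δ (s + 1)|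
      ≤ C / √(I.d : ℝ) ∧
    |1 / ((I.d : ℝ) - 1) * ∑ p ∈ I.incoming q, ∫ z0, I.Y s p z0 ^ 2 ∂I.law - nu f δ (s + 1)|
      ≤ C / √(I.d : ℝ)

theorem incrementsConverge_of_secondMomentsConverge {s : ℕ} (hs : s < L)
    (h : SecondMomentsConverge f δ K L (s + 1)) : IncrementsConverge f δ K L s := by
  obtain ⟨C, hC, h⟩ := h
  obtain ⟨C₄, hC₄, h₄⟩ := exists_integral_X_pow_four_le f δ K L le_rfl
  set B : ℝ := max C₄ (L * δ) with hB
  have hB1 : 1 ≤ B := hC₄.trans (le_max_left _ _)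
  set M : ℝ := ∑ S : Finset (Fin r), cubeFourierCoeff f S ^ 2 * (r * B ^ r) with hM
  have hM0 : 0 ≤ M := Finset.sum_nonneg fun S _ => by positivity
  set T : ℝ := |nu f δ (s + 1)| + ∑ ι, |derivVariance f ι ((s + 1 : ℕ) * δ)
    - derivVariance f ι (s * δ)| with hT
  have hT0 : 0 ≤ T := add_nonneg (abs_nonneg _) (Finset.sum_nonneg fun _ _ => abs_nonneg _)
  refine ⟨2 * (M * C) + 2 * T, by positivity, fun I q => ?_⟩
  have hsd := I.sqrt_d_pos
  have hD : ∀ t ≤ s + 1, ∀ p, |∫ z0, I.D t p z0 ^ 2 ∂I.law - derivVariance f p.2 (t * δ)|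
      ≤ M * (C / √(I.d : ℝ)) := fun t ht p => by
    refine I.abs_integral_D_sq_sub_le (by omega) hB1 (by positivity) ?_ (fun q => ?_)
      (fun q => h I t ht q) p
    · refine le_trans ?_ (le_max_right _ _)
      have := I.delta_pos
      have h1 : (t : ℝ) ≤ L := by exact_mod_cast (by omega : t ≤ L)
      gcongr
    · exact (integral_sq_le_of_integral_pow_four_le (I.hasAllMoments_X (by omega) q) hC₄
        (h₄ I t (by omega) q)).trans (le_max_left _ _)
  have hY : ∀ p, |∫ z0, I.Y s p z0 ^ 2 ∂I.law -
      (derivVariance f p.2 ((s + 1 : ℕ) * δ) - derivVariance f p.2 (s * δ))|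
      ≤ 2 * (M * (C / √(I.d : ℝ))) := fun p => by
    rw [I.integral_Y_sq hs]
    have h1 := abs_le.1 (hD (s + 1) le_rfl p)
    have h0 := abs_le.1 (hD s (by omega) p)
    exact abs_le.2 ⟨by linarith, by linarith⟩
  obtain ⟨h1, h2⟩ := I.abs_average_sub_nu_le hY q
  have e : (2 * (M * C) + 2 * T) / √(I.d : ℝ)
      = 2 * (M * (C / √(I.d : ℝ))) + T * (2 / √(I.d : ℝ)) := by ring
  rw [e]
  refine ⟨h1.trans ?_, h2⟩
  have : 0 ≤ T * (2 / √(I.d : ℝ)) := by positivity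
  linarith

theorem secondMomentsConverge (hν : ∀ s, nu f δ (s + 1) ≠ 0) {s : ℕ} (hs : s ≤ L) :
    SecondMomentsConverge f δ K L s := by
  induction s with
  | zero =>
    refine ⟨0, le_rfl, fun I t ht q => ?_⟩
    obtain rfl : t = 0 := by omega
    simp [X_zero]
  | succ s ih =>
    obtain ⟨C, hC, h⟩ := ih (by omega)
    -- it suffices to treat the last message
    suffices hlast : ∃ C' : ℝ, ∀ I : Setting f δ K L, ∀ q,
        |∫ z0, I.X (s + 1) q z0 ^ 2 ∂I.law - (s + 1 : ℕ) * δ| ≤ C' / √(I.d : ℝ) by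
      obtain ⟨C', h'⟩ := hlast
      refine ⟨max C C', le_max_of_le_left hC, fun I t ht q => ?_⟩
      have hsd := I.sqrt_d_pos
      rcases Nat.lt_or_ge s t with h1 | h1
      · obtain rfl : t = s + 1 := by omega
        refine (h' I q).trans ?_
        gcongr
        exact le_max_right _ _
      · refine (h I t h1 q).trans ?_
        gcongr
        exact le_max_left _ _
    cases s with
    | zero =>
      refine ⟨0, fun I q => ?_⟩
      simp only [zero_add, X_one, I.integral_coordinate_sq]
      simp
    | succ s =>
      have hs' : s < L := by omega
      obtain ⟨C₁, hC₁, h₁⟩ := incrementsConverge_of_secondMomentsConverge (K := K) hs' ⟨C, hC, h⟩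
      obtain ⟨C₄, hC₄, h₄⟩ := exists_integral_Y_pow_four_le f δ K L
      refine ⟨C + (2 * (K ^ 2 * C₄) + K ^ 2 * C₁), fun I q => ?_⟩
      have hsd := I.sqrt_d_pos
      have hAm := (I.hasAllMoments_A hs' q).pow 2
      have hA0 : 0 ≤ ∫ z0, I.A s q z0 ^ 2 ∂I.law := integral_nonneg fun _ => sq_nonneg _
      have hAK : ∫ z0, I.A s q z0 ^ 2 ∂I.law ≤ K ^ 2 := by
        refine (integral_mono hAm.integrable (integrable_const (K ^ 2)) fun z0 => ?_).trans_eq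
          (by simp)
        change I.A s q z0 ^ 2 ≤ K ^ 2
        rw [← sq_abs]
        exact pow_le_pow_left₀ (abs_nonneg _) (I.abs_A_le hs' q z0) 2
      have hAν : (∫ z0, I.A s q z0 ^ 2 ∂I.law) * nu f δ (s + 1) = δ := by
        rw [I.integral_A_sq hs', div_mul_cancel₀ _ (hν s)]
      set m : ℝ := 1 / ((I.d : ℝ) - 1) * ∑ p ∈ I.incoming q, ∫ z0, I.Y s p z0 ^ 2 ∂I.law with hm
      have hdec : |∫ z0, (I.A s q z0 * I.U s q z0) ^ 2 ∂I.law
          - (∫ z0, I.A s q z0 ^ 2 ∂I.law) * m| ≤ 2 * (K ^ 2 * C₄) / √(I.d : ℝ) := by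
        refine (I.abs_integral_A_mul_sub_le hs' hC₄ (h₄ I s hs') q).trans ?_
        have := I.one_div_sqrt_d_sub_one_le
        calc K ^ 2 * (C₄ / √((I.d : ℝ) - 1)) = K ^ 2 * C₄ * (1 / √((I.d : ℝ) - 1)) := by ring
          _ ≤ K ^ 2 * C₄ * (2 / √(I.d : ℝ)) := by gcongr
          _ = _ := by ring
      have hmν : |(∫ z0, I.A s q z0 ^ 2 ∂I.law) * m - δ| ≤ K ^ 2 * C₁ / √(I.d : ℝ) := by
        have e : (∫ z0, I.A s q z0 ^ 2 ∂I.law) * m - δ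
            = (∫ z0, I.A s q z0 ^ 2 ∂I.law) * (m - nu f δ (s + 1)) := by rw [mul_sub, hAν]
        rw [e, abs_mul, abs_of_nonneg hA0, mul_div_assoc]
        exact mul_le_mul hAK (h₁ I q).2 (abs_nonneg _) (sq_nonneg _)
      have hX := h I (s + 1) le_rfl q
      have hrec := I.integral_X_sq_succ (s := s) (by omega) q
      rw [show s + 1 + 1 = s + 2 from rfl, hrec, add_div, add_div]
      push_cast at hX ⊢
      rw [abs_le] at hdec hmν hX ⊢
      constructor <;> linarith

/-- If a limiting variance vanishes, then `f` is constant and all increments vanish. -/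
theorem incrementsConverge {s : ℕ} (hs : s < L) : IncrementsConverge f δ K L s := by
  by_cases hν : ∀ s, nu f δ (s + 1) ≠ 0
  · exact incrementsConverge_of_secondMomentsConverge hs (secondMomentsConverge hν hs)
  · push Not at hν
    obtain ⟨t, ht⟩ := hν
    refine ⟨0, le_rfl, fun I q => ?_⟩
    have hf : ∀ (S : Finset (Fin r)) ι, ι ∈ S → cubeFourierCoeff f S = 0 := fun S ι hι =>
      cubeFourierCoeff_eq_zero_of_nu_eq_zero I.delta_pos I.no_linear ht hι
    have hν0 : nu f δ (s + 1) = 0 := by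
      rw [nu_succ_eq]
      have : ∀ ι x, derivVariance f ι x = 0 := fun ι x =>
        Finset.sum_eq_zero fun S hS => by simp [hf S ι (Finset.mem_filter.1 hS).2]
      simp [this]
    have hY : ∀ p z0, I.Y s p z0 = 0 := fun p z0 => by
      have hD : ∀ t, I.D t p z0 = 0 := fun t => by
        rw [D_eq_sum]
        exact Finset.sum_eq_zero fun S hS => by simp [hf S p.2 (Finset.mem_filter.1 hS).2]
      rw [Y, hD, hD, sub_zero]
    simp [hY, hν0]

end Setting

/-! ### Convergence of the laws of the increments -/

theorem abs_exp_neg_sub_exp_neg_le {a b : ℝ} (ha : 0 ≤ a) (hb : 0 ≤ b) :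
    |Real.exp (-a) - Real.exp (-b)| ≤ |a - b| := by
  wlog h : a ≤ b generalizing a b
  · rw [abs_sub_comm, abs_sub_comm a b]
    exact this hb ha (not_le.1 h).le
  have h1 : Real.exp (-b) ≤ Real.exp (-a) := Real.exp_le_exp.2 (by linarith)
  rw [abs_of_nonneg (by linarith), abs_of_nonpos (by linarith)]
  have h2 : Real.exp (-b) = Real.exp (-a) * Real.exp (-(b - a)) := by
    rw [← Real.exp_add]
    ring_nf
  have h3 : 1 - (b - a) ≤ Real.exp (-(b - a)) := by
    have := Real.add_one_le_exp (-(b - a))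
    linarith
  have h4 : Real.exp (-a) ≤ 1 := Real.exp_le_one_iff.2 (by linarith)
  have h5 : Real.exp (-a) * (1 - Real.exp (-(b - a))) ≤ 1 * (b - a) :=
    mul_le_mul h4 (by linarith) (by
      rw [sub_nonneg, Real.exp_le_one_iff]
      linarith) zero_le_one
  rw [h2]
  linarith

section VectorLaw

variable {Ω : Type*} [MeasurableSpace Ω] {P : Measure Ω} {ℓ : ℕ} {u : Fin ℓ → Ω → ℝ}

theorem measurable_toLp_pi (hu : ∀ s, HasAllMoments (u s) P) :
    Measurable fun ω => (WithLp.toLp 2 fun s => u s ω : EuclideanSpace ℝ (Fin ℓ)) :=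
  (MeasurableEquiv.toLp 2 (Fin ℓ → ℝ)).measurable.comp
    (measurable_pi_lambda _ fun s => (hu s).1)

theorem norm_toLp_pow_four (x : Fin ℓ → ℝ) :
    ‖(WithLp.toLp 2 x : EuclideanSpace ℝ (Fin ℓ))‖ ^ 4 = (∑ s, x s ^ 2) ^ 2 := by
  rw [show (4 : ℕ) = 2 * 2 from rfl, pow_mul, EuclideanSpace.real_norm_sq_eq]

variable [IsProbabilityMeasure P]

theorem integrable_norm_pow_four_map (hu : ∀ s, HasAllMoments (u s) P) :
    Integrable (fun x => ‖x‖ ^ 4) (P.map fun ω =>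
      (WithLp.toLp 2 fun s => u s ω : EuclideanSpace ℝ (Fin ℓ))) := by
  rw [integrable_map_measure (by fun_prop) (measurable_toLp_pi hu).aemeasurable]
  simp only [Function.comp_def, norm_toLp_pow_four]
  exact ((HasAllMoments.finset_sum fun s _ => (hu s).pow 2).pow 2).integrable

theorem integral_norm_pow_four_map_le (hu : ∀ s, HasAllMoments (u s) P) {C : ℝ}
    (hC : ∀ s, ∫ ω, u s ω ^ 4 ∂P ≤ C) :
    ∫ x, ‖x‖ ^ 4 ∂(P.map fun ω => (WithLp.toLp 2 fun s => u s ω : EuclideanSpace ℝ (Fin ℓ)))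
      ≤ ℓ * (ℓ * C) := by
  rw [integral_map (measurable_toLp_pi hu).aemeasurable (by fun_prop)]
  simp only [norm_toLp_pow_four]
  have hpt : ∀ ω, (∑ s, u s ω ^ 2) ^ 2 ≤ ℓ * ∑ s, u s ω ^ 4 := fun ω => by
    have := sq_sum_le_card_mul_sum_sq (s := Finset.univ) (f := fun s => u s ω ^ 2)
    simpa [← pow_mul] using this
  refine (integral_mono ((HasAllMoments.finset_sum fun s _ => (hu s).pow 2).pow 2).integrable
    ((HasAllMoments.finset_sum fun s _ => (hu s).pow 4).const_mul _).integrable hpt).trans ?_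
  rw [integral_const_mul, integral_finsetSum _ fun s _ => ((hu s).pow 4).integrable]
  gcongr
  refine (Finset.sum_le_card_nsmul _ _ _ fun s _ => hC s).trans_eq ?_
  simp

end VectorLaw

section LimitLaw

variable {r : ℕ} (f : (Fin r → ℤˣ) → ℝ) (δ : ℝ) (ℓ : ℕ)

instance : IsProbabilityMeasure (limitLaw f δ ℓ) := by
  unfold limitLaw
  infer_instance

theorem charFun_map_limitLaw {δ : ℝ} (hδ : 0 ≤ δ) (t : EuclideanSpace ℝ (Fin ℓ)) :
    charFun ((limitLaw f δ ℓ).map (WithLp.toLp 2)) t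
      = (Real.exp (-((∑ s, t s ^ 2 * nu f δ (s + 1)) / 2)) : ℝ) := by
  rw [limitLaw, charFun_pi]
  simp only [charFun_gaussianReal]
  rw [← Complex.exp_sum, Complex.ofReal_exp]
  congr 1
  rw [Finset.sum_div, ← Finset.sum_neg_distrib]
  push_cast
  refine Finset.sum_congr rfl fun s _ => ?_
  rw [Real.coe_toNNReal _ (nu_nonneg f hδ (by omega))]
  ring

theorem integrable_norm_pow_four_map_limitLaw :
    Integrable (fun x => ‖x‖ ^ 4) ((limitLaw f δ ℓ).map
      (WithLp.toLp 2 : (Fin ℓ → ℝ) → EuclideanSpace ℝ (Fin ℓ))) :=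
  integrable_norm_pow_four_map (P := limitLaw f δ ℓ) (u := fun s x => x s) fun s =>
    ⟨measurable_pi_apply s, fun p hp => (memLp_id_gaussianReal' p hp).comp_measurePreserving
      (measurePreserving_eval (fun s : Fin ℓ => gaussianReal 0 (nu f δ (s + 1)).toNNReal) s)⟩

end LimitLaw

namespace Setting

variable {r : ℕ} {f : (Fin r → ℤˣ) → ℝ} {δ K : ℝ} {L : ℕ} (I : Setting f δ K L)

/-- The normalized sum of the increments over a set of slots of a vertex. -/
noncomputable def normalizedSum (B : Finset I.Slot) (s : ℕ) (z0 : Fin I.n → ℝ) : ℝ :=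
  1 / √(B.card : ℝ) * ∑ p ∈ B, I.Y s p z0

theorem hasAllMoments_normalizedSum (B : Finset I.Slot) {s : ℕ} (hs : s < L) :
    HasAllMoments (I.normalizedSum B s) I.law :=
  (HasAllMoments.finset_sum fun p _ => I.hasAllMoments_Y hs p).const_mul _

/-- The law of the vector of normalized sums of the increments. -/
noncomputable def sumLaw (B : Finset I.Slot) (ℓ : ℕ) : Measure (EuclideanSpace ℝ (Fin ℓ)) :=
  I.law.map fun z0 => WithLp.toLp 2 fun s : Fin ℓ => I.normalizedSum B s z0

/-- Multivariate central limit theorem: a linear combination of the increments is a sum of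
independent centered variables, whose variance is determined by the orthogonality of the increments
at different steps. -/
theorem norm_charFun_sumLaw_sub_le {ℓ : ℕ} (hℓ : ℓ ≤ L) {C : ℝ}
    (h4 : ∀ s < L, ∀ p, ∫ z0, I.Y s p z0 ^ 4 ∂I.law ≤ C) {i : Fin I.n} {B : Finset I.Slot}
    (hB : B ⊆ I.slots i) (hne : B.Nonempty) {η : ℝ}
    (hη : ∀ s < L, |1 / (B.card : ℝ) * ∑ p ∈ B, ∫ z0, I.Y s p z0 ^ 2 ∂I.law - nu f δ (s + 1)| ≤ η)
    (t : EuclideanSpace ℝ (Fin ℓ)) :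
    ‖charFun (I.sumLaw B ℓ) t - charFun ((limitLaw f δ ℓ).map (WithLp.toLp 2)) t‖
      ≤ 9 * (max 1 ((ℓ : ℝ) ^ 3 * ∑ s, t s ^ 4 * C)) ^ 2 * (1 / √(B.card : ℝ))
        + (∑ s, t s ^ 2) * η := by
  set c : ℝ := 1 / √(B.card : ℝ) with hc
  set M : ℝ := max 1 ((ℓ : ℝ) ^ 3 * ∑ s, t s ^ 4 * C) with hM
  have hcard : (1 : ℝ) ≤ B.card := by exact_mod_cast hne.card_pos
  have hsq : 1 ≤ √(B.card : ℝ) := Real.one_le_sqrt.2 hcard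
  have hc0 : 0 ≤ c := by positivity
  have hc1 : c ≤ 1 := by
    rw [hc, div_le_one (by linarith)]
    exact hsq
  have hc2 : c ^ 2 = 1 / B.card := by
    rw [hc, div_pow, one_pow, Real.sq_sqrt (by linarith)]
  have hYm : ∀ (s : Fin ℓ) p, HasAllMoments (I.Y s p) I.law := fun s p =>
    I.hasAllMoments_Y (s.2.trans_le hℓ) p
  set X : I.Slot → (Fin I.n → ℝ) → ℝ := fun p z0 => ∑ s : Fin ℓ, t s * I.Y s p z0 with hX
  have hXm : ∀ p, HasAllMoments (X p) I.law := fun p =>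
    HasAllMoments.finset_sum fun s _ => (hYm s p).const_mul _
  have hX0 : ∀ p, ∫ z0, X p z0 ∂I.law = 0 := fun p => by
    simp only [hX]
    rw [integral_finsetSum _ fun s _ => ((hYm s p).const_mul _).integrable]
    refine Finset.sum_eq_zero fun s _ => ?_
    rw [integral_const_mul, I.integral_Y (s.2.trans_le hℓ) p, mul_zero]
  have hXd : ∀ p, DependsOn (X p) (I.branch L p) := fun p =>
    dependsOn_finset_sum fun s _ => dependsOn_map
      ((I.dependsOn_Y (s.2.trans_le hℓ) p).mono (I.branch_mono (by omega) p)) (t s * ·)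
  have hX4 : ∀ p, ∫ z0, X p z0 ^ 4 ∂I.law ≤ M := fun p => by
    refine le_trans ?_ (le_max_right _ _)
    have hpt : ∀ z0, X p z0 ^ 4 ≤ (ℓ : ℝ) ^ 3 * ∑ s : Fin ℓ, t s ^ 4 * I.Y s p z0 ^ 4 :=
      fun z0 => by
        have := pow_four_sum_le Finset.univ fun s : Fin ℓ => t s * I.Y s p z0
        simpa [mul_pow] using this
    have hm : ∀ s : Fin ℓ, HasAllMoments (fun z0 => t s ^ 4 * I.Y s p z0 ^ 4) I.law := fun s =>
      ((hYm s p).pow 4).const_mul _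
    refine (integral_mono ((hXm p).pow 4).integrable
      ((HasAllMoments.finset_sum fun s _ => hm s).const_mul _).integrable hpt).trans ?_
    rw [integral_const_mul, integral_finsetSum _ fun s _ => (hm s).integrable]
    simp only [integral_const_mul]
    gcongr with s
    exact h4 s (s.2.trans_le hℓ) p
  have hX2 : ∀ p, ∫ z0, X p z0 ^ 2 ∂I.law = ∑ s : Fin ℓ, t s ^ 2 * ∫ z0, I.Y s p z0 ^ 2 ∂I.law :=
    fun p => by
      have hm : ∀ s s' : Fin ℓ, HasAllMoments
          (fun z0 => t s * I.Y s p z0 * (t s' * I.Y s' p z0)) I.law := fun s s' =>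
        ((hYm s p).const_mul _).mul ((hYm s' p).const_mul _)
      simp only [hX, sq, Finset.sum_mul_sum]
      rw [integral_finsetSum _ fun s _ => integrable_finsetSum _ fun s' _ => (hm s s').integrable]
      refine Finset.sum_congr rfl fun s _ => ?_
      rw [integral_finsetSum _ fun s' _ => (hm s s').integrable]
      have e : ∀ (s' : Fin ℓ) z0, t s * I.Y s p z0 * (t s' * I.Y s' p z0)
          = t s * t s' * (I.Y s p z0 * I.Y s' p z0) := fun s' z0 => by ring
      simp only [e, integral_const_mul]
      refine Finset.sum_eq_single_of_mem s (Finset.mem_univ s) fun s' _ hss => ?_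
      rcases Nat.lt_or_gt_of_ne (Fin.val_ne_of_ne hss) with h | h
      · rw [I.integral_Y_mul_Y (s.2.trans_le hℓ) h p, mul_zero]
      · have := I.integral_Y_mul_Y (s'.2.trans_le hℓ) h p
        simp only [mul_comm (I.Y s' p _)] at this
        rw [this, mul_zero]
  have hchar : charFun (I.sumLaw B ℓ) t
      = ∫ z0, Complex.exp ((c * ∑ p ∈ B, X p z0 : ℝ) * Complex.I) ∂I.law := by
    rw [sumLaw, charFun_apply, integral_map
      (measurable_toLp_pi fun s : Fin ℓ => I.hasAllMoments_normalizedSum B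
        (s.2.trans_le hℓ)).aemeasurable (by fun_prop)]
    refine integral_congr_ae (Filter.Eventually.of_forall fun z0 => ?_)
    have e : inner ℝ (WithLp.toLp 2 fun s : Fin ℓ => I.normalizedSum B s z0) t
        = c * ∑ p ∈ B, X p z0 := by
      rw [PiLp.inner_apply]
      simp only [hX, normalizedSum, ← hc]
      rw [Finset.sum_comm, Finset.mul_sum]
      refine Finset.sum_congr rfl fun s _ => ?_
      rw [← Finset.mul_sum]
      simp
      ring
    simp only [e]
  have hclt := norm_integral_exp_sum_sub_exp_le
    (μ := fun _ : Fin I.n => gaussianReal 0 δ.toNNReal)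
    (I.pairwiseDisjoint_branch_of_subset le_rfl hB) (fun p _ => hXd p) (fun p _ => hXm p)
    (fun p _ => hX0 p) (le_max_left _ _ : 1 ≤ M) (fun p _ => hX4 p)
    (by rwa [abs_of_nonneg hc0] : |c| ≤ 1)
  change ‖∫ z0, Complex.exp ((c * ∑ p ∈ B, X p z0 : ℝ) * Complex.I) ∂I.law
    - (Real.exp (-(c ^ 2 * ∑ p ∈ B, ∫ z0, X p z0 ^ 2 ∂I.law) / 2) : ℝ)‖ ≤ _ at hclt
  rw [← hchar, abs_of_nonneg hc0] at hclt
  set v : ℝ := ∑ s : Fin ℓ, t s ^ 2 * nu f δ (s + 1) with hv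
  set w : ℝ := c ^ 2 * ∑ p ∈ B, ∫ z0, X p z0 ^ 2 ∂I.law with hw
  have hw0 : 0 ≤ w := mul_nonneg (sq_nonneg _) (Finset.sum_nonneg fun p _ =>
    integral_nonneg fun _ => sq_nonneg _)
  have hv0 : 0 ≤ v := Finset.sum_nonneg fun s _ => mul_nonneg (sq_nonneg _)
    (nu_nonneg f I.delta_pos.le (by omega))
  have hwv : |w - v| ≤ (∑ s, t s ^ 2) * η := by
    have e : w = ∑ s : Fin ℓ, t s ^ 2 *
        (1 / (B.card : ℝ) * ∑ p ∈ B, ∫ z0, I.Y s p z0 ^ 2 ∂I.law) := by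
      rw [hw, hc2]
      simp only [hX2]
      rw [Finset.sum_comm, Finset.mul_sum]
      refine Finset.sum_congr rfl fun s _ => ?_
      rw [← Finset.mul_sum]
      ring
    rw [e, hv, ← Finset.sum_sub_distrib, Finset.sum_mul]
    refine (Finset.abs_sum_le_sum_abs _ _).trans (Finset.sum_le_sum fun s _ => ?_)
    rw [← mul_sub, abs_mul, abs_of_nonneg (sq_nonneg (t s))]
    exact mul_le_mul_of_nonneg_left (hη s (s.2.trans_le hℓ)) (sq_nonneg _)
  have hfirst : (B.card : ℝ) * (9 * M ^ 2 * c ^ 3) = 9 * M ^ 2 * c := by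
    rw [pow_succ c 2, hc2]
    field_simp
  rw [hfirst] at hclt
  rw [charFun_map_limitLaw f ℓ I.delta_pos.le t]
  refine (norm_sub_le_norm_sub_add_norm_sub _ ((Real.exp (-w / 2) : ℝ) : ℂ) _).trans
    (add_le_add hclt ?_)
  rw [← Complex.ofReal_sub, Complex.norm_real, Real.norm_eq_abs, neg_div]
  refine (abs_exp_neg_sub_exp_neg_le (by positivity) (by positivity)).trans ?_
  rw [← sub_div, abs_div, abs_of_pos (two_pos : (0 : ℝ) < 2)]
  have := abs_nonneg (w - v)
  linarith

/-- The family of laws that appear in state evolution, for the messages out of a slot and for the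
nodes. -/
def lawFamily (f : (Fin r → ℤˣ) → ℝ) (δ K : ℝ) (L ℓ d : ℕ) :
    Set (Measure (EuclideanSpace ℝ (Fin ℓ))) :=
  {ν | ∃ I : Setting f δ K L, I.d = d ∧ ∃ q, ν = I.sumLaw (I.incoming q) ℓ ∨
    ν = I.sumLaw (I.slots (I.vert q)) ℓ}

theorem exists_forall_mem_lawFamily (f : (Fin r → ℤˣ) → ℝ) (δ K : ℝ) (L ℓ : ℕ) :
    ∃ C : ℝ, 0 ≤ C ∧ ∀ d, ∀ ν ∈ lawFamily f δ K L ℓ d, ∃ I : Setting f δ K L, I.d = d ∧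
      ∃ i, ∃ B ⊆ I.slots i, B.Nonempty ∧ ν = I.sumLaw B ℓ ∧ (d : ℝ) ≤ 2 * B.card ∧
        ∀ s < L, |1 / (B.card : ℝ) * ∑ p ∈ B, ∫ z0, I.Y s p z0 ^ 2 ∂I.law - nu f δ (s + 1)|
          ≤ C / √(d : ℝ) := by
  have hex : ∃ C : ℝ, 0 ≤ C ∧ ∀ I : Setting f δ K L, ∀ s < L, ∀ q,
      |1 / (I.d : ℝ) * ∑ p ∈ I.slots (I.vert q), ∫ z0, I.Y s p z0 ^ 2 ∂I.law - nu f δ (s + 1)|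
        ≤ C / √(I.d : ℝ) ∧
      |1 / ((I.d : ℝ) - 1) * ∑ p ∈ I.incoming q, ∫ z0, I.Y s p z0 ^ 2 ∂I.law - nu f δ (s + 1)|
        ≤ C / √(I.d : ℝ) := by
    choose C hC h using fun s : Fin L => incrementsConverge (f := f) (δ := δ) (K := K) s.2
    refine ⟨∑ s, C s, Finset.sum_nonneg fun s _ => hC s, fun I s hs q => ?_⟩
    have hle : C ⟨s, hs⟩ / √(I.d : ℝ) ≤ (∑ s, C s) / √(I.d : ℝ) := by
      have := Finset.single_le_sum (fun s _ => hC s) (Finset.mem_univ (⟨s, hs⟩ : Fin L))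
      gcongr
    exact ⟨(h ⟨s, hs⟩ I q).1.trans hle, (h ⟨s, hs⟩ I q).2.trans hle⟩
  obtain ⟨C, hC, h⟩ := hex
  refine ⟨C, hC, ?_⟩
  rintro d ν ⟨I, rfl, q, hν⟩
  have h1 := I.one_le_d_sub_one
  rcases hν with rfl | rfl
  · refine ⟨I, rfl, I.vert q, I.incoming q, I.incoming_subset_slots q, ?_, rfl, ?_, ?_⟩
    · rw [← Finset.card_pos, card_incoming]
      have := I.two_le
      omega
    · rw [cast_card_incoming]
      linarith
    · intro s hs
      rw [cast_card_incoming]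
      exact (h I s hs q).2
  · refine ⟨I, rfl, I.vert q, _, subset_rfl, ⟨q, I.mem_slots.2 rfl⟩, rfl, ?_, ?_⟩
    · rw [card_slots]
      linarith
    · intro s hs
      rw [card_slots]
      exact (h I s hs q).1

/-- State evolution for the whole family of laws. -/
theorem exists_forall_lawFamily_abs_integral_sub_le (f : (Fin r → ℤˣ) → ℝ) (δ K : ℝ) (L : ℕ)
    {ℓ : ℕ} (hℓ : ℓ ≤ L) {ψ : EuclideanSpace ℝ (Fin ℓ) → ℝ} (hψ : PseudoLipschitz ψ) {ε : ℝ}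
    (hε : 0 < ε) : ∃ d₀ : ℕ, ∀ d, d₀ ≤ d → ∀ ν ∈ lawFamily f δ K L ℓ d,
      Integrable ψ ν ∧
      |∫ x, ψ x ∂ν - ∫ x, ψ x ∂((limitLaw f δ ℓ).map (WithLp.toLp 2))| ≤ ε := by
  obtain ⟨C₂, hC₂, hfam⟩ := exists_forall_mem_lawFamily f δ K L ℓ
  obtain ⟨C₄, hC₄, h₄⟩ := exists_integral_Y_pow_four_le f δ K L
  have htoLp : Measurable (WithLp.toLp 2 : (Fin ℓ → ℝ) → EuclideanSpace ℝ (Fin ℓ)) :=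
    (MeasurableEquiv.toLp 2 (Fin ℓ → ℝ)).measurable
  have hγp : IsProbabilityMeasure ((limitLaw f δ ℓ).map
      (WithLp.toLp 2 : (Fin ℓ → ℝ) → EuclideanSpace ℝ (Fin ℓ))) :=
    Measure.isProbabilityMeasure_map htoLp.aemeasurable
  have hprob : ∀ d, ∀ ν ∈ lawFamily f δ K L ℓ d, IsProbabilityMeasure ν := by
    intro d ν hν
    obtain ⟨I, -, i, B, -, -, rfl, -⟩ := hfam d ν hν
    exact Measure.isProbabilityMeasure_map (measurable_toLp_pi fun s : Fin ℓ =>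
      I.hasAllMoments_normalizedSum B (s.2.trans_le hℓ)).aemeasurable
  have hmom : ∀ d, ∀ ν ∈ lawFamily f δ K L ℓ d, Integrable (fun x => ‖x‖ ^ 4) ν ∧
      ∫ x, ‖x‖ ^ 4 ∂ν ≤ ℓ * (ℓ * (3 * C₄ ^ 2)) := by
    intro d ν hν
    obtain ⟨I, -, i, B, hB, -, rfl, -⟩ := hfam d ν hν
    have hu := fun s : Fin ℓ => I.hasAllMoments_normalizedSum B (s.2.trans_le hℓ)
    exact ⟨integrable_norm_pow_four_map hu, integral_norm_pow_four_map_le hu fun s =>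
      I.integral_sum_Y_pow_four_le (s.2.trans_le hℓ) hC₄ hB (h₄ I s (s.2.trans_le hℓ))⟩
  have hchar : ∀ t : EuclideanSpace ℝ (Fin ℓ), ∀ ε : ℝ, 0 < ε → ∃ d₀ : ℕ, ∀ d, d₀ ≤ d →
      ∀ ν ∈ lawFamily f δ K L ℓ d,
        ‖charFun ν t - charFun ((limitLaw f δ ℓ).map (WithLp.toLp 2)) t‖ ≤ ε := by
    intro t ε hε
    set M : ℝ := 9 * (max 1 ((ℓ : ℝ) ^ 3 * ∑ s, t s ^ 4 * C₄)) ^ 2 with hM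
    set T : ℝ := 2 * M + (∑ s, t s ^ 2) * C₂ with hT
    have hM0 : 0 ≤ M := by positivity
    have hlim : Filter.Tendsto (fun d : ℕ => T / √(d : ℝ)) Filter.atTop (nhds 0) :=
      Filter.Tendsto.const_div_atTop (Real.tendsto_sqrt_atTop.comp tendsto_natCast_atTop_atTop) T
    obtain ⟨d₀, hd₀⟩ := Filter.eventually_atTop.1 (hlim.eventually_le_const hε)
    refine ⟨d₀, fun d hd ν hν => ?_⟩
    obtain ⟨I, hId, i, B, hB, hne, rfl, hcard, hη⟩ := hfam d ν hν
    refine ((I.norm_charFun_sumLaw_sub_le hℓ (h₄ I) hB hne hη t).trans ?_).trans (hd₀ d hd)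
    have hd0 : 0 < √(d : ℝ) := hId ▸ I.sqrt_d_pos
    have hB0 : 0 < √(B.card : ℝ) := Real.sqrt_pos.2 (by exact_mod_cast hne.card_pos)
    have h1 : 1 / √(B.card : ℝ) ≤ 2 / √(d : ℝ) := by
      rw [div_le_div_iff₀ hB0 hd0, one_mul, Real.sqrt_le_left (by positivity), mul_pow,
        Real.sq_sqrt (Nat.cast_nonneg _)]
      have : (0 : ℝ) ≤ B.card := Nat.cast_nonneg _
      linarith
    calc _ ≤ M * (2 / √(d : ℝ)) + (∑ s, t s ^ 2) * (C₂ / √(d : ℝ)) := by gcongr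
      _ = T / √(d : ℝ) := by
        rw [hT]
        ring
  obtain ⟨d₀, h⟩ := exists_forall_abs_integral_sub_le hψ
    (integrable_norm_pow_four_map_limitLaw f δ ℓ) (lawFamily f δ K L ℓ) hprob hmom hchar hε
  obtain ⟨B, -, hB⟩ := hψ.exists_abs_le
  refine ⟨d₀, fun d hd ν hν => ⟨?_, h d hd ν hν⟩⟩
  have := hprob d ν hν
  exact integrable_of_abs_le hψ.continuous hB (hmom d ν hν).1

/-- A test function of the normalized sums, expressed through their law. -/
theorem integrable_and_integral_normalizedSum (B : Finset I.Slot) {ℓ : ℕ} (hℓ : ℓ ≤ L)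
    {ψ : EuclideanSpace ℝ (Fin ℓ) → ℝ} (hc : Continuous ψ) (h : Integrable ψ (I.sumLaw B ℓ)) :
    Integrable (fun z0 => ψ (WithLp.toLp 2 fun s : Fin ℓ => I.normalizedSum B s z0)) I.law ∧
      ∫ z0, ψ (WithLp.toLp 2 fun s : Fin ℓ => I.normalizedSum B s z0) ∂I.law
        = ∫ x, ψ x ∂(I.sumLaw B ℓ) := by
  have hm := (measurable_toLp_pi fun s : Fin ℓ =>
    I.hasAllMoments_normalizedSum B (s.2.trans_le hℓ)).aemeasurable (μ := I.law)
  refine ⟨?_, (integral_map hm hc.aestronglyMeasurable).symm⟩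
  exact (integrable_map_measure hc.aestronglyMeasurable hm).1 h

end Setting
end CSP

theorem theorem4p3 {r : ℕ} (f : (Fin r → ℤˣ) → ℝ) (hf : ∀ x, f x = 0 ∨ f x = 1)
    (hlin : CSP.fourierWeight f 1 = 0) (δ : ℝ) (hδ : 0 < δ) (K : ℝ) (hK : 0 < K)
    (L : ℕ) (hL : L = ⌊1 / δ⌋₊) (ℓ : ℕ) (hℓ : 1 ≤ ℓ) (hℓL : ℓ ≤ L)
    (ψ : EuclideanSpace ℝ (Fin ℓ) → ℝ) (hψ : CSP.PseudoLipschitz ψ) :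
    Integrable (fun x : Fin ℓ → ℝ => ψ (WithLp.toLp 2 x)) (CSP.limitLaw f δ ℓ) ∧
    ∀ ε : ℝ, 0 < ε → ∃ d₀ : ℕ, ∀ d : ℕ, d₀ ≤ d →
      ∀ (n m : ℕ) (G : CSP.DirectedHypergraph r (Fin n) (Fin m)),
        G.IsIndexRegular d → G.GirthAtLeast (2 * L + 2) →
      ∀ (F : (k : ℕ) → Fin n → Fin m → (Fin k → ℝ) → ℝ)
        (FN : (k : ℕ) → Fin n → (Fin k → ℝ) → ℝ),
        (∀ k < L, ∀ i a, Measurable (F k i a) ∧ ∀ x, |F k i a x| ≤ K) →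
        (∀ k < L, ∀ i, Measurable (FN k i) ∧ ∀ x, |FN k i x| ≤ K) →
        CSP.SecondMomentNormalized G f d F FN δ L →
      ∀ (i : Fin n), ∀ a ∈ G.incident i,
        (Integrable (fun z0 => ψ (WithLp.toLp 2 fun s : Fin ℓ =>
            CSP.msgU G f d F z0 (s + 1) i a)) (CSP.initLaw (Fin n) δ) ∧
          |∫ z0, ψ (WithLp.toLp 2 fun s : Fin ℓ =>
              CSP.msgU G f d F z0 (s + 1) i a) ∂(CSP.initLaw (Fin n) δ)
            - ∫ x, ψ (WithLp.toLp 2 x) ∂(CSP.limitLaw f δ ℓ)| ≤ ε) ∧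
        (Integrable (fun z0 => ψ (WithLp.toLp 2 fun s : Fin ℓ =>
            CSP.nodeU G f d F z0 (s + 1) i)) (CSP.initLaw (Fin n) δ) ∧
          |∫ z0, ψ (WithLp.toLp 2 fun s : Fin ℓ =>
              CSP.nodeU G f d F z0 (s + 1) i) ∂(CSP.initLaw (Fin n) δ)
            - ∫ x, ψ (WithLp.toLp 2 x) ∂(CSP.limitLaw f δ ℓ)| ≤ ε) := by
  have hc := hψ.continuous
  have htoLp : Measurable (WithLp.toLp 2 : (Fin ℓ → ℝ) → EuclideanSpace ℝ (Fin ℓ)) :=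
    (MeasurableEquiv.toLp 2 (Fin ℓ → ℝ)).measurable
  have hγp : IsProbabilityMeasure ((CSP.limitLaw f δ ℓ).map
      (WithLp.toLp 2 : (Fin ℓ → ℝ) → EuclideanSpace ℝ (Fin ℓ))) :=
    Measure.isProbabilityMeasure_map htoLp.aemeasurable
  obtain ⟨B, -, hB⟩ := hψ.exists_abs_le
  refine ⟨(integrable_map_measure hc.aestronglyMeasurable htoLp.aemeasurable).1
    (CSP.integrable_of_abs_le hc hB (CSP.integrable_norm_pow_four_map_limitLaw f δ ℓ)),
    fun ε hε => ?_⟩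
  obtain ⟨d₀, h⟩ := CSP.Setting.exists_forall_lawFamily_abs_integral_sub_le f δ K L hℓL hψ hε
  refine ⟨max d₀ 2, fun d hd n m G hreg hgirth F FN hF _ hmom i a ha => ?_⟩
  let I : CSP.Setting f δ K L :=
    { n := n, m := m, d := d, G := G, F := F
      two_le := (le_max_right _ _).trans hd
      delta_pos := hδ
      no_linear := hlin
      regular := hreg
      girth := hgirth
      measurable_F := fun k hk i a => (hF k hk i a).1
      abs_F_le := fun k hk i a => (hF k hk i a).2
      integral_msgA_sq := fun k hk i a ha => (hmom k hk i a ha).2 }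
  obtain ⟨ι, hι⟩ := I.mem_incident_iff.1 ha
  obtain rfl : i = I.vert (a, ι) := hι.symm
  have hd' := (le_max_left _ _).trans hd
  obtain ⟨i1, e1⟩ := h d hd' _ ⟨I, rfl, (a, ι), Or.inl rfl⟩
  obtain ⟨i2, e2⟩ := h d hd' _ ⟨I, rfl, (a, ι), Or.inr rfl⟩
  obtain ⟨j1, k1⟩ := I.integrable_and_integral_normalizedSum _ hℓL hc i1
  obtain ⟨j2, k2⟩ := I.integrable_and_integral_normalizedSum _ hℓL hc i2
  rw [integral_map htoLp.aemeasurable hc.aestronglyMeasurable] at e1 e2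
  rw [← k1] at e1
  rw [← k2] at e2
  have hmsg : ∀ (z0 : Fin n → ℝ) (s : ℕ), CSP.msgU G f d F z0 (s + 1) (I.vert (a, ι)) a
      = I.normalizedSum (I.incoming (a, ι)) s z0 := fun z0 s => I.U_eq_card s (a, ι) z0
  have hnode : ∀ (z0 : Fin n → ℝ) (s : ℕ), CSP.nodeU G f d F z0 (s + 1) (I.vert (a, ι))
      = I.normalizedSum (I.slots (I.vert (a, ι))) s z0 := fun z0 s => by
    rw [CSP.Setting.normalizedSum, I.card_slots]
    exact I.nodeU_eq s _ z0
  simp only [hmsg, hnode]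
  exact ⟨⟨j1, e1⟩, ⟨j2, e2⟩⟩
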